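/- **Model.** A multi-prover interactive protocol $(V,\vec P)$ has, on inputs $x\in\{0,1\}^n$, $p(n)\ge 1$ provers and $k(n)\ge 1$ rounds. In odd rounds every prover sends $V$ a message, whose length is prescribed by the protocol; in even rounds $V$ sends a (possibly empty) private message to each prover. $V$ is one probabilistic multi-stack (equivalently, multi-tape) machine with random access, through binary addresses, to the input and to the prover messages received so far; one fresh random bit is available in each step. $V$ writes and sends its messages at unit cost per step (the buffers with the message and with the prover's index are emptied by sending), closing a round takes one step, and $V$ accesses only message bits that exist. The protocol has verification time $T(n)$ if $V$ halts within $T(n)$ steps on every input of length $n$, whatever the provers and the random bits do; its communication is at most $C(n)$ if at most $C(n)$ bits are transmitted in all, over all provers and rounds. At the end $V$ pays $R\in[0,1]$, a rational number that it has computed. A strategy of a prover maps, for each odd round, the transcript that this prover has seen to his message; $u(s;x)$ is the expected payment under the strategy profile $s$. The answer bit is the first bit of the first prover's round-1 message. The protocol is an MRIP protocol for a language $L\subseteq\{0,1\}^*$ if for every $x$ the maximum of $u(\cdot\,;x)$ is attained, and under every profile that attains it the answer bit is $1$ iff $x\in L$. It has a $\gamma(n)$-utility gap if for every $x$ with $|x|=n$,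 every profile $s$ that maximizes $u(\cdot\,;x)$, and every profile $s'$ with a different answer bit, $u(s;x)-u(s';x)>1/\gamma(n)$. **Lemma.** Let $(V,\vec P)$ be an MRIP protocol for a language $L$ with $p(n)$ provers, $k(n)$ rounds, verification time $T(n)$ and communication at most $C(n)$. Assume that $T$ is constructible: some machine as above, without provers, given any input of length $n$, halts after $O(T(n)+\log C(n))$ steps with a string of length $T(n)$ as its output. Then there are an MRIP protocol $(V',P_1',P_2')$ for the same language $L$, with exactly $2$ provers and $5$ rounds, and a constant $A$, such that for all $n$ the verification time and the communication of $(V',P_1',P_2')$ are at most $A\,(T(n)+\log C(n))$, and the second prover sends a single bit in total, in round $5$. Moreover, whenever $(V,\vec P)$ has a $\gamma(n)$-utility gap, $(V',P_1',P_2')$ has an $A\,(T(n)+C(n))^{A}\,\gamma(n)$-utility gap; in particular, the utility gap stays polynomial if $T$ and $C$ are polynomial. -/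

import Mathlib

namespace MRIP

/-- What a machine does to one of its stacks in one step. -/
inductive StackOp where
  | keep
  | pop
  | push (b : Bool)

/-- The effect of a stack operation; the head of the list is the top of the stack. -/
def StackOp.apply : StackOp → List Bool → List Bool
  | .keep, l => l
  | .pop, l => l.tail
  | .push b, l => b :: l

/-- The external moves of a verifier whose stacks are named by `K`. Each move takes its
arguments from stacks, on which addresses are written in binary. -/
inductive Move (K : Type) where
  /-- no external move -/
  | idle
  /-- read the bit of the input at the address on stack `a` -/
  | readInput (a : K)
  /-- read bit number `b` of the message that prover number `i` sent in round number `j` -/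
  | readMessage (i j b : K)
  /-- send the contents of stack `m` to prover number `i`; both stacks are emptied -/
  | send (i m : K)
  /-- close the current verifier round -/
  | nextRound

/-- A probabilistic machine with finitely many states and finitely many stacks of bits (two stacks
make one work tape), with random access to its input and to the messages it received. One step
looks at the state, the tops of all stacks, the result of the latest reading and one fresh random
bit, and yields a new state, one operation on each stack, and one external move, which takes
place after the stack operations. -/
structure Machine where
  /-- the states -/
  Q : Type
  /-- the names of the stacks -/
  K : Type
  [fintypeQ : Fintype Q]
  [fintypeK : Fintype K]
  [decEqQ : DecidableEq Q]
  [decEqK : DecidableEq K]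
  /-- the initial state -/
  start : Q
  /-- the final state -/
  halt : Q
  /-- the output stacks, for a numerator and a denominator -/
  num : K
  den : K
  /-- the transition function -/
  next : Q → (K → Option Bool) → Option Bool → Bool → Q × (K → StackOp) × Move K

attribute [instance] Machine.fintypeQ Machine.fintypeK Machine.decEqQ Machine.decEqK

/-- The number with the given binary digits, least significant digit first. -/
def binValue (l : List Bool) : ℕ := l.foldr Nat.bit 0

/-- The format of the conversation on the inputs of one length: the number of provers (numbered
from `0`), the number of rounds (numbered from `1`; provers speak in odd rounds, the verifier in
even ones), and the length of the message of prover `i` in the odd round `j`. -/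
structure Layout where
  provers : ℕ
  rounds : ℕ
  len : ℕ → ℕ → ℕ

/-- A strategy profile: `s i j t` is the message of prover `i` in round `j` if `t` is the transcript
that this prover has seen before, that is, the list of the messages exchanged between him and the
verifier in the rounds `1, …, j - 1`. -/
abbrev Profile : Type := ℕ → ℕ → List (List Bool) → List Bool

namespace Layout

/-- The transcript that prover `i` has seen after round `t`, where `sent i j` is the message of the
verifier to prover `i` in the even round `j`. Messages of provers are brought to the prescribed
length (cut, or filled up with zeros). -/
def transcript (Y : Layout) (s : Profile) (sent : ℕ → ℕ → List Bool) (i : ℕ) :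
    ℕ → List (List Bool)
  | 0 => []
  | t + 1 =>
    Y.transcript s sent i t ++
      [if Odd (t + 1) then (s i (t + 1) (Y.transcript s sent i t)).takeD (Y.len i (t + 1)) false
       else sent i (t + 1)]

/-- The message of prover `i` in the odd round `j`. -/
def message (Y : Layout) (s : Profile) (sent : ℕ → ℕ → List Bool) (i j : ℕ) : List Bool :=
  (s i j (Y.transcript s sent i (j - 1))).takeD (Y.len i j) false

/-- The total number of bits transmitted, over all provers and all rounds. -/
def totalBits (Y : Layout) (s : Profile) (sent : ℕ → ℕ → List Bool) : ℕ :=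
  ∑ i ∈ Finset.range Y.provers, ((Y.transcript s sent i Y.rounds).map List.length).sum

end Layout

namespace Machine

/-- A configuration: the state, the contents of the stacks, the result of the latest reading, the
number of the verifier round that is open, and the messages sent to each prover in each round. -/
structure Config (M : Machine) where
  state : M.Q
  stack : M.K → List Bool
  answer : Option Bool
  round : ℕ
  sent : ℕ → ℕ → List Bool

/-- At the beginning, the messages of round `1` have been received and round `2` is open. -/
def init (M : Machine) : M.Config where
  state := M.start
  stack := fun _ => []
  answer := none
  round := 2
  sent := fun _ _ => []

/-- The external moves. Reading the input beyond its end gives `none`. The result is `none` (the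
computation breaks down) if the verifier reads a message bit that has not been transmitted, writes
to a prover that does not exist, or speaks after the last round. -/
def act (M : Machine) (Y : Layout) (x : List Bool) (s : Profile) (c : M.Config) :
    Move M.K → Option M.Config
  | .idle => some c
  | .readInput a => some { c with answer := x[binValue (c.stack a)]? }
  | .readMessage i j b =>
    let i := binValue (c.stack i)
    let j := binValue (c.stack j)
    let b := binValue (c.stack b)
    if i < Y.provers ∧ Odd j ∧ j ≤ Y.rounds ∧ j < c.round ∧ b < Y.len i j then
      some { c with answer := (Y.message s c.sent i j)[b]? }
    else none
  | .send i m =>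
    let p := binValue (c.stack i)
    if p < Y.provers ∧ c.round ≤ Y.rounds then
      some { c with
        stack := Function.update (Function.update c.stack i []) m []
        sent := Function.update c.sent p
          (Function.update (c.sent p) c.round (c.sent p c.round ++ c.stack m)) }
    else none
  | .nextRound =>
    if c.round ≤ Y.rounds then some { c with round := c.round + 2 } else none

/-- One step of computation, with random bit `r`. -/
def step (M : Machine) (Y : Layout) (x : List Bool) (s : Profile) (r : Bool) (c : M.Config) :
    Option M.Config :=
  if c.state = M.halt then some c
  else
    let d := M.next c.state (fun a => (c.stack a).head?) c.answer r
    M.act Y x s { c with state := d.1, stack := fun a => (d.2.1 a).apply (c.stack a) } d.2.2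

/-- The configuration after `t` steps, where `r t` is the random bit of step `t`. -/
def run (M : Machine) (Y : Layout) (x : List Bool) (s : Profile) (r : ℕ → Bool) :
    ℕ → Option M.Config
  | 0 => some M.init
  | t + 1 => (M.run Y x s r t).bind (M.step Y x s (r t))

end Machine

/-- `f` can be computed in time `O(g)`: some machine, without provers, given any input of length
`n`, stops after `O(g n)` steps with a string of length `f n` on its first output stack. -/
def ComputableInTime (f g : ℕ → ℕ) : Prop :=
  ∃ (M : Machine) (a : ℕ), ∀ (x : List Bool) (r : ℕ → Bool),
    ∃ c, M.run ⟨0, 0, fun _ _ => 0⟩ x (fun _ _ _ => []) r (a * g x.length) = some c ∧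
      c.state = M.halt ∧ (c.stack M.num).length = f x.length

/-- A multi-prover protocol with payments. Its data depend on the input length only, apart from the
verifier, which is one machine for all inputs. There is at least one prover, and his first message
has a first bit, the answer bit. -/
structure Protocol where
  /-- the number of provers -/
  provers : ℕ → ℕ
  /-- the number of rounds -/
  rounds : ℕ → ℕ
  /-- the length of the message of a prover in an odd round -/
  len : ℕ → ℕ → ℕ → ℕ
  verifier : Machine
  /-- the running time of the verifier -/
  time : ℕ → ℕ
  provers_pos : ∀ n, 1 ≤ provers n
  rounds_pos : ∀ n, 1 ≤ rounds n
  len_pos : ∀ n, 1 ≤ len n 0 1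

namespace Protocol

/-- The format of the conversation on inputs of length `n`. -/
def layout (P : Protocol) (n : ℕ) : Layout := ⟨P.provers n, P.rounds n, P.len n⟩

/-- The computation of the verifier on input `x`, strategy profile `s` and random bits `r`. -/
def run (P : Protocol) (x : List Bool) (s : Profile) (r : ℕ → Bool) (t : ℕ) :
    Option P.verifier.Config :=
  P.verifier.run (P.layout x.length) x s r t

/-- On every input the verifier stops within its running time, whatever the provers and the random
bits do. -/
def HaltsInTime (P : Protocol) : Prop :=
  ∀ (x : List Bool) (s : Profile) (r : ℕ → Bool),
    ∃ c, P.run x s r (P.time x.length) = some c ∧ c.state = P.verifier.halt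

/-- At most `C n` bits are transmitted on inputs of length `n`. -/
def CommunicationAtMost (P : Protocol) (C : ℕ → ℕ) : Prop :=
  ∀ (x : List Bool) (s : Profile) (r : ℕ → Bool), ∀ c ∈ P.run x s r (P.time x.length),
    (P.layout x.length).totalBits s c.sent ≤ C x.length

/-- The payment, a rational number in `[0, 1]`: the fraction on the output stacks, capped at `1`. -/
noncomputable def payment (P : Protocol) (x : List Bool) (s : Profile) (r : ℕ → Bool) : ℝ :=
  match P.run x s r (P.time x.length) with
  | some c =>
    min 1 ((binValue (c.stack P.verifier.num) : ℝ) / (binValue (c.stack P.verifier.den) : ℝ))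
  | none => 0

/-- The expected payment `u(s; x)`, over uniform random bits, one for each step. -/
noncomputable def utility (P : Protocol) (x : List Bool) (s : Profile) : ℝ :=
  (∑ r : Fin (P.time x.length) → Bool,
    P.payment x s (fun t => if h : t < P.time x.length then r ⟨t, h⟩ else false)) /
      2 ^ P.time x.length

/-- The answer bit: the first bit that the first prover sends in round `1`. -/
def answerBit (P : Protocol) (x : List Bool) (s : Profile) : Bool :=
  ((s 0 1 []).takeD (P.len x.length 0 1) false).headD false

/-- The strategy profile `s` maximizes the expected payment on input `x`. -/
def IsOptimal (P : Protocol) (x : List Bool) (s : Profile) : Prop :=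
  ∀ s', P.utility x s' ≤ P.utility x s

/-- `P` is a multi-prover rational interactive proof protocol for `L`: the expected payment has a
maximum, and whenever it is attained, the answer bit tells whether `x ∈ L`. -/
structure IsMRIP (P : Protocol) (L : Language Bool) : Prop where
  halts : P.HaltsInTime
  exists_optimal : ∀ x, ∃ s, P.IsOptimal x s
  correct : ∀ x s, P.IsOptimal x s → (P.answerBit x s = true ↔ x ∈ L)

/-- `P` has a `γ(n)`-utility gap: a strategy profile with another answer bit than an optimal one
loses more than `1 / γ(n)`. -/
def HasUtilityGap (P : Protocol) (γ : ℕ → ℝ) : Prop :=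
  ∀ x s s', P.IsOptimal x s → P.answerBit x s' ≠ P.answerBit x s →
    1 < γ x.length * (P.utility x s - P.utility x s')

end Protocol

end MRIP

open MRIP

/-!
The verifier of the two-prover protocol simulates the given verifier `V` on random bits `r` that it
draws itself. It computes the running time `T` of `V`, draws `T` random bits, tells them to the
first prover in round 2, and receives in round 3 one bit for each step of `V`: the message bit that
`V` reads in this step, if it reads one. With these claimed bits it simulates `V` step by step. Its
running time is linear in `T`, because it never looks at the messages of the provers of `V`
themselves, whose length may be exponential in `T`.

The second prover stands for all provers of `V`. In round 4 he is asked for one bit of one message,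
and the query contains all that the prover in question has received before: the verifier keeps a
log of the messages that `V` sends, and `goes_query` filters it. As the second prover knows neither
the random bits nor the claims, his strategy is a function `f` of the query, and such a function is
the same thing as a strategy profile for `V` (`profileOf`, `oracleOf`,
`Layout.message_profileOf_oracleOf`). If all claimed bits agree with `f`, the simulation follows the
computation of `V` with this profile (`Sim.Rel.step`, `simPay_of_consistent`).

The payment is one of two. With probability `δ = 2 ^ (-(d + 1))`, where `d` is the number of binary
digits of `T`, the verifier pays what `V` would pay. Otherwise it checks one claimed bit against the
reply of the second prover, and pays `1` if they agree and `0` if not. The bit is chosen by a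
counter that starts from `d` random digits and is incremented once for each step: a step is marked
if the counter overflows. There is at most one mark, each step is marked for some choice of the digits
(`exists_mark`), and for some choice no step is marked (`exists_no_mark`). If no marked step reads a
message bit, the answer bit, which the first prover has sent in round 1, is checked against the
first bit of his first message according to `f`. A wrong claim or a wrong answer bit is therefore
found out with probability at least `2 ^ (-d)` given that there is a check, and this costs more than
the payment of `V` may gain (`value_le`, `value_le_of_ne`).

Hence the utility of a profile is at most `δ * u(f) + (1 - δ)`, where `u(f)` is the utility in the
given protocol of the profile that belongs to `f`, and this is attained if the first prover is
truthful (`utility_twoProver_le`, `utility_honestProfile`). So in every optimal profile the second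
prover follows an optimal profile of the given protocol and confirms the answer bit
(`twoProver_optimal`). A wrong answer bit loses the utility gap of the given protocol times `δ`, or
`2 ^ (-d) / 4` if `f` does not confirm it, and both `δ` and `2 ^ (-d)` are of the order `1 / T`
(`twoProver_gap`). A verifier with `T = 0` pays a
constant, which contradicts the condition on the answer bit, so that `T` is positive.

The larger part of the text is the construction of the verifier as a machine, `simulator`, and the
analysis of its computation, which ends with `goes_verifier`. Its time is linear in `T` as counters
have amortized constant cost and the simulation satisfies a bound in terms of a potential
(`goes_sim`). The lemmas `goes_*` are stated backwards: what the verifier reaches after a phase, it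
reaches from before this phase.
-/

namespace MRIP

/-! ### Averages over random bits -/

/-- The expectation of `F` over a uniformly random list of `n` bits. -/
noncomputable def avgBits : ℕ → (List Bool → ℝ) → ℝ
  | 0, F => F []
  | n + 1, F => (avgBits n (fun l => F (false :: l)) + avgBits n (fun l => F (true :: l))) / 2

theorem avgBits_congr {n : ℕ} {F G : List Bool → ℝ} (h : ∀ l, l.length = n → F l = G l) :
    avgBits n F = avgBits n G := by
  induction n generalizing F G with
  | zero => exact h [] rfl
  | succ n ih =>
    simp only [avgBits]
    rw [ih (F := fun l => F (false :: l)) (G := fun l => G (false :: l))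
        fun l hl => h _ (by simp [hl]),
      ih (F := fun l => F (true :: l)) (G := fun l => G (true :: l))
        fun l hl => h _ (by simp [hl])]

theorem avgBits_le {n : ℕ} {F G : List Bool → ℝ} (h : ∀ l, l.length = n → F l ≤ G l) :
    avgBits n F ≤ avgBits n G := by
  induction n generalizing F G with
  | zero => exact h [] rfl
  | succ n ih =>
    simp only [avgBits]
    have h0 := ih (F := fun l => F (false :: l)) (G := fun l => G (false :: l))
      (fun l hl => h _ (by simp [hl]))
    have h1 := ih (F := fun l => F (true :: l)) (G := fun l => G (true :: l))
      (fun l hl => h _ (by simp [hl]))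
    linarith

theorem avgBits_affine (n : ℕ) (F : List Bool → ℝ) (a b : ℝ) :
    avgBits n (fun l => a * F l + b) = a * avgBits n F + b := by
  induction n generalizing F with
  | zero => rfl
  | succ n ih =>
    simp only [avgBits]
    rw [ih (fun l => F (false :: l)), ih (fun l => F (true :: l))]
    ring

theorem avgBits_const (n : ℕ) (a : ℝ) : avgBits n (fun _ => a) = a := by
  simpa using avgBits_affine n (fun _ => 0) 0 a

theorem avgBits_add (m n : ℕ) (F : List Bool → ℝ) :
    avgBits (m + n) F = avgBits m (fun l => avgBits n (fun l' => F (l ++ l'))) := by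
  induction m generalizing F with
  | zero => simp [avgBits]
  | succ m ih => rw [Nat.succ_add]; simp only [avgBits, ih, List.cons_append]

theorem avgBits_reverse (n : ℕ) (F : List Bool → ℝ) :
    avgBits n (fun l => F l.reverse) = avgBits n F := by
  induction n generalizing F with
  | zero => rfl
  | succ n ih =>
    rw [avgBits_add n 1 F]
    simp only [avgBits, List.reverse_cons]
    rw [ih (fun l => F (l ++ [false])), ih (fun l => F (l ++ [true]))]
    clear ih
    induction n generalizing F with
    | zero => simp [avgBits]
    | succ n ih =>
      simp only [avgBits, List.cons_append]
      rw [← ih (fun l => F (false :: l)), ← ih (fun l => F (true :: l))]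
      ring

/-- One bad list among the `2 ^ n` equally likely ones costs at least `2⁻ⁿ`. -/
theorem avgBits_le_of_eq_zero {n : ℕ} {F : List Bool → ℝ} (h : ∀ l, l.length = n → F l ≤ 1)
    {l₀ : List Bool} (h₀ : l₀.length = n) (hF : F l₀ ≤ 0) :
    avgBits n F ≤ 1 - (1 / 2) ^ n := by
  induction n generalizing F l₀ with
  | zero =>
    obtain rfl := List.length_eq_zero_iff.1 h₀
    simpa [avgBits] using hF
  | succ n ih =>
    obtain ⟨b, l, rfl⟩ : ∃ b l, l₀ = b :: l := by
      cases l₀ with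
      | nil => simp at h₀
      | cons b l => exact ⟨b, l, rfl⟩
    have hl : l.length = n := by simpa using h₀
    have hle : ∀ c, avgBits n (fun l => F (c :: l)) ≤ 1 := fun c =>
      (avgBits_le (G := fun _ => 1) (fun l hl => h _ (by simp [hl]))).trans_eq (avgBits_const n 1)
    have hb := ih (F := fun l => F (b :: l)) (fun l hl => h _ (by simp [hl])) hl hF
    have h0 := hle false
    have h1 := hle true
    simp only [avgBits, pow_succ]
    cases b <;> linarith

/-- The event that `n` random bits are all `true` has probability `2⁻ⁿ`. -/
theorem avgBits_all (n : ℕ) (a b : ℝ) :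
    avgBits n (fun l => if l.all id then a else b) = (1 / 2) ^ n * a + (1 - (1 / 2) ^ n) * b := by
  induction n with
  | zero => simp [avgBits]
  | succ n ih =>
    have h : avgBits (n + 1) (fun l => if l.all id then a else b) =
        (b + avgBits n (fun l => if l.all id then a else b)) / 2 := by
      simp only [avgBits, List.all_cons, id, Bool.false_and, Bool.true_and]
      rw [show (fun _ : List Bool => if false = true then a else b) = fun _ => b by simp,
        avgBits_const]
    rw [h, ih, pow_succ]; ring

/-- The average over random bits that are indexed by their times. -/
theorem sum_bits_div (n : ℕ) (G : (ℕ → Bool) → ℝ) :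
    (∑ r : Fin n → Bool, G (fun t => if h : t < n then r ⟨t, h⟩ else false)) / 2 ^ n =
      avgBits n (fun l => G (fun t => l.getD t false)) := by
  induction n generalizing G with
  | zero => simp [avgBits]
  | succ n ih =>
    have key : ∀ b : Bool, avgBits n (fun l => G (fun t => (b :: l).getD t false)) =
        (∑ r : Fin n → Bool, G (fun t => if h : t < n + 1 then
          (Fin.cons b r : Fin (n + 1) → Bool) ⟨t, h⟩ else false)) / 2 ^ n := by
      intro b
      have := ih (fun tp => G (fun t => Nat.casesOn t b tp))
      have e1 : ∀ l : List Bool, (fun t => (b :: l).getD t false) =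
          (fun t => Nat.casesOn (motive := fun _ => Bool) t b (fun t => l.getD t false)) := by
        intro l; funext t; cases t <;> simp
      simp only [e1]
      rw [← this]
      congr 1
      refine Finset.sum_congr rfl fun r _ => ?_
      congr 1
      funext t
      cases t with
      | zero => simp
      | succ t =>
        by_cases h : t < n
        · simp only [h, dif_pos, Nat.succ_lt_succ h]
          exact (Fin.cons_succ (α := fun _ => Bool) b r ⟨t, h⟩).symm
        · simp [h]
    simp only [avgBits, key]
    rw [← (Fin.consEquiv (fun _ : Fin (n + 1) => Bool)).sum_comp, Fintype.sum_prod_type]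
    simp only [Fintype.sum_bool, Fin.consEquiv, Equiv.coe_fn_mk]
    rw [pow_succ]
    field_simp
    ring

/-! ### Computations of machines -/

namespace Machine

/-- The computation from the configuration `c` that uses up a list of random bits. -/
def runL (M : Machine) (Y : Layout) (x : List Bool) (s : Profile) :
    List Bool → M.Config → Option M.Config
  | [], c => some c
  | b :: l, c => (M.step Y x s b c).bind (M.runL Y x s l)

variable {M : Machine} {Y : Layout} {x : List Bool} {s : Profile}

theorem runL_append (l l' : List Bool) (c : M.Config) :
    M.runL Y x s (l ++ l') c = (M.runL Y x s l c).bind (M.runL Y x s l') := by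
  induction l generalizing c with
  | nil => rfl
  | cons b l ih =>
    simp only [List.cons_append, runL]
    cases M.step Y x s b c with
    | none => rfl
    | some c' => simp [ih]

theorem run_eq_runL (r : ℕ → Bool) (t : ℕ) :
    M.run Y x s r t = M.runL Y x s ((List.range t).map r) M.init := by
  induction t with
  | zero => rfl
  | succ t ih =>
    rw [run, ih, List.range_succ, List.map_append, runL_append]
    congr 1
    funext c
    simp [runL]

theorem run_getD (l : List Bool) :
    M.run Y x s (fun t => l.getD t false) l.length = M.runL Y x s l M.init := by
  rw [run_eq_runL]
  congr 1
  apply List.ext_getElem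
  · simp
  · intro i h1 h2
    simp [h2]

/-- `M.Reach Y x s D c l n c'`: from `c` the machine gets to `c'` within `n` steps if `l` is the
list of the random bits that it receives in the states of `D`, whatever its random bits in the
other states are. -/
inductive Reach (M : Machine) (Y : Layout) (x : List Bool) (s : Profile) (D : M.Q → Prop) :
    M.Config → List Bool → ℕ → M.Config → Prop
  | refl (c : M.Config) (n : ℕ) : Reach M Y x s D c [] n c
  | det {c c₁ c' : M.Config} {l : List Bool} {n : ℕ} (hD : ¬ D c.state)
      (h : ∀ b, M.step Y x s b c = some c₁) (h' : Reach M Y x s D c₁ l n c') :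
      Reach M Y x s D c l (n + 1) c'
  | draw {c c₁ c' : M.Config} {b : Bool} {l : List Bool} {n : ℕ} (hD : D c.state)
      (h : M.step Y x s b c = some c₁) (h' : Reach M Y x s D c₁ l n c') :
      Reach M Y x s D c (b :: l) (n + 1) c'

variable {D : M.Q → Prop} {c c' c₁ c₂ : M.Config} {l l' : List Bool} {n n' : ℕ}

theorem Reach.mono (h : M.Reach Y x s D c l n c') (hn : n ≤ n') : M.Reach Y x s D c l n' c' := by
  induction h generalizing n' with
  | refl => exact .refl _ _
  | det hD hs _ ih =>
    obtain ⟨k, rfl⟩ : ∃ k, n' = k + 1 := ⟨n' - 1, by omega⟩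
    exact .det hD hs (ih (by omega))
  | draw hD hs _ ih =>
    obtain ⟨k, rfl⟩ : ∃ k, n' = k + 1 := ⟨n' - 1, by omega⟩
    exact .draw hD hs (ih (by omega))

theorem Reach.eq_of_halt (h : M.Reach Y x s D c l n c') (hc : c.state = M.halt)
    (hD : ¬ D M.halt) : c' = c ∧ l = [] := by
  induction h with
  | refl => exact ⟨rfl, rfl⟩
  | @det c c₁ _ _ _ _ hs _ ih =>
    have h1 : c₁ = c := by simpa [step, hc] using (hs true).symm
    subst h1
    exact ih hc
  | draw hD' => exact absurd (hc ▸ hD') hD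

theorem runL_halt (l : List Bool) (hc : c.state = M.halt) : M.runL Y x s l c = some c := by
  induction l with
  | nil => rfl
  | cons b l ih => simp [runL, step, hc, ih]

/-- The expected value of a function of the final configuration, if the machine halts in time `n`
with the result `F l`, where `l` consists of the `d` random bits that matter. -/
theorem avgBits_runL (hD : ¬ D M.halt) (g : Option M.Config → ℝ) (n d : ℕ) (c : M.Config)
    (F : List Bool → ℝ)
    (h : ∀ l, l.length = d →
      ∃ c', M.Reach Y x s D c l n c' ∧ c'.state = M.halt ∧ g (some c') = F l) :
    avgBits n (fun l => g (M.runL Y x s l c)) = avgBits d F := by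
  induction n generalizing c d F with
  | zero =>
    obtain ⟨c', hr, hc', -⟩ := h (List.replicate d true) (by simp)
    have hc : c.state = M.halt := by
      generalize List.replicate d true = l at hr
      cases hr
      exact hc'
    have hd : d = 0 := by
      have := (hr.eq_of_halt hc hD).2
      simpa using congrArg List.length this
    subst hd
    obtain ⟨c', hr, -, hg⟩ := h [] rfl
    obtain rfl := (hr.eq_of_halt hc hD).1
    simpa [avgBits, runL] using hg
  | succ n ih =>
    by_cases hc : c.state = M.halt
    · obtain ⟨c', hr, hc', -⟩ := h (List.replicate d true) (by simp)
      have hd : d = 0 := by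
        have := (hr.eq_of_halt hc hD).2
        simpa using congrArg List.length this
      subst hd
      obtain ⟨c', hr, -, hg⟩ := h [] rfl
      obtain rfl := (hr.eq_of_halt hc hD).1
      simp only [runL_halt _ hc, avgBits_const]
      exact hg
    · by_cases hDc : D c.state
      · obtain ⟨d, rfl⟩ : ∃ e, d = e + 1 := by
          cases d with
          | succ e => exact ⟨e, rfl⟩
          | zero =>
            obtain ⟨c', hr, hc', -⟩ := h [] rfl
            cases hr with
            | refl => exact absurd hc' hc
            | det hD' => exact absurd hDc hD'
        have key : ∀ b, avgBits n (fun l => g (M.runL Y x s (b :: l) c)) =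
            avgBits d (fun l => F (b :: l)) := by
          intro b
          obtain ⟨c₁, hc₁⟩ : ∃ c₁, M.step Y x s b c = some c₁ := by
            obtain ⟨c', hr, -⟩ := h (b :: List.replicate d true) (by simp)
            cases hr with
            | det hD' => exact absurd hDc hD'
            | draw _ hs => exact ⟨_, hs⟩
          simp only [runL, hc₁, Option.bind_some]
          refine ih d c₁ (fun l => F (b :: l)) fun l hl => ?_
          obtain ⟨c', hr, hc', hg⟩ := h (b :: l) (by simp [hl])
          cases hr with
          | det hD' => exact absurd hDc hD'
          | draw _ hs hr =>
            obtain rfl : c₁ = _ := Option.some.inj (hc₁.symm.trans hs)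
            exact ⟨c', hr, hc', hg⟩
        simp only [avgBits, key]
      · obtain ⟨c₁, hc₁⟩ : ∃ c₁, ∀ b, M.step Y x s b c = some c₁ := by
          obtain ⟨c', hr, hc', -⟩ := h (List.replicate d true) (by simp)
          generalize List.replicate d true = l at hr
          cases hr with
          | refl => exact absurd hc' hc
          | det _ hs => exact ⟨_, hs⟩
          | draw hD' => exact absurd hD' hDc
        simp only [avgBits, runL, hc₁, Option.bind_some, add_self_div_two]
        refine ih d c₁ F fun l hl => ?_
        obtain ⟨c', hr, hc', hg⟩ := h l hl
        cases hr with
        | refl => exact absurd hc' hc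
        | det _ hs hr =>
          obtain rfl : c₁ = _ := Option.some.inj ((hc₁ true).symm.trans (hs true))
          exact ⟨c', hr, hc', hg⟩
        | draw hD' => exact absurd hD' hDc

/-- If the machine halts in time `n` for each sequence of the `d` random bits that matter, then it
halts in time `n` for each sequence of random bits. -/
theorem runL_of_reach (hD : ¬ D M.halt) (p : M.Config → Prop) (l : List Bool) (d : ℕ)
    (c : M.Config)
    (h : ∀ l', l'.length = d → ∃ c', M.Reach Y x s D c l' l.length c' ∧ c'.state = M.halt ∧ p c') :
    ∃ c', M.runL Y x s l c = some c' ∧ c'.state = M.halt ∧ p c' := by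
  induction l generalizing c d with
  | nil =>
    obtain ⟨c', hr, hc', hp⟩ := h (List.replicate d true) (by simp)
    generalize List.replicate d true = l at hr
    cases hr
    exact ⟨c, rfl, hc', hp⟩
  | cons b l ih =>
    simp only [runL]
    obtain ⟨c', hr, hc', hp⟩ := h (List.replicate d b) (by simp)
    by_cases hc : c.state = M.halt
    · obtain rfl := (hr.eq_of_halt hc hD).1
      exact ⟨c', by simp [step, hc, runL_halt], hc, hp⟩
    · by_cases hDc : D c.state
      · cases d with
        | zero =>
          cases hr with
          | refl => exact absurd hc' hc
          | det hD' => exact absurd hDc hD'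
        | succ d =>
          cases hr with
          | det hD' => exact absurd hDc hD'
          | @draw _ c₁ _ _ _ _ _ hs hr =>
            rw [hs]
            refine ih d c₁ fun l' hl' => ?_
            obtain ⟨c', hr, hc', hp⟩ := h (b :: l') (by simp [hl'])
            cases hr with
            | det hD' => exact absurd hDc hD'
            | draw _ hs' hr =>
              obtain rfl : c₁ = _ := Option.some.inj (hs.symm.trans hs')
              exact ⟨c', hr, hc', hp⟩
      · obtain ⟨c₁, hc₁⟩ : ∃ c₁, ∀ b, M.step Y x s b c = some c₁ := by
          generalize List.replicate d b = l at hr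
          cases hr with
          | refl => exact absurd hc' hc
          | det _ hs => exact ⟨_, hs⟩
          | draw hD' => exact absurd hD' hDc
        rw [hc₁]
        refine ih d c₁ fun l hl => ?_
        obtain ⟨c', hr, hc', hg⟩ := h l hl
        cases hr with
        | refl => exact absurd hc' hc
        | det _ hs hr =>
          obtain rfl : c₁ = _ := Option.some.inj ((hc₁ true).symm.trans (hs true))
          exact ⟨c', hr, hc', hg⟩
        | draw hD' => exact absurd hD' hDc

end Machine

end MRIP

namespace MRIP

/-! ### Queries to the second prover -/

/-- The symbols of the logs and of the query: `(false, b)` stands for the bit `b`, and `endMark`,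
`roundMark` are separators. -/
abbrev Tok : Type := Bool × Bool

/-- The separator that closes a string. -/
def endMark : Tok := (true, false)

/-- The separator that closes a round. -/
def roundMark : Tok := (true, true)

/-- A string of bits as a list of symbols. -/
def dat (l : List Bool) : List Tok := l.map fun b => (false, b)

@[simp] theorem dat_nil : dat [] = [] := rfl
@[simp] theorem dat_cons (b : Bool) (l : List Bool) : dat (b :: l) = (false, b) :: dat l := rfl
@[simp] theorem dat_append (l l' : List Bool) : dat (l ++ l') = dat l ++ dat l' := by simp [dat]
@[simp] theorem length_dat (l : List Bool) : (dat l).length = l.length := by simp [dat]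

/-- A list of strings as a list of symbols. -/
def blocks (L : List (List Bool)) : List Tok := L.flatMap fun l => dat l ++ [endMark]

@[simp] theorem blocks_nil : blocks [] = [] := rfl
@[simp] theorem blocks_cons (l : List Bool) (L : List (List Bool)) :
    blocks (l :: L) = dat l ++ endMark :: blocks L := by simp [blocks]
@[simp] theorem blocks_append (L L' : List (List Bool)) :
    blocks (L ++ L') = blocks L ++ blocks L' := by simp [blocks]

theorem dat_append_endMark_inj {l l' : List Bool} {t t' : List Tok}
    (h : dat l ++ endMark :: t = dat l' ++ endMark :: t') : l = l' ∧ t = t' := by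
  induction l generalizing l' with
  | nil => cases l' <;> simp_all [endMark]
  | cons b l ih =>
    cases l' with
    | nil => simp [endMark] at h
    | cons b' l' =>
      simp only [dat_cons, List.cons_append, List.cons.injEq, Prod.mk.injEq, true_and] at h
      obtain ⟨h1, h2⟩ := ih h.2
      exact ⟨by rw [h.1, h1], h2⟩

theorem blocks_injective : Function.Injective blocks := by
  intro L
  induction L with
  | nil => intro L' h; cases L' <;> simp_all
  | cons l L ih =>
    intro L' h
    cases L' with
    | nil => simp at h
    | cons l' L' =>
      simp only [blocks_cons] at h
      obtain ⟨h1, h2⟩ := dat_append_endMark_inj h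
      rw [h1, ih h2]

/-- The query for bit `b` of the message of prover `i` in round `j`, where `out` describes the
messages that he has received before; last symbol first, as on a stack. -/
def queryToks (i j b : ℕ) (out : List Tok) : List Tok :=
  (blocks [b.bits.reverse, j.bits.reverse, i.bits.reverse] ++ out).reverse

theorem binValue_bits (n : ℕ) : binValue n.bits = n := by
  induction n using Nat.binaryRec' with
  | zero => rfl
  | bit b n h ih => rw [Nat.bits_append_bit _ _ h, binValue, List.foldr_cons]; exact congrArg _ ih

theorem queryToks_blocks_inj {i j b i' j' b' : ℕ} {L L' : List (List Bool)}
    (h : queryToks i j b (blocks L) = queryToks i' j' b' (blocks L')) :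
    i = i' ∧ j = j' ∧ b = b' ∧ L = L' := by
  have h1 := List.reverse_injective h
  rw [← blocks_append, ← blocks_append] at h1
  have h2 := blocks_injective h1
  simp only [List.cons_append, List.nil_append, List.cons.injEq, List.reverse_inj] at h2
  have hb : ∀ {m n : ℕ}, m.bits = n.bits → m = n := fun {m n} hmn => by
    rw [← binValue_bits m, hmn, binValue_bits]
  exact ⟨hb h2.2.2.1, hb h2.2.1, hb h2.1, h2.2.2.2⟩

/-- A list of symbols as it is sent. -/
def wire (q : List Tok) : List Bool := q.map Prod.fst ++ q.map Prod.snd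

theorem wire_injective : Function.Injective wire := by
  intro q q' h
  have hl : q.length = q'.length := by
    have := congrArg List.length h
    simp only [wire, List.length_append, List.length_map] at this
    omega
  obtain ⟨h1, h2⟩ := List.append_inj h (by simpa using hl)
  apply List.ext_getElem hl
  intro n hn hn'
  have e1 := congrArg (fun l => l[n]?) h1
  have e2 := congrArg (fun l => l[n]?) h2
  simp [hn, hn'] at e1 e2
  exact Prod.ext e1 e2

/-! ### Strategies of the second prover and strategy profiles -/

/-- The messages of the verifier in a transcript. -/
def evens : List (List Bool) → List (List Bool)
  | _ :: m :: t => m :: evens t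
  | _ => []

theorem evens_append {t : List (List Bool)} (ht : Even t.length) (t' : List (List Bool)) :
    evens (t ++ t') = evens t ++ evens t' := by
  induction t using evens.induct with
  | case1 a m t ih =>
    simp only [List.length_cons, Nat.even_add_one, not_not] at ht
    simp [evens, ih ht]
  | case2 t h =>
    match t, h, ht with
    | [], _, _ => rfl
    | [_], _, ht => simp at ht
    | a :: b :: t, h, _ => exact (h a b t rfl).elim

/-- The profile in which the provers say what the second prover answers if he follows `f`. -/
def profileOf (f : List Tok → Bool) (len : ℕ → ℕ → ℕ) : Profile := fun i j t =>
  (List.range (len i j)).map fun b => f (queryToks i j b (blocks (evens t)))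

namespace Layout

variable (Y : Layout)

theorem length_transcript (s : Profile) (sent : ℕ → ℕ → List Bool) (i t : ℕ) :
    (Y.transcript s sent i t).length = t := by
  induction t with
  | zero => rfl
  | succ t ih => simp [transcript, ih]

theorem evens_transcript (s : Profile) (sent : ℕ → ℕ → List Bool) (i h : ℕ) :
    evens (Y.transcript s sent i (2 * h)) = (List.range h).map fun k => sent i (2 * k + 2) := by
  induction h with
  | zero => rfl
  | succ h ih =>
    rw [show 2 * (h + 1) = 2 * h + 1 + 1 by ring, transcript, transcript, List.append_assoc,
      evens_append (by simp [length_transcript]), ih, List.range_succ, List.map_append]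
    simp [evens, parity_simps]

theorem transcript_congr (s : Profile) {sent sent' : ℕ → ℕ → List Bool} (i t : ℕ)
    (h : ∀ k, 2 * k + 2 ≤ t → sent i (2 * k + 2) = sent' i (2 * k + 2)) :
    Y.transcript s sent i t = Y.transcript s sent' i t := by
  induction t with
  | zero => rfl
  | succ t ih =>
    rw [transcript, transcript, ih fun k hk => h k (by omega)]
    by_cases ho : Odd (t + 1)
    · simp [ho]
    · obtain ⟨k, hk⟩ := Nat.not_odd_iff_even.1 ho
      simp only [ho, if_false]
      have := h (k - 1) (by omega)
      rw [show 2 * (k - 1) + 2 = t + 1 by omega] at this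
      rw [this]

theorem length_message (s : Profile) (sent : ℕ → ℕ → List Bool) (i j : ℕ) :
    (Y.message s sent i j).length = Y.len i j := by
  simp [message]

theorem message_profileOf (f : List Tok → Bool) (sent : ℕ → ℕ → List Bool) (i h b : ℕ)
    (hb : b < Y.len i (2 * h + 1)) :
    (Y.message (profileOf f Y.len) sent i (2 * h + 1))[b]? =
      some (f (queryToks i (2 * h + 1) b
        (blocks ((List.range h).map fun k => sent i (2 * k + 2))))) := by
  rw [message, Nat.add_sub_cancel, List.takeD_eq_take _ (by simp [profileOf]), profileOf,
    evens_transcript, List.getElem?_take, if_pos hb, List.getElem?_map, List.getElem?_range hb]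
  rfl

open Classical in
/-- The strategy of the second prover that answers according to the profile `s`. -/
noncomputable def oracleOf (s : Profile) (q : List Tok) : Bool :=
  if h : ∃ a : ℕ × ℕ × ℕ × List (List Bool), queryToks a.1 a.2.1 a.2.2.1 (blocks a.2.2.2) = q then
    ((Y.message s (fun _ j => h.choose.2.2.2.getD (j / 2 - 1) []) h.choose.1
      h.choose.2.1)[h.choose.2.2.1]?).getD false
  else false

theorem oracleOf_queryToks (s : Profile) (i j b : ℕ) (L : List (List Bool)) :
    Y.oracleOf s (queryToks i j b (blocks L)) =
      ((Y.message s (fun _ j => L.getD (j / 2 - 1) []) i j)[b]?).getD false := by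
  have h : ∃ a : ℕ × ℕ × ℕ × List (List Bool), queryToks a.1 a.2.1 a.2.2.1 (blocks a.2.2.2) =
    queryToks i j b (blocks L) := ⟨(i, j, b, L), rfl⟩
  obtain ⟨h1, h2, h3, h4⟩ := queryToks_blocks_inj h.choose_spec
  rw [oracleOf, dif_pos h, h1, h2, h3, h4]

/-- A query determines what it asks about, so that the answers of the second prover can reproduce
every profile. -/
theorem message_profileOf_oracleOf (s : Profile) (sent : ℕ → ℕ → List Bool) (i j : ℕ)
    (hj : Odd j) :
    Y.message (profileOf (Y.oracleOf s) Y.len) sent i j = Y.message s sent i j := by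
  obtain ⟨h, rfl⟩ := hj
  apply List.ext_getElem?
  intro b
  by_cases hb : b < Y.len i (2 * h + 1)
  · rw [message_profileOf _ _ _ _ _ _ hb, oracleOf_queryToks]
    have : Y.message s (fun _ j => ((List.range h).map fun k => sent i (2 * k + 2)).getD
        (j / 2 - 1) []) i (2 * h + 1) = Y.message s sent i (2 * h + 1) := by
      rw [message, message, transcript_congr]
      intro k hk
      have hk' : k < h := by omega
      rw [show (2 * k + 2) / 2 - 1 = k by omega]
      simp [hk']
    rw [this, List.getElem?_eq_getElem (by rwa [length_message])]
    rfl
  · rw [List.getElem?_eq_none (by rw [length_message]; omega),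
      List.getElem?_eq_none (by rw [length_message]; omega)]

end Layout

/-! ### The simulation with claimed message bits -/

/-- What the log of a simulation records: a message sent, with the index of the prover and the
string as they stand on the stacks, or (`none`) the end of a round. -/
abbrev Event : Type := Option (List Bool × List Bool)

/-- The messages that prover `i` has received, up to the end of `h` rounds; the log begins with the
oldest event. -/
def outToks (i : ℕ) : ℕ → List Event → List Tok
  | 0, _ => []
  | _ + 1, [] => []
  | h + 1, none :: L => endMark :: outToks i h L
  | h + 1, some (e, m) :: L => (if binValue e = i then dat m else []) ++ outToks i (h + 1) L

/-- The effect of an event on the number of the open round and on the messages sent. -/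
def replayEvent (st : ℕ × (ℕ → ℕ → List Bool)) : Event → ℕ × (ℕ → ℕ → List Bool)
  | none => (st.1 + 2, st.2)
  | some (e, m) => (st.1, Function.update st.2 (binValue e)
      (Function.update (st.2 (binValue e)) st.1 (st.2 (binValue e) st.1 ++ m)))

/-- Later events do not change the messages of rounds that are closed. -/
theorem replay_old (L : List Event) (st : ℕ × (ℕ → ℕ → List Bool)) :
    st.1 ≤ (L.foldl replayEvent st).1 ∧
      ∀ i k, k < st.1 → (L.foldl replayEvent st).2 i k = st.2 i k := by
  induction L generalizing st with
  | nil => exact ⟨le_rfl, fun _ _ _ => rfl⟩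
  | cons e L ih =>
    rw [List.foldl_cons]
    obtain ⟨h1, h2⟩ := ih (replayEvent st e)
    match e with
    | none =>
      simp only [replayEvent] at h1 h2 ⊢
      exact ⟨by omega, fun i k hk => h2 i k (by omega)⟩
    | some (e, m) =>
      refine ⟨h1, fun i k hk => (h2 i k hk).trans ?_⟩
      simp only [replayEvent]
      by_cases hi : i = binValue e
      · subst hi; simp [hk.ne]
      · simp [hi]

theorem blocks_replay_aux (i : ℕ) (L : List Event) (st : ℕ × (ℕ → ℕ → List Bool)) (h : ℕ)
    (hst : ∀ i k, st.1 < k → st.2 i k = [])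
    (hh : st.1 + 2 * (h + 1) ≤ (L.foldl replayEvent st).1) :
    blocks ((List.range (h + 1)).map fun k => (L.foldl replayEvent st).2 i (2 * k + st.1)) =
      dat (st.2 i st.1) ++ outToks i (h + 1) L := by
  induction L generalizing st h with
  | nil => simp at hh
  | cons e L ih =>
    rw [List.foldl_cons] at hh ⊢
    match e with
    | none =>
      have hold := (replay_old L (replayEvent st none)).2 i st.1 (by simp [replayEvent])
      rw [List.range_succ_eq_map, List.map_cons, blocks_cons, Nat.mul_zero, Nat.zero_add, hold,
        outToks, List.map_map]
      have e2 : (replayEvent st none).2 = st.2 := rfl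
      rw [e2]
      congr 2
      cases h with
      | zero => simp [outToks]
      | succ h =>
        have := ih (replayEvent st none) h
          (fun i k hk => hst i k (by simp [replayEvent] at hk; omega))
          (by simp only [replayEvent] at hh ⊢; omega)
        rw [e2, hst i _ (by simp [replayEvent]), dat_nil, List.nil_append] at this
        rw [← this]
        congr 1
        refine List.map_congr_left fun k _ => ?_
        simp only [Function.comp, replayEvent]
        rw [Nat.succ_eq_add_one, show 2 * (k + 1) + st.1 = 2 * k + (st.1 + 2) by ring]
    | some (e, m) =>
      rw [show st.1 = (replayEvent st (some (e, m))).1 from rfl,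
        ih _ h ?_ (by simpa only [replayEvent] using hh)]
      · rw [outToks, ← List.append_assoc]
        congr 1
        by_cases hi : binValue e = i
        · subst hi; simp [replayEvent]
        · simp [replayEvent, hi, Function.update_of_ne (Ne.symm hi)]
      · intro i k hk
        simp only [replayEvent] at hk ⊢
        by_cases hi : i = binValue e
        · subst hi; simp [hk.ne', hst _ _ hk]
        · simp [hi, hst _ _ hk]

/-- Filtering the log yields the messages that a prover has received in the first `h` verifier
rounds, provided that these rounds are closed. -/
theorem outToks_eq_blocks (i : ℕ) (L : List Event) (h : ℕ)
    (hh : 2 * h < (L.foldl replayEvent (2, fun _ _ => [])).1) :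
    outToks i h L = blocks ((List.range h).map fun k =>
      (L.foldl replayEvent (2, fun _ _ => [])).2 i (2 * k + 2)) := by
  have hpar : Even (L.foldl replayEvent (2, fun _ _ => [])).1 := by
    suffices ∀ st, Even st.1 → Even (L.foldl replayEvent st).1 from this _ (by decide)
    clear hh
    induction L with
    | nil => exact fun _ h => h
    | cons e L ih =>
      intro st hs
      refine ih _ ?_
      match e with
      | none => simpa [replayEvent, parity_simps] using hs
      | some _ => exact hs
  obtain ⟨r, hr⟩ := hpar
  cases h with
  | zero => simp [outToks]
  | succ h =>
    have := blocks_replay_aux i L (2, fun _ _ => []) h (fun _ _ _ => rfl) (by simp only; omega)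
    simpa using this.symm

/-- The state of a simulation of the machine `V`; the log has its newest event first. -/
structure Sim (V : Machine) where
  state : V.Q
  stack : V.K → List Bool
  answer : Option Bool
  log : List Event

namespace Sim

variable {V : Machine}

/-- The beginning of a simulation. -/
def init (V : Machine) : Sim V := ⟨V.start, fun _ => [], none, []⟩

/-- The value of the transition function. -/
def next (a : Sim V) (r : Bool) : V.Q × (V.K → StackOp) × Move V.K :=
  V.next a.state (fun k => (a.stack k).head?) a.answer r

/-- The stacks after the stack operations of a step. -/
def stack' (a : Sim V) (r : Bool) : V.K → List Bool :=
  fun k => ((a.next r).2.1 k).apply (a.stack k)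

/-- One step of the simulation, with the random bit `r`, in which `w` is used as result if a message
bit is read. -/
def step (x : List Bool) (a : Sim V) (r w : Bool) : Sim V :=
  if a.state = V.halt then a
  else
    match (a.next r).2.2 with
    | .idle => ⟨(a.next r).1, a.stack' r, a.answer, a.log⟩
    | .readInput k => ⟨(a.next r).1, a.stack' r, x[binValue (a.stack' r k)]?, a.log⟩
    | .readMessage _ _ _ => ⟨(a.next r).1, a.stack' r, some w, a.log⟩
    | .send i m => ⟨(a.next r).1, Function.update (Function.update (a.stack' r) i []) m [],
        a.answer, some (a.stack' r i, a.stack' r m) :: a.log⟩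
    | .nextRound => ⟨(a.next r).1, a.stack' r, a.answer, none :: a.log⟩

/-- The query for a bit whose coordinates are written on stacks. -/
def query (i j b : List Bool) (log : List Event) : List Tok :=
  queryToks (binValue i) (binValue j) (binValue b)
    (outToks (binValue i) (binValue j / 2) log.reverse)

/-- The query that belongs to the next step, if a message bit is read in this step. -/
def ask (a : Sim V) (r : Bool) : Option (List Tok) :=
  if a.state = V.halt then none
  else
    match (a.next r).2.2 with
    | .readMessage i j b => some (query (a.stack' r i) (a.stack' r j) (a.stack' r b) a.log)
    | _ => none

/-- The simulation with random bits `rs` and claimed message bits `ws`. -/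
def run (x : List Bool) : Sim V → List Bool → List Bool → Sim V
  | a, r :: rs, w :: ws => run x (a.step x r w) rs ws
  | a, _, _ => a

/-- All claimed message bits agree with the answers that the second prover would give. -/
def Consistent (f : List Tok → Bool) (x : List Bool) : Sim V → List Bool → List Bool → Prop
  | a, r :: rs, w :: ws => (∀ q ∈ a.ask r, w = f q) ∧ Consistent f x (a.step x r w) rs ws
  | _, _, _ => True

/-- The claimed message bits that agree with the answers of the second prover. -/
def honest (f : List Tok → Bool) (x : List Bool) : Sim V → List Bool → List Bool
  | _, [] => []
  | a, r :: rs =>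
    ((a.ask r).map f).getD false ::
      honest f x (a.step x r (((a.ask r).map f).getD false)) rs

/-- The query at the first marked step that reads a message bit, with the claimed bit; if there is
no such step, the default `d`. -/
def check (x : List Bool) (d : List Tok × Bool) :
    Sim V → List Bool → List Bool → List Bool → List Tok × Bool
  | a, r :: rs, w :: ws, m :: ms =>
    match if m then a.ask r else none with
    | some q => (q, w)
    | none => check x d (a.step x r w) rs ws ms
  | _, _, _, _ => d

theorem length_honest (f : List Tok → Bool) (x : List Bool) (a : Sim V) (rs : List Bool) :
    (honest f x a rs).length = rs.length := by
  induction rs generalizing a with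
  | nil => rfl
  | cons r rs ih => simp [honest, ih]

theorem consistent_honest (f : List Tok → Bool) (x : List Bool) (a : Sim V) (rs : List Bool) :
    Consistent f x a rs (honest f x a rs) := by
  induction rs generalizing a with
  | nil => trivial
  | cons r rs ih =>
    refine ⟨fun q hq => ?_, ih _⟩
    rw [Option.mem_def.1 hq]
    rfl

theorem check_of_unmarked (x : List Bool) (d : List Tok × Bool) (a : Sim V)
    (rs ws ms : List Bool) (h : ∀ m ∈ ms, m = false) : check x d a rs ws ms = d := by
  induction ms generalizing a rs ws with
  | nil => cases rs <;> cases ws <;> rfl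
  | cons m ms ih =>
    cases rs with
    | nil => rfl
    | cons r rs =>
      cases ws with
      | nil => rfl
      | cons w ws =>
        obtain rfl := h m (by simp)
        exact ih (a.step x r w) rs ws fun m hm => h m (by simp [hm])

theorem check_of_consistent {f : List Tok → Bool} {x : List Bool} {d : List Tok × Bool}
    (hd : d.2 = f d.1) (a : Sim V) (rs ws ms : List Bool) (h : Consistent f x a rs ws) :
    (check x d a rs ws ms).2 = f (check x d a rs ws ms).1 := by
  induction rs generalizing a ws ms with
  | nil => exact hd
  | cons r rs ih =>
    cases ws with
    | nil => exact hd
    | cons w ws =>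
      cases ms with
      | nil => exact hd
      | cons m ms =>
        simp only [check]
        split
        · rename_i q hq
          exact h.1 _ (Option.mem_def.2 (by cases m <;> simp_all))
        · exact ih _ _ _ h.2

/-- If some claimed bit is wrong, the check fails whenever the first marked step is the first step
with a wrong bit; earlier marks are excluded, as a check of a correct bit would succeed. -/
theorem exists_check_of_not_consistent {f : List Tok → Bool} {x : List Bool}
    (d : List Tok × Bool) (a : Sim V) (rs ws : List Bool) (h : ¬ Consistent f x a rs ws) :
    ∃ t, t < rs.length ∧ ∀ ms : List Bool, (∀ i < t, ms[i]? = some false) → ms[t]? = some true →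
      (check x d a rs ws ms).2 ≠ f (check x d a rs ws ms).1 := by
  induction rs generalizing a ws with
  | nil => exact absurd trivial h
  | cons r rs ih =>
    cases ws with
    | nil => exact absurd trivial h
    | cons w ws =>
      by_cases hq : ∀ q ∈ a.ask r, w = f q
      · obtain ⟨t, ht, hms⟩ := ih _ _ fun hc => h ⟨hq, hc⟩
        refine ⟨t + 1, by simpa using ht, fun ms h0 h1 => ?_⟩
        cases ms with
        | nil => simp at h1
        | cons m ms =>
          obtain rfl : m = false := by simpa using h0 0 (by omega)
          simp only [check]
          exact hms ms (fun i hi => by simpa using h0 (i + 1) (by omega)) (by simpa using h1)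
      · push Not at hq
        obtain ⟨q, hq, hw⟩ := hq
        refine ⟨0, by simp, fun ms _ h1 => ?_⟩
        cases ms with
        | nil => simp at h1
        | cons m ms =>
          obtain rfl : m = true := by simpa using h1
          rw [Option.mem_def] at hq
          simpa only [check, hq, if_true] using hw

/-- The simulation agrees with a configuration of the simulated machine. -/
structure Rel (a : Sim V) (c : V.Config) : Prop where
  state : a.state = c.state
  stack : a.stack = c.stack
  answer : a.answer = c.answer
  log : a.log.reverse.foldl replayEvent (2, fun _ _ => []) = (c.round, c.sent)

theorem rel_init (V : Machine) : Rel (init V) V.init := ⟨rfl, rfl, rfl, rfl⟩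

/-- As long as the claimed bits agree with the answers of the second prover, the simulation follows
the computation of `V` with provers who say what the second prover answers. -/
theorem Rel.step {a : Sim V} {c c' : V.Config} {Y : Layout} {x : List Bool}
    {f : List Tok → Bool} {r w : Bool} (h : Rel a c)
    (hs : V.step Y x (profileOf f Y.len) r c = some c') (hw : ∀ q ∈ a.ask r, w = f q) :
    Rel (a.step x r w) c' := by
  obtain ⟨q, st, an, lg⟩ := a
  obtain ⟨q', st', an', rd, sn⟩ := c
  obtain ⟨h1, h2, h3, h4⟩ := h
  simp only at h1 h2 h3 h4
  subst h1 h2 h3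
  rw [Machine.step] at hs
  rw [Sim.step]
  simp only at hs ⊢
  split at hs
  · rename_i hq
    rw [if_pos hq]
    obtain rfl := Option.some.inj hs
    exact ⟨rfl, rfl, rfl, h4⟩
  · rename_i hq
    rw [if_neg hq]
    simp only [ask, hq, if_false] at hw
    unfold Sim.stack' Sim.next at *
    generalize V.next q (fun k => (st k).head?) an r = d at hs hw ⊢
    obtain ⟨q₁, ops, mv⟩ := d
    simp only at hs hw ⊢
    cases mv with
    | idle =>
      obtain rfl := Option.some.inj hs
      exact ⟨rfl, rfl, rfl, h4⟩
    | readInput k =>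
      obtain rfl := Option.some.inj hs
      exact ⟨rfl, rfl, rfl, h4⟩
    | readMessage i j b =>
      simp only [Machine.act] at hs
      split at hs
      · rename_i hv
        obtain rfl := Option.some.inj hs
        refine ⟨rfl, rfl, ?_, h4⟩
        obtain ⟨-, hj, -, hjr, hb⟩ := hv
        simp only [Option.mem_def, Option.some.injEq, forall_eq', query] at hw
        obtain ⟨h, hh⟩ := hj
        rw [hh] at hw hb hjr ⊢
        rw [Y.message_profileOf f _ _ _ _ hb, hw, show (2 * h + 1) / 2 = h by omega,
          outToks_eq_blocks _ _ _ (by rw [h4]; simp only; omega), h4]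
      · simp at hs
    | send i m =>
      simp only [Machine.act] at hs
      split at hs
      · obtain rfl := Option.some.inj hs
        refine ⟨rfl, rfl, rfl, ?_⟩
        simp only [List.reverse_cons, List.foldl_append, h4]
        rfl
      · simp at hs
    | nextRound =>
      simp only [Machine.act] at hs
      split at hs
      · obtain rfl := Option.some.inj hs
        refine ⟨rfl, rfl, rfl, ?_⟩
        simp only [List.reverse_cons, List.foldl_append, h4]
        rfl
      · simp at hs

theorem Rel.run {a : Sim V} {c c' : V.Config} {Y : Layout} {x : List Bool}
    {f : List Tok → Bool} {rs ws : List Bool} (h : Rel a c) (hl : ws.length = rs.length)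
    (hs : V.runL Y x (profileOf f Y.len) rs c = some c') (hw : Consistent f x a rs ws) :
    Rel (a.run x rs ws) c' := by
  induction rs generalizing a c ws with
  | nil =>
    obtain rfl := Option.some.inj hs
    exact h
  | cons r rs ih =>
    cases ws with
    | nil => simp at hl
    | cons w ws =>
      simp only [Machine.runL] at hs
      cases hc : V.step Y x (profileOf f Y.len) r c with
      | none => simp [hc] at hs
      | some c₁ =>
        rw [hc] at hs
        exact ih (h.step hc hw.1) (by simpa using hl) hs hw.2

theorem step_of_halt (x : List Bool) {a : Sim V} (h : a.state = V.halt) (r w : Bool) :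
    a.step x r w = a := by
  simp [step, h]

theorem run_of_halt (x : List Bool) {a : Sim V} (h : a.state = V.halt) (rs ws : List Bool) :
    a.run x rs ws = a := by
  induction rs generalizing ws with
  | nil => rfl
  | cons r rs ih => cases ws <;> simp [run, step_of_halt x h, ih]

theorem check_of_halt (x : List Bool) (d : List Tok × Bool) {a : Sim V} (h : a.state = V.halt)
    (rs ws ms : List Bool) : check x d a rs ws ms = d := by
  induction rs generalizing ws ms with
  | nil => rfl
  | cons r rs ih =>
    cases ws with
    | nil => rfl
    | cons w ws =>
      cases ms with
      | nil => rfl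
      | cons m ms =>
        have ha : a.ask r = none := by simp [ask, h]
        simp only [check, ha, step_of_halt x h, ite_self]
        exact ih ws ms

end Sim

end MRIP

namespace MRIP

/-! ### The verifier of the two-prover protocol -/

/-- The binary counters of the verifier: for the number of random bits, for the addresses in the
message of the first prover, for the step to be checked, and for the rounds in a query. -/
inductive Counter where
  | size
  | addr
  | pick
  | rounds
  deriving DecidableEq

instance : Fintype Counter :=
  ⟨{.size, .addr, .pick, .rounds}, fun c => by cases c <;> simp⟩

/-- The coordinates of a message bit. -/
inductive Coord where
  | bit
  | round
  | prover
  deriving DecidableEq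

instance : Fintype Coord := ⟨{.bit, .round, .prover}, fun c => by cases c <;> simp⟩

/-- The stacks of the verifier that simulates a verifier with stacks `VK` and a machine with stacks
`MK` that produces a string of length `T`. A list of symbols is held by a pair of stacks. -/
inductive Stk (VK MK : Type) where
  /-- the stacks of the simulated verifier -/
  | sim (k : VK)
  /-- the stacks of the machine that computes the running time -/
  | ctor (k : MK)
  | counter (c : Counter)
  /-- the coordinates of the bit to be checked -/
  | coord (w : Coord)
  /-- the log of the simulation: indices of provers and ends of rounds -/
  | logI (h : Bool)
  /-- the log of the simulation: messages -/
  | logM (h : Bool)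
  /-- the reversed logs -/
  | revI (h : Bool)
  | revM (h : Bool)
  /-- the query -/
  | query (h : Bool)
  /-- a unary copy of the running time -/
  | unary
  /-- the random bits of the simulation, and the copy that is sent to the first prover -/
  | rand
  | randCopy
  /-- the claimed message bits -/
  | claims
  /-- the mark of the step to be checked -/
  | marks
  | carry
  /-- nonempty if the payment of the simulated verifier is paid -/
  | flag
  /-- the claimed value of the bit to be checked -/
  | claim
  /-- the prover to be asked about, and the part of his index that has been compared -/
  | target
  | saved
  /-- constants -/
  | one
  | three
  | five
  | zero
  deriving DecidableEq, Fintype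

/-- The states of the verifier. -/
inductive Label (VQ VK MQ : Type) where
  | setup₀
  | setup₁
  | setup₂
  /-- the computation of the running time -/
  | ctor (q : MQ)
  /-- random bits for the simulation -/
  | gen
  | draw
  /-- increment of a counter: carry over ones, set a digit, put the zeros back -/
  | inc (c : Counter)
  | set (c : Counter) (overflow : Bool)
  | fill (c : Counter) (overflow : Bool)
  /-- the choice of the step to be checked -/
  | genPick
  | drawPick
  /-- the choice between payment of the simulated verifier and check -/
  | drawFlag₀
  | genFlag
  | drawFlag
  /-- the messages of rounds 2 and 3 -/
  | sendRand
  | closeRand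
  | read
  | store
  /-- the simulation; the result of the latest reading is `answer` if this is not `none`, and
  otherwise the result of the latest reading of the verifier -/
  | sim (q : VQ) (answer : Option (Option Bool))
  | simSend (q : VQ) (answer : Option (Option Bool)) (i m : VK)
  | done
  /-- a check of the answer bit -/
  | readAnswer
  | storeAnswer
  /-- construction of the query: coordinates -/
  | load (i j b : VK)
  | strip (w : Coord)
  | conv (w : Coord)
  /-- construction of the query: messages -/
  | rev
  | event
  | compare (ok : Bool)
  | restore (ok : Bool)
  | copy (ok : Bool)
  /-- the messages of rounds 4 and 5 -/
  | send₀
  | send₁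
  | close
  | readReply
  | judge
  /-- the payment -/
  | pay (ok : Bool)
  | halt
  deriving DecidableEq, Fintype

/-- The operation that takes part in pushing a symbol on a pair of stacks. -/
def pushTok (t : Tok) (h : Bool) : StackOp := .push (cond h t.2 t.1)

/-- Pop two stacks at a time, which may be the same. -/
def popTwo {K : Type} [DecidableEq K] (i j k : K) : StackOp :=
  if k = i ∨ k = j then .pop else .keep

/-- Push the given bit, if there is one. -/
def pushOpt : Option Bool → StackOp
  | some b => .push b
  | none => .keep

/-- Push the given bit as a symbol, if there is one. -/
def pushOptTok (o : Option Bool) (h : Bool) : StackOp :=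
  match o with
  | some b => pushTok (false, b) h
  | none => .keep

/-- The stack operations in a step of the simulation. -/
def simOps {VK MK : Type} (ops : VK → StackOp) : Stk VK MK → StackOp
  | .sim k => ops k
  | .rand => .pop
  | .claims => .pop
  | .marks => .pop
  | _ => .keep

variable (V M : Machine)

/-- The transition in a step of the simulation, if the transition function of the simulated
verifier yields `d`. -/
def simNext (src : Option (Option Bool)) (t : Stk V.K M.K → Option Bool)
    (d : V.Q × (V.K → StackOp) × Move V.K) :
    Label V.Q V.K M.Q × (Stk V.K M.K → StackOp) × Move (Stk V.K M.K) :=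
  match d.2.2 with
  | .idle => (.sim d.1 src, simOps d.2.1, .idle)
  | .readInput k => (.sim d.1 none, simOps d.2.1, .readInput (.sim k))
  | .readMessage i j b =>
    if t .marks = some true ∧ t .flag = none then
      (.load i j b, fun | .claim => pushOpt (t .claims) | a => simOps d.2.1 a, .idle)
    else (.sim d.1 (some (t .claims)), simOps d.2.1, .idle)
  | .send i m => (.simSend d.1 src i m, simOps d.2.1, .idle)
  | .nextRound =>
    (.sim d.1 src, fun | .logI h => pushTok roundMark h | a => simOps d.2.1 a, .idle)

/-- The transition function of the verifier of the two-prover protocol. -/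
def next (l : Label V.Q V.K M.Q) (t : Stk V.K M.K → Option Bool) (an : Option Bool) (r : Bool) :
    Label V.Q V.K M.Q × (Stk V.K M.K → StackOp) × Move (Stk V.K M.K) :=
  match l with
  | .setup₀ => (.setup₁, fun | .one => .push true | .three => .push true | .five => .push true
                             | _ => .keep, .idle)
  | .setup₁ => (.setup₂, fun | .three => .push true | .five => .push false | _ => .keep, .idle)
  | .setup₂ => (.ctor M.start, fun | .five => .push true | _ => .keep, .idle)
  | .ctor q =>
    if q = M.halt then (.gen, fun _ => .keep, .idle)
    else
      -- The computed length must not depend on random bits, so that they are replaced by zeros.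
      let d := M.next q (fun k => t (.ctor k)) an false
      (.ctor d.1, fun | .ctor k => d.2.1 k | _ => .keep,
        match d.2.2 with | .readInput a => .readInput (.ctor a) | _ => .idle)
  | .gen =>
    match t (.ctor M.num) with
    | none => (.genPick, fun _ => .keep, .idle)
    | some _ => (.draw, fun | .ctor k => if k = M.num then .pop else .keep | _ => .keep, .idle)
  | .draw => (.inc .size, fun | .rand => .push r | .randCopy => .push r | .unary => .push true
                              | _ => .keep, .idle)
  | .inc c =>
    match t (.counter c) with
    | some true => (.inc c, fun | .counter c' => if c' = c then .pop else .keep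
                                | .carry => .push true | _ => .keep, .idle)
    | some false => (.set c false, fun | .counter c' => if c' = c then .pop else .keep
                                       | _ => .keep, .idle)
    | none => (.set c true, fun _ => .keep, .idle)
  | .set c ov => (.fill c ov, fun | .counter c' => if c' = c then .push true else .keep
                                  | _ => .keep, .idle)
  | .fill c ov =>
    match t .carry with
    | some _ => (.fill c ov, fun | .counter c' => if c' = c then .push false else .keep
                                 | .carry => .pop | _ => .keep, .idle)
    | none =>
      match c with
      | .size => (.gen, fun _ => .keep, .idle)
      | .addr => (.inc .pick, fun _ => .keep, .idle)
      | .pick => (.read, fun | .marks => .push ov | _ => .keep, .idle)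
      | .rounds => (if ov then .send₀ else .event, fun _ => .keep, .idle)
  | .genPick =>
    match t (.counter .size) with
    | none => (.drawFlag₀, fun _ => .keep, .idle)
    | some _ => (.drawPick, fun | .counter .size => .pop | .marks => .push true | _ => .keep, .idle)
  | .drawPick => (.genPick, fun | .counter .pick => .push r | _ => .keep, .idle)
  | .drawFlag₀ => (.genFlag, fun | .flag => if r then .push true else .keep | _ => .keep, .idle)
  | .genFlag =>
    match t .marks with
    | none => (.sendRand, fun _ => .keep, .idle)
    | some _ => (.drawFlag, fun | .marks => .pop | _ => .keep, .idle)
  | .drawFlag => (.genFlag, fun | .flag => if r then .keep else .pop | _ => .keep, .idle)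
  | .sendRand => (.closeRand, fun _ => .keep, .send .zero .randCopy)
  | .closeRand => (.read, fun _ => .keep, .nextRound)
  | .read =>
    match t .unary with
    | none => (.sim V.start (some none), fun _ => .keep, .idle)
    | some _ =>
      (.store, fun | .unary => .pop | _ => .keep, .readMessage .zero .three (.counter .addr))
  | .store => (.inc .addr, fun | .claims => .push (an.getD false) | _ => .keep, .idle)
  | .sim q src =>
    if q = V.halt then (.done, fun _ => .keep, .idle)
    else
      match t .rand with
      | none => (.done, fun _ => .keep, .idle)
      | some r =>
        simNext V M src t (V.next q (fun k => t (.sim k)) (src.getD an) r)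
  | .simSend q src i m =>
    if t (.sim i) = none ∧ t (.sim m) = none then
      (.sim q src, fun | .logI h => pushTok endMark h | .logM h => pushTok endMark h
                       | _ => .keep, .idle)
    else
      -- Both stacks are popped at a time, as they may be the same.
      (.simSend q src i m, fun | .sim k => popTwo i m k | .logI h => pushOptTok (t (.sim i)) h
                               | .logM h => pushOptTok (t (.sim m)) h | _ => .keep, .idle)
  | .done =>
    match t .flag with
    | some _ => (.halt, fun _ => .keep, .idle)
    | none => (.readAnswer, fun _ => .keep, .idle)
  | .readAnswer => (.storeAnswer, fun _ => .keep, .readMessage .zero .one .zero)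
  | .storeAnswer => (.strip .bit, fun | .claim => .push (an.getD false)
                                      | .coord .round => .push true | _ => .keep, .idle)
  | .load i j b =>
    if t (.sim i) = none ∧ t (.sim j) = none ∧ t (.sim b) = none then
      (.strip .bit, fun _ => .keep, .idle)
    else
      (.load i j b, fun | .sim k => if k = i ∨ k = j ∨ k = b then .pop else .keep
                        | .coord .bit => pushOpt (t (.sim b))
                        | .coord .round => pushOpt (t (.sim j))
                        | .coord .prover => pushOpt (t (.sim i)) | _ => .keep, .idle)
  | .strip w =>
    if t (.coord w) = some false then
      (.strip w, fun | .coord w' => if w' = w then .pop else .keep | _ => .keep, .idle)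
    else (.conv w, fun _ => .keep, .idle)
  | .conv w =>
    match t (.coord w) with
    | some v =>
      (.conv w, fun | .coord w' => if w' = w then .pop else .keep
                    | .query h => pushTok (false, v) h
                    | .target => if w = .prover then .push v else .keep
                    -- The counter of the rounds runs from the complement of the number to the
                    -- overflow.
                    | .counter .rounds => if w = .round then .push (!v) else .keep
                    | _ => .keep, .idle)
    | none =>
      (match w with | .bit => .strip .round | .round => .strip .prover | .prover => .rev,
        fun | .query h => pushTok endMark h
            | .counter .rounds => if w = .round then .pop else .keep | _ => .keep, .idle)
  | .rev =>
    if t (.logI false) = none ∧ t (.logM false) = none then (.inc .rounds, fun _ => .keep, .idle)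
    else
      (.rev, fun | .logI _ => .pop | .logM _ => .pop | .revI h => pushOpt (t (.logI h))
                 | .revM h => pushOpt (t (.logM h)) | _ => .keep, .idle)
  | .event =>
    match t (.revI false), t (.revI true) with
    | none, _ => (.send₀, fun _ => .keep, .idle)
    | some true, some true =>
      (.inc .rounds, fun | .revI _ => .pop | .query h => pushTok endMark h | _ => .keep, .idle)
    | _, _ => (.compare true, fun _ => .keep, .idle)
  | .compare ok =>
    match t (.revI false) with
    | none => (.send₀, fun _ => .keep, .idle)
    | some true => (.restore (ok && (t .target).isNone), fun | .revI _ => .pop | _ => .keep, .idle)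
    | some false =>
      if ok ∧ t .target = t (.revI true) then
        (.compare true, fun | .revI _ => .pop | .target => .pop | .saved => pushOpt (t .target)
                            | _ => .keep, .idle)
      else
        -- Zeros beyond the last digit of the index make no difference.
        (.compare (ok && (t .target).isNone && (t (.revI true) == some false)),
          fun | .revI _ => .pop | _ => .keep, .idle)
  | .restore ok =>
    match t .saved with
    | some v => (.restore ok, fun | .saved => .pop | .target => .push v | _ => .keep, .idle)
    | none => (.copy ok, fun _ => .keep, .idle)
  | .copy ok =>
    match t (.revM false) with
    | none => (.send₀, fun _ => .keep, .idle)
    | some true => (.event, fun | .revM _ => .pop | _ => .keep, .idle)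
    | some false =>
      (.copy ok, fun | .revM _ => .pop
                     | .query h => if ok then pushOptTok (t (.revM true)) h else .keep
                     | _ => .keep, .idle)
  | .send₀ => (.send₁, fun _ => .keep, .send .one (.query false))
  | .send₁ => (.close, fun | .one => .push true | _ => .keep, .send .one (.query true))
  | .close => (.readReply, fun _ => .keep, .nextRound)
  | .readReply => (.judge, fun | .one => .push true | _ => .keep, .readMessage .one .five .zero)
  | .judge => (.pay (t .claim == an), fun _ => .keep, .idle)
  | .pay ok =>
    if t (.sim V.num) = none ∧ t (.sim V.den) = none then
      (.halt, fun | .sim k => if ok = true ∧ (k = V.num ∨ k = V.den) then .push true else .keep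
                  | _ => .keep, .idle)
    else (.pay ok, fun | .sim k => popTwo V.num V.den k | _ => .keep, .idle)
  | .halt => (.halt, fun _ => .keep, .idle)

/-- The verifier of the two-prover protocol, which simulates the verifier `V`, where `M` computes
the running time of `V`. -/
abbrev simulator : Machine where
  Q := Label V.Q V.K M.Q
  K := Stk V.K M.K
  start := .setup₀
  halt := .halt
  num := .sim V.num
  den := .sim V.den
  next := next V M

/-- The states in which the verifier uses a random bit. -/
def IsDraw (l : Label V.Q V.K M.Q) : Prop :=
  l = .draw ∨ l = .drawPick ∨ l = .drawFlag₀ ∨ l = .drawFlag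

/-- The contents of the stacks of the verifier. -/
structure Store where
  sim : V.K → List Bool
  ctor : M.K → List Bool
  counter : Counter → List Bool
  coord : Coord → List Bool
  logI : List Tok
  logM : List Tok
  revI : List Tok
  revM : List Tok
  query : List Tok
  unary : List Bool
  rand : List Bool
  randCopy : List Bool
  claims : List Bool
  marks : List Bool
  carry : List Bool
  flag : List Bool
  claim : List Bool
  target : List Bool
  saved : List Bool
  one : List Bool
  three : List Bool
  five : List Bool

variable {V M}

/-- One of the two stacks that hold a list of symbols. -/
def half (h : Bool) (l : List Tok) : List Bool := l.map fun t => cond h t.2 t.1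

@[simp] theorem half_nil (h : Bool) : half h [] = [] := rfl
@[simp] theorem half_cons (h : Bool) (t : Tok) (l : List Tok) :
    half h (t :: l) = cond h t.2 t.1 :: half h l := rfl
@[simp] theorem half_eq_nil (h : Bool) (l : List Tok) : half h l = [] ↔ l = [] := by simp [half]

/-- The stacks as a function of their names. -/
def Store.toFun (s : Store V M) : Stk V.K M.K → List Bool
  | .sim k => s.sim k
  | .ctor k => s.ctor k
  | .counter c => s.counter c
  | .coord w => s.coord w
  | .logI h => half h s.logI
  | .logM h => half h s.logM
  | .revI h => half h s.revI
  | .revM h => half h s.revM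
  | .query h => half h s.query
  | .unary => s.unary
  | .rand => s.rand
  | .randCopy => s.randCopy
  | .claims => s.claims
  | .marks => s.marks
  | .carry => s.carry
  | .flag => s.flag
  | .claim => s.claim
  | .target => s.target
  | .saved => s.saved
  | .one => s.one
  | .three => s.three
  | .five => s.five
  | .zero => []

/-- A configuration of the verifier. -/
def config (l : Label V.Q V.K M.Q) (s : Store V M) (an : Option Bool) (rd : ℕ)
    (sn : ℕ → ℕ → List Bool) : (simulator V M).Config :=
  ⟨l, s.toFun, an, rd, sn⟩

/-- What the verifier sees of its stacks. -/
def Store.tops (s : Store V M) : Stk V.K M.K → Option Bool := fun a => (s.toFun a).head?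

section Reach

variable {Y : Layout} {x : List Bool} {p : Profile} {l l' : Label V.Q V.K M.Q} {s s' : Store V M}
  {an : Option Bool} {rd : ℕ} {sn : ℕ → ℕ → List Bool} {bs : List Bool} {n : ℕ}
  {c' : (simulator V M).Config}

theorem step_config (hl : l ≠ .halt) {r : Bool} {mv : Move (Stk V.K M.K)}
    (h1 : (next V M l s.tops an r).1 = l')
    (h2 : ∀ a, ((next V M l s.tops an r).2.1 a).apply (s.toFun a) = s'.toFun a)
    (h3 : (next V M l s.tops an r).2.2 = mv) :
    (simulator V M).step Y x p r (config l s an rd sn) =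
      (simulator V M).act Y x p (config l' s' an rd sn) mv := by
  subst h1 h3
  unfold config
  rw [← funext h2]
  exact if_neg hl

/-- A step without an external move and without use of the random bit. -/
theorem reach_idle (hl : l ≠ .halt) (hD : ¬ IsDraw V M l)
    (h1 : ∀ r, (next V M l s.tops an r).1 = l')
    (h2 : ∀ r a, ((next V M l s.tops an r).2.1 a).apply (s.toFun a) = s'.toFun a)
    (h3 : ∀ r, (next V M l s.tops an r).2.2 = .idle)
    (h : (simulator V M).Reach Y x p (IsDraw V M) (config l' s' an rd sn) bs n c') :
    (simulator V M).Reach Y x p (IsDraw V M) (config l s an rd sn) bs (n + 1) c' := by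
  exact .det hD (fun r => step_config hl (h1 r) (h2 r) (h3 r)) h

/-- A step without an external move that uses the random bit. -/
theorem reach_draw (hD : IsDraw V M l) (r : Bool)
    (h1 : (next V M l s.tops an r).1 = l')
    (h2 : ∀ a, ((next V M l s.tops an r).2.1 a).apply (s.toFun a) = s'.toFun a)
    (h3 : (next V M l s.tops an r).2.2 = .idle)
    (h : (simulator V M).Reach Y x p (IsDraw V M) (config l' s' an rd sn) bs n c') :
    (simulator V M).Reach Y x p (IsDraw V M) (config l s an rd sn) (r :: bs) (n + 1) c' := by
  have hl : l ≠ .halt := by rintro rfl; simp [IsDraw] at hD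
  exact .draw hD (step_config hl h1 h2 h3) h

end Reach

end MRIP

namespace MRIP

/-! ### Binary counters -/

/-- The increment of a binary number. -/
def incr : List Bool → List Bool
  | [] => [true]
  | false :: l => true :: l
  | true :: l => false :: incr l

@[simp] theorem binValue_nil : binValue [] = 0 := rfl
@[simp] theorem binValue_cons (b : Bool) (l : List Bool) :
    binValue (b :: l) = 2 * binValue l + b.toNat := by
  simp [binValue, Nat.bit_val]

theorem binValue_incr (l : List Bool) : binValue (incr l) = binValue l + 1 := by
  induction l with
  | nil => rfl
  | cons b l ih => cases b <;> simp [incr, ih]; ring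

theorem binValue_lt (l : List Bool) : binValue l < 2 ^ l.length := by
  induction l with
  | nil => simp
  | cons b l ih =>
    have := Bool.toNat_le b
    simp only [binValue_cons, List.length_cons, pow_succ]
    omega

/-- A binary number overflows if all its digits are ones. -/
theorem all_iff_binValue (l : List Bool) : l.all id = true ↔ binValue l + 1 = 2 ^ l.length := by
  induction l with
  | nil => simp
  | cons b l ih =>
    have := binValue_lt l
    cases b
    · simp [pow_succ]; omega
    · simp only [List.all_cons, id, Bool.true_and, ih, binValue_cons, List.length_cons, pow_succ,
        Bool.toNat_true]
      omega

theorem length_incr (l : List Bool) : (incr l).length = l.length + (l.all id).toNat := by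
  induction l with
  | nil => rfl
  | cons b l ih => cases b <;> simp [incr, ih]; ring

/-- The amortized cost of an increment is constant: each step of the carry turns a one into a
zero. -/
theorem exists_incr (l : List Bool) : ∃ k l', l = List.replicate k true ++ l' ∧
    l'.head? ≠ some true ∧ incr l = List.replicate k false ++ true :: l'.tail ∧
    l.all id = l'.isEmpty ∧ k + (incr l).count true = l.count true + 1 := by
  induction l with
  | nil => exact ⟨0, [], by simp [incr]⟩
  | cons b l ih =>
    cases b
    · exact ⟨0, false :: l, by simp [incr]⟩
    · obtain ⟨k, l', h1, h2, h3, h4, h5⟩ := ih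
      refine ⟨k + 1, l', by rw [h1]; rfl, h2, by rw [incr, h3]; rfl, by simpa using h4, ?_⟩
      simp only [incr, List.count_cons]
      simp
      omega

section Reach

variable {V M : Machine} {Y : Layout} {x : List Bool} {p : Profile}
  {s : Store V M}
  {an : Option Bool} {rd : ℕ} {sn : ℕ → ℕ → List Bool} {bs : List Bool} {n : ℕ}
  {c' : (simulator V M).Config}

/-- Reachability for the verifier of the two-prover protocol. -/
abbrev Goes (Y : Layout) (x : List Bool) (p : Profile) (c : (simulator V M).Config)
    (bs : List Bool) (n : ℕ) (c' : (simulator V M).Config) : Prop :=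
  (simulator V M).Reach Y x p (IsDraw V M) c bs n c'

theorem goes_carry (c : Counter) (k : ℕ) (l' : List Bool)
    (hc : s.counter c = List.replicate k true ++ l')
    (h : Goes Y x p (config (.inc c) { s with
      counter := Function.update s.counter c l'
      carry := List.replicate k true ++ s.carry } an rd sn) bs n c') :
    Goes Y x p (config (.inc c) s an rd sn) bs (n + k) c' := by
  induction k generalizing s with
  | zero =>
    simp only [List.replicate_zero, List.nil_append] at hc
    simpa [← hc] using h
  | succ k ih =>
    rw [List.replicate_succ, List.cons_append] at hc
    rw [← Nat.add_assoc]
    refine reach_idle (s' := { s with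
      counter := Function.update s.counter c (List.replicate k true ++ l')
      carry := true :: s.carry }) (by simp) (by simp [IsDraw]) ?_ ?_ ?_ (ih (by simp) ?_)
    · intro r; simp [next, Store.tops, Store.toFun, hc]
    · intro r a
      simp only [next, Store.tops, Store.toFun, hc, List.head?_cons]
      cases a <;> try rfl
      rename_i c'
      by_cases h' : c' = c
      · subst h'; simp [hc, StackOp.apply]
      · simp [h', StackOp.apply]
    · intro r; simp [next, Store.tops, Store.toFun, hc]
    · simpa [List.replicate_succ', List.append_assoc] using h

theorem goes_fill (c : Counter) (ov : Bool) (k : ℕ) (hc : s.carry = List.replicate k true)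
    (h : Goes Y x p (config (.fill c ov) { s with
      counter := Function.update s.counter c (List.replicate k false ++ s.counter c)
      carry := [] } an rd sn) bs n c') :
    Goes Y x p (config (.fill c ov) s an rd sn) bs (n + k) c' := by
  induction k generalizing s with
  | zero =>
    obtain ⟨⟩ := s
    simp only [List.replicate_zero] at hc
    subst hc
    simpa using h
  | succ k ih =>
    rw [List.replicate_succ] at hc
    rw [← Nat.add_assoc]
    refine reach_idle (s' := { s with
      counter := Function.update s.counter c (false :: s.counter c)
      carry := List.replicate k true }) (by simp) (by simp [IsDraw]) ?_ ?_ ?_ (ih (by simp) ?_)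
    · intro r; simp [next, Store.tops, Store.toFun, hc]
    · intro r a
      simp only [next, Store.tops, Store.toFun, hc, List.head?_cons]
      cases a <;> try rfl
      · rename_i c'
        by_cases h' : c' = c
        · subst h'; simp [StackOp.apply]
        · simp [h', StackOp.apply]
    · intro r; simp [next, Store.tops, Store.toFun, hc]
    · have e : List.replicate k false ++ false :: s.counter c =
          List.replicate (k + 1) false ++ s.counter c := by
        rw [List.replicate_succ', List.append_assoc]; rfl
      simpa [e] using h

/-- The carry takes as many steps as there are ones that vanish, so that increments take amortized
constant time. -/
theorem goes_inc (c : Counter) {N : ℕ} (hc : s.carry = [])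
    (h : Goes Y x p (config (.fill c ((s.counter c).all id)) { s with
      counter := Function.update s.counter c (incr (s.counter c)) } an rd sn) bs n c')
    (hN : n + 2 * (s.counter c).count true + 4 ≤ N + 2 * (incr (s.counter c)).count true) :
    Goes Y x p (config (.inc c) s an rd sn) bs N c' := by
  obtain ⟨k, l', h1, h2, h3, h4, h5⟩ := exists_incr (s.counter c)
  refine (goes_carry (n := n + k + 1 + 1) c k l' h1 ?_).mono (by omega)
  refine reach_idle (l' := .set c l'.isEmpty) (s' := { s with
      counter := Function.update s.counter c l'.tail
      carry := List.replicate k true }) (by simp) (by simp [IsDraw]) ?_ ?_ ?_ ?_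
  · intro r
    rcases l' with _ | ⟨_ | _, l'⟩ <;> simp_all [next, Store.tops, Store.toFun]
  · intro r a
    rcases l' with _ | ⟨_ | _, l'⟩
    · simp only [next, Store.tops, Store.toFun, Function.update_self, List.head?_nil, hc,
        List.append_nil]
      cases a <;> try rfl
    · simp only [next, Store.tops, Store.toFun, Function.update_self, List.head?_cons]
      cases a <;> try rfl
      · rename_i c'
        by_cases h' : c' = c
        · subst h'; simp [StackOp.apply]
        · simp [h', StackOp.apply]
      · simp [hc, StackOp.apply]
    · simp at h2
  · intro r
    rcases l' with _ | ⟨_ | _, l'⟩ <;> simp_all [next, Store.tops, Store.toFun]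
  refine reach_idle (l' := .fill c l'.isEmpty) (s' := { s with
      counter := Function.update s.counter c (true :: l'.tail)
      carry := List.replicate k true }) (by simp) (by simp [IsDraw]) (fun _ => rfl) ?_
      (fun _ => rfl) ?_
  · intro r a
    simp only [next]
    cases a <;> try rfl
    rename_i c'
    by_cases h' : c' = c
    · subst h'; simp [Store.toFun, StackOp.apply]
    · simp [Store.toFun, h', StackOp.apply]
  refine goes_fill c _ k rfl ?_
  rw [← h4]
  simpa [← h3, ← hc] using h

/-! ### The random choices -/

/-- One random bit is drawn for each symbol of the computed string, while its length is counted in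
binary. -/
theorem goes_gen {N : ℕ} (l : List Bool) (hc : s.carry = []) (hl : (s.ctor M.num).length = l.length)
    (h : Goes Y x p (config .genPick { s with
      ctor := Function.update s.ctor M.num []
      counter := Function.update s.counter .size (incr^[l.length] (s.counter .size))
      unary := List.replicate l.length true ++ s.unary
      rand := l.reverse ++ s.rand
      randCopy := l.reverse ++ s.randCopy } an rd sn) bs n c')
    (hN : n + 2 * (s.counter .size).count true + 7 * l.length + 1 ≤ N) :
    Goes Y x p (config .gen s an rd sn) (l ++ bs) N c' := by
  induction l generalizing s N with
  | nil =>
    have h0 : s.ctor M.num = [] := by simpa using hl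
    refine Machine.Reach.mono (reach_idle (s' := s) (n := n) (l' := .genPick) (by simp)
      (by simp [IsDraw]) ?_ ?_ ?_ ?_) (by omega)
    · intro r; simp [next, Store.tops, Store.toFun, h0]
    · intro r a
      simp only [next, Store.tops, Store.toFun, h0, List.head?_nil]
      rfl
    · intro r; simp [next, Store.tops, Store.toFun, h0]
    · have e : Function.update s.ctor M.num [] = s.ctor := by rw [← h0]; simp
      simpa [e] using h
  | cons b l ih =>
    obtain ⟨u, us, hu⟩ : ∃ u us, s.ctor M.num = u :: us := by
      cases h : s.ctor M.num with
      | nil => simp [h] at hl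
      | cons u us => exact ⟨u, us, rfl⟩
    have hn : ∃ m, N = m + 1 + 1 := ⟨N - 2, by simp at hN; omega⟩
    obtain ⟨m, rfl⟩ := hn
    refine reach_idle (l' := .draw) (s' := { s with ctor := Function.update s.ctor M.num us })
      (by simp) (by simp [IsDraw]) ?_ ?_ ?_ ?_
    · intro r; simp [next, Store.tops, Store.toFun, hu]
    · intro r a
      simp only [next, Store.tops, Store.toFun, hu, List.head?_cons]
      cases a <;> try rfl
      rename_i k
      by_cases h' : k = M.num
      · subst h'; simp [hu, StackOp.apply]
      · simp [h', StackOp.apply]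
    · intro r; simp [next, Store.tops, Store.toFun, hu]
    refine reach_draw (l' := .inc .size) (s' := { s with
      ctor := Function.update s.ctor M.num us
      unary := true :: s.unary
      rand := b :: s.rand
      randCopy := b :: s.randCopy }) (by simp [IsDraw]) b rfl ?_ rfl ?_
    · intro a
      cases a <;> rfl
    have hcount : (incr (s.counter .size)).count true ≤ (s.counter .size).count true + 1 := by
      obtain ⟨k, -, -, -, -, -, h5⟩ := exists_incr (s.counter .size)
      omega
    refine goes_inc (n := m + 2 * (incr (s.counter .size)).count true -
      2 * (s.counter .size).count true - 4) .size hc ?_ (by simp at hN ⊢; omega)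
    refine Machine.Reach.mono (n := n + 2 * (incr (s.counter .size)).count true +
      7 * l.length + 1 + 1) ?_ (by simp at hN; omega)
    refine reach_idle (l' := .gen) (s' := { s with
      ctor := Function.update s.ctor M.num us
      counter := Function.update s.counter .size (incr (s.counter .size))
      unary := true :: s.unary
      rand := b :: s.rand
      randCopy := b :: s.randCopy }) (by simp) (by simp [IsDraw]) ?_ ?_ ?_ ?_
    · intro r; simp [next, Store.tops, Store.toFun, hc]
    · intro r a
      simp only [next, Store.tops, Store.toFun, hc, List.head?_nil]
      rfl
    · intro r; simp [next, Store.tops, Store.toFun, hc]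
    refine ih (by exact hc) (by simp [hu] at hl; simp [hl]) ?_ (by simp)
    have e : List.replicate l.length true ++ true :: s.unary =
        List.replicate (l.length + 1) true ++ s.unary := by
      rw [List.replicate_succ', List.append_assoc]; rfl
    simpa [e] using h

/-- The start of the counter that determines the marked step has as many random digits as the
running time. -/
theorem goes_genPick {N : ℕ} (l : List Bool) (hl : (s.counter .size).length = l.length)
    (h : Goes Y x p (config .drawFlag₀ { s with
      counter := Function.update (Function.update s.counter .size []) .pick
        (l.reverse ++ s.counter .pick)
      marks := List.replicate l.length true ++ s.marks } an rd sn) bs n c')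
    (hN : n + 2 * l.length + 1 ≤ N) :
    Goes Y x p (config .genPick s an rd sn) (l ++ bs) N c' := by
  induction l generalizing s N with
  | nil =>
    have h0 : s.counter .size = [] := by simpa using hl
    refine Machine.Reach.mono (reach_idle (s' := s) (n := n) (l' := .drawFlag₀) (by simp)
      (by simp [IsDraw]) ?_ ?_ ?_ ?_) (by omega)
    · intro r; simp [next, Store.tops, Store.toFun, h0]
    · intro r a
      simp only [next, Store.tops, Store.toFun, h0, List.head?_nil]
      rfl
    · intro r; simp [next, Store.tops, Store.toFun, h0]
    · have e : Function.update s.counter .size [] = s.counter := by rw [← h0]; simp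
      simpa [e] using h
  | cons b l ih =>
    obtain ⟨u, us, hu⟩ : ∃ u us, s.counter .size = u :: us := by
      cases h : s.counter .size with
      | nil => simp [h] at hl
      | cons u us => exact ⟨u, us, rfl⟩
    have hn : ∃ m, N = m + 1 + 1 := ⟨N - 2, by simp at hN; omega⟩
    obtain ⟨m, rfl⟩ := hn
    refine reach_idle (l' := .drawPick) (s' := { s with
      counter := Function.update s.counter .size us
      marks := true :: s.marks }) (by simp) (by simp [IsDraw]) ?_ ?_ ?_ ?_
    · intro r; simp [next, Store.tops, Store.toFun, hu]
    · intro r a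
      simp only [next, Store.tops, Store.toFun, hu, List.head?_cons]
      cases a <;> try rfl
      rename_i c
      cases c <;> simp [hu, StackOp.apply]
    · intro r; simp [next, Store.tops, Store.toFun, hu]
    refine reach_draw (l' := .genPick) (s' := { s with
      counter := Function.update (Function.update s.counter .size us) .pick (b :: s.counter .pick)
      marks := true :: s.marks }) (by simp [IsDraw]) b rfl ?_ rfl ?_
    · intro a
      simp only [next]
      cases a <;> try rfl
      rename_i c
      cases c <;> rfl
    refine ih (by simpa [hu] using hl) ?_ (by simp at hN; omega)
    have e : List.replicate l.length true ++ true :: s.marks =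
        List.replicate (l.length + 1) true ++ s.marks := by
      rw [List.replicate_succ', List.append_assoc]; rfl
    have e2 : Function.update (Function.update (Function.update (Function.update s.counter .size us)
        .pick (b :: s.counter .pick)) .size []) .pick (l.reverse ++ b :: s.counter .pick) =
        Function.update (Function.update s.counter .size []) .pick
          (l.reverse ++ b :: s.counter .pick) := by
      funext c; cases c <;> rfl
    simpa [e, e2] using h

/-- The flag, which is set by a first random bit, survives if all random bits `l` are ones. -/
theorem goes_genFlag {N : ℕ} (l : List Bool) (hl : s.marks.length = l.length)
    (hf : s.flag.length ≤ 1)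
    (h : Goes Y x p (config .sendRand { s with
      marks := []
      flag := if l.all id then s.flag else [] } an rd sn) bs n c')
    (hN : n + 2 * l.length + 1 ≤ N) :
    Goes Y x p (config .genFlag s an rd sn) (l ++ bs) N c' := by
  induction l generalizing s N with
  | nil =>
    have h0 : s.marks = [] := by simpa using hl
    refine Machine.Reach.mono (reach_idle (s' := s) (n := n) (l' := .sendRand) (by simp)
      (by simp [IsDraw]) ?_ ?_ ?_ ?_) (by omega)
    · intro r; simp [next, Store.tops, Store.toFun, h0]
    · intro r a
      simp only [next, Store.tops, Store.toFun, h0, List.head?_nil]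
      rfl
    · intro r; simp [next, Store.tops, Store.toFun, h0]
    · obtain ⟨⟩ := s
      simp only at h0
      subst h0
      simpa using h
  | cons b l ih =>
    obtain ⟨u, us, hu⟩ : ∃ u us, s.marks = u :: us := by
      cases h : s.marks with
      | nil => simp [h] at hl
      | cons u us => exact ⟨u, us, rfl⟩
    have hn : ∃ m, N = m + 1 + 1 := ⟨N - 2, by simp at hN; omega⟩
    obtain ⟨m, rfl⟩ := hn
    refine reach_idle (l' := .drawFlag) (s' := { s with marks := us }) (by simp)
      (by simp [IsDraw]) ?_ ?_ ?_ ?_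
    · intro r; simp [next, Store.tops, Store.toFun, hu]
    · intro r a
      simp only [next, Store.tops, Store.toFun, hu, List.head?_cons]
      cases a <;> try rfl
    · intro r; simp [next, Store.tops, Store.toFun, hu]
    refine reach_draw (l' := .genFlag) (s' := { s with
      marks := us
      flag := if b then s.flag else [] }) (by simp [IsDraw]) b rfl ?_ rfl ?_
    · intro a
      simp only [next]
      cases a <;> try rfl
      cases b
      · have : s.flag.tail = [] := List.eq_nil_of_length_eq_zero (by simp; omega)
        simpa [Store.toFun, StackOp.apply] using this
      · rfl
    refine ih (by simpa [hu] using hl) (by cases b <;> simp [hf]) ?_ (by simp at hN; omega)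
    cases b
    · simpa using h
    · simpa using h

theorem goes_drawFlag {N : ℕ} (b : Bool) (hf : s.flag = [])
    (h : Goes Y x p (config .genFlag { s with
      flag := if b then [true] else [] } an rd sn) bs n c') (hN : n + 1 ≤ N) :
    Goes Y x p (config .drawFlag₀ s an rd sn) (b :: bs) N c' := by
  refine Machine.Reach.mono (reach_draw (by simp [IsDraw]) b rfl ?_ rfl h) hN
  intro a
  simp only [next]
  cases a <;> try rfl
  cases b <;> simp [Store.toFun, hf, StackOp.apply]

end Reach

end MRIP

namespace MRIP

/-! ### The first three rounds -/

/-- The store after the constants have been written. -/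
def Store.start (V M : Machine) : Store V M where
  sim := fun _ => []
  ctor := fun _ => []
  counter := fun _ => []
  coord := fun _ => []
  logI := []
  logM := []
  revI := []
  revM := []
  query := []
  unary := []
  rand := []
  randCopy := []
  claims := []
  marks := []
  carry := []
  flag := []
  claim := []
  target := []
  saved := []
  one := [true]
  three := [true, true]
  five := [true, false, true]

/-- The overflows in `n` increments of a counter. -/
def overflows : ℕ → List Bool → List Bool
  | 0, _ => []
  | n + 1, l => l.all id :: overflows n (incr l)

section Reach

variable {V M : Machine} {Y : Layout} {x : List Bool} {p : Profile}
  {l l' : Label V.Q V.K M.Q} {s s' : Store V M}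
  {an an' : Option Bool} {rd rd' : ℕ} {sn sn' : ℕ → ℕ → List Bool} {bs : List Bool} {n : ℕ}
  {c' : (simulator V M).Config}

theorem reach_move (mv : Move (Stk V.K M.K)) (hl : l ≠ .halt) (hD : ¬ IsDraw V M l)
    (h1 : ∀ r, (next V M l s.tops an r).1 = l')
    (h2 : ∀ r a, ((next V M l s.tops an r).2.1 a).apply (s.toFun a) = s'.toFun a)
    (h3 : ∀ r, (next V M l s.tops an r).2.2 = mv) {c₁ : (simulator V M).Config}
    (h4 : (simulator V M).act Y x p (config l' s' an rd sn) mv = some c₁)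
    (h : Goes Y x p c₁ bs n c') :
    Goes Y x p (config l s an rd sn) bs (n + 1) c' :=
  .det hD (fun r => (step_config hl (h1 r) (h2 r) (h3 r)).trans h4) h

theorem goes_init
    (h : Goes Y x p (config (.ctor M.start) (Store.start V M) none 2 (fun _ _ => [])) bs n c') :
    Goes Y x p (simulator V M).init bs (n + 3) c' := by
  have e : (simulator V M).init = config .setup₀ { Store.start V M with
      one := [], three := [], five := [] } none 2 (fun _ _ => []) := by
    unfold config Machine.init
    congr
    funext a
    cases a <;> rfl
  rw [e]
  refine reach_idle (l' := .setup₁) (s' := { Store.start V M with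
      one := [true], three := [true], five := [true] }) (by simp) (by simp [IsDraw])
      (fun _ => rfl) (fun r a => by cases a <;> rfl) (fun _ => rfl) ?_
  refine reach_idle (l' := .setup₂) (s' := { Store.start V M with
      one := [true], three := [true, true], five := [false, true] }) (by simp) (by simp [IsDraw])
      (fun _ => rfl) (fun r a => by cases a <;> rfl) (fun _ => rfl) ?_
  exact reach_idle (by simp) (by simp [IsDraw])
      (fun _ => rfl) (fun r a => by cases a <;> rfl) (fun _ => rfl) h

/-- The computation of the running time. The machine has no provers, so that reading messages,
sending, and closing rounds are excluded. -/
theorem goes_ctor {q : Profile} (t : ℕ) {c₀ c₁ : M.Config} (hr : c₀.round = 2)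
    (hc : M.runL ⟨0, 0, fun _ _ => 0⟩ x q (List.replicate t false) c₀ = some c₁)
    (hh : c₁.state = M.halt)
    (h : Goes Y x p (config .gen { s with ctor := c₁.stack } c₁.answer rd sn) bs n c') :
    Goes Y x p (config (.ctor c₀.state) { s with ctor := c₀.stack } c₀.answer rd sn) bs
      (n + t + 1) c' := by
  have hexit : Goes Y x p (config (.ctor c₁.state) { s with ctor := c₁.stack }
      c₁.answer rd sn) bs (n + 1) c' := by
    refine reach_idle (by simp) (by simp [IsDraw]) ?_ ?_ ?_ h
    · intro r; simp [next, hh]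
    · intro r a; simp [next, hh, StackOp.apply]
    · intro r; simp [next, hh]
  induction t generalizing c₀ with
  | zero =>
    obtain rfl := Option.some.inj hc
    exact hexit
  | succ t ih =>
    by_cases hq : c₀.state = M.halt
    · obtain rfl : c₀ = c₁ := by simpa [Machine.runL_halt _ hq] using hc
      exact hexit.mono (by omega)
    · simp only [List.replicate_succ, Machine.runL, Machine.step, hq, if_false] at hc
      have e1 : ∀ (r : Bool) (s₁ : Store V M) (d : M.Q × (M.K → StackOp) × Move M.K),
          M.next c₀.state (fun k => (c₀.stack k).head?) c₀.answer false = d →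
          next V M (.ctor c₀.state) ({ s₁ with ctor := c₀.stack } : Store V M).tops c₀.answer r =
          (.ctor d.1, fun | .ctor k => d.2.1 k | _ => .keep,
            match d.2.2 with | .readInput a => .readInput (.ctor a) | _ => .idle) := by
        rintro r s₁ d rfl
        simp only [next, if_neg hq]
        rfl
      generalize hd : M.next c₀.state (fun k => (c₀.stack k).head?) c₀.answer false = d at hc
      obtain ⟨q₁, ops, mv⟩ := d
      cases mv with
      | idle =>
        simp only [Machine.act, Option.bind_some] at hc
        refine reach_idle (l' := .ctor q₁)
          (s' := { s with ctor := fun k => (ops k).apply (c₀.stack k) }) (by simp)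
          (by simp [IsDraw]) ?_ ?_ ?_ (ih (c₀ := ⟨q₁, _, _, _, _⟩) hr hc)
        · intro r; rw [e1 r s _ hd]
        · intro r a; rw [e1 r s _ hd]; cases a <;> rfl
        · intro r; rw [e1 r s _ hd]
      | readInput k =>
        simp only [Machine.act, Option.bind_some] at hc
        refine reach_move (l' := .ctor q₁)
          (s' := { s with ctor := fun k => (ops k).apply (c₀.stack k) }) (.readInput (.ctor k))
          (by simp) (by simp [IsDraw]) ?_ ?_ ?_ rfl (ih (c₀ := ⟨q₁, _, _, _, _⟩) hr hc)
        · intro r; rw [e1 r s _ hd]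
        · intro r a; rw [e1 r s _ hd]; cases a <;> rfl
        · intro r; rw [e1 r s _ hd]
      | readMessage i j b => simp [Machine.act] at hc
      | send i m => simp [Machine.act] at hc
      | nextRound => simp [Machine.act, hr] at hc

theorem goes_sendRand (hp : Y.provers = 2) (hr : Y.rounds = 5)
    (h : Goes Y x p (config .read { s with randCopy := [] } an 4
      (Function.update sn 0 (Function.update (sn 0) 2 (sn 0 2 ++ s.randCopy)))) bs n c') :
    Goes Y x p (config .sendRand s an 2 sn) bs (n + 2) c' := by
  refine reach_move (l' := .closeRand) (s' := s) (.send .zero .randCopy) (by simp)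
    (by simp [IsDraw]) (fun _ => rfl) (fun r a => rfl) (fun _ => rfl)
    (c₁ := config .closeRand { s with randCopy := [] } an 2
      (Function.update sn 0 (Function.update (sn 0) 2 (sn 0 2 ++ s.randCopy)))) ?_ ?_
  · simp only [Machine.act, config, Store.toFun, binValue_nil, hp, hr]
    rw [if_pos (by decide)]
    simp only [Option.some.injEq, Machine.Config.mk.injEq, true_and, and_true]
    funext a
    cases a <;> rfl
  refine reach_move (l' := .read) (s' := { s with randCopy := [] }) .nextRound (by simp)
    (by simp [IsDraw]) (fun _ => rfl) (fun r a => rfl) (fun _ => rfl) ?_ h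
  simp [Machine.act, config, hr]

/-- The claimed bits are read one by one, and each increment of the counter `pick` that overflows
marks a step. As stacks reverse the order, the last bit read belongs to the first step of the
simulation. -/
theorem goes_read {N : ℕ} (hp : Y.provers = 2) (hr : Y.rounds = 5) (w : List Bool)
    (hw : (Y.message p sn 0 3).drop (binValue (s.counter .addr)) = w)
    (hu : s.unary.length = w.length) (h3 : s.three = [true, true]) (hc : s.carry = [])
    (h : Goes Y x p (config (.sim V.start (some none)) { s with
      unary := []
      counter := Function.update (Function.update s.counter .addr
        (incr^[w.length] (s.counter .addr))) .pick (incr^[w.length] (s.counter .pick))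
      claims := w.reverse ++ s.claims
      marks := (overflows w.length (s.counter .pick)).reverse ++ s.marks }
      (w.getLast?.or an) 4 sn) bs n c')
    (hN : n + 2 * (s.counter .addr).count true + 2 * (s.counter .pick).count true +
      12 * w.length + 1 ≤ N) :
    Goes Y x p (config .read s an 4 sn) bs N c' := by
  induction w generalizing s N an with
  | nil =>
    have h0 : s.unary = [] := by simpa using hu
    refine Machine.Reach.mono (reach_idle (s' := s) (n := n) (l' := .sim V.start (some none))
      (by simp) (by simp [IsDraw]) ?_ ?_ ?_ ?_) (by omega)
    · intro r; simp [next, Store.tops, Store.toFun, h0]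
    · intro r a
      simp only [next, Store.tops, Store.toFun, h0, List.head?_nil]
      rfl
    · intro r; simp [next, Store.tops, Store.toFun, h0]
    · obtain ⟨⟩ := s
      simp only at h0
      subst h0
      simpa [overflows] using h
  | cons b w ih =>
    obtain ⟨u, us, hus⟩ : ∃ u us, s.unary = u :: us := by
      cases h : s.unary with
      | nil => simp [h] at hu
      | cons u us => exact ⟨u, us, rfl⟩
    have hn : ∃ m, N = m + 1 + 1 := ⟨N - 2, by simp at hN; omega⟩
    obtain ⟨m, rfl⟩ := hn
    have hb : (Y.message p sn 0 3)[binValue (s.counter .addr)]? = some b := by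
      rw [← List.head?_drop, hw]; rfl
    have hlt := (List.getElem?_eq_some_iff.1 hb).1
    rw [Layout.length_message] at hlt
    refine reach_move (l' := .store) (s' := { s with unary := us })
      (.readMessage .zero .three (.counter .addr)) (by simp) (by simp [IsDraw]) ?_ ?_ ?_
      (c₁ := config .store { s with unary := us } (some b) 4 sn) ?_ ?_
    · intro r; simp [next, Store.tops, Store.toFun, hus]
    · intro r a
      simp only [next, Store.tops, Store.toFun, hus, List.head?_cons]
      cases a <;> rfl
    · intro r; simp [next, Store.tops, Store.toFun, hus]
    · have e3 : binValue [true, true] = 3 := rfl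
      simp only [Machine.act, config, Store.toFun, binValue_nil, h3, e3, hp, hr]
      rw [if_pos ⟨by decide, by decide, by decide, by decide, hlt⟩, hb]
    refine reach_idle (l' := .inc .addr) (s' := { s with
      unary := us
      claims := b :: s.claims }) (by simp) (by simp [IsDraw]) (fun _ => rfl)
      (fun r a => by cases a <;> rfl) (fun _ => rfl) ?_
    have hcount : ∀ l : List Bool, (incr l).count true ≤ l.count true + 1 := fun l => by
      obtain ⟨k, -, -, -, -, -, h5⟩ := exists_incr l
      omega
    have hc1 := hcount (s.counter .addr)
    have hc2 := hcount (s.counter .pick)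
    simp only [List.length_cons] at hN
    refine goes_inc (n := n + 2 * (incr (s.counter .addr)).count true +
      2 * (s.counter .pick).count true + 12 * w.length + 7) .addr hc ?_ (by simp; omega)
    refine reach_idle (l' := .inc .pick) (s' := { s with
      unary := us
      claims := b :: s.claims
      counter := Function.update s.counter .addr (incr (s.counter .addr)) })
      (by simp) (by simp [IsDraw]) ?_ ?_ ?_ ?_
    · intro r; simp [next, Store.tops, Store.toFun, hc]
    · intro r a
      simp only [next, Store.tops, Store.toFun, hc, List.head?_nil]
      rfl
    · intro r; simp [next, Store.tops, Store.toFun, hc]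
    refine goes_inc (n := n + 2 * (incr (s.counter .addr)).count true +
      2 * (incr (s.counter .pick)).count true + 12 * w.length + 2) .pick hc ?_
      (by simp; omega)
    refine reach_idle (l' := .read) (s' := { s with
      unary := us
      claims := b :: s.claims
      marks := (s.counter .pick).all id :: s.marks
      counter := Function.update (Function.update s.counter .addr (incr (s.counter .addr))) .pick
        (incr (s.counter .pick)) })
      (by simp) (by simp [IsDraw]) ?_ ?_ ?_ ?_
    · intro r; simp [next, Store.tops, Store.toFun, hc]
    · intro r a
      simp only [next, Store.tops, Store.toFun, hc, List.head?_nil]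
      cases a <;> rfl
    · intro r; simp [next, Store.tops, Store.toFun, hc]
    refine ih ?_ (by simpa [hus] using hu) h3 hc ?_ (by simp)
    · have : (Function.update (Function.update s.counter .addr (incr (s.counter .addr))) .pick
        (incr (s.counter .pick))) .addr = incr (s.counter .addr) := rfl
      simp only [this, binValue_incr]
      rw [← List.drop_drop, hw]; rfl
    · have e2 : ∀ u v u' v' : List Bool, Function.update (Function.update (Function.update
        (Function.update s.counter .addr u) .pick v) .addr u') .pick v' =
        Function.update (Function.update s.counter .addr u') .pick v' := by
        intro u v u' v'
        funext c; cases c <;> rfl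
      have e4 : (b :: w).getLast?.or an = w.getLast?.or (some b) := by
        rw [List.getLast?_cons]
        cases w.getLast? <;> rfl
      rw [e4] at h
      simpa [overflows, e2] using h

end Reach

end MRIP

namespace MRIP

/-! ### The construction of the query -/

/-- There are no leading zeros: the most significant digit, which is the last one, is not zero. -/
def Canonical (l : List Bool) : Prop := l.getLast? ≠ some false

theorem Canonical.tail {b : Bool} {l : List Bool} (h : Canonical (b :: l)) : Canonical l := by
  cases l with
  | nil => simp [Canonical]
  | cons c l => simpa [Canonical, List.getLast?_cons_cons] using h

theorem Canonical.eq_nil {l : List Bool} (h : Canonical l) (h0 : binValue l = 0) : l = [] := by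
  induction l with
  | nil => rfl
  | cons b l ih =>
    rw [binValue_cons] at h0
    obtain rfl := ih h.tail (by omega)
    cases b
    · simp [Canonical] at h
    · simp at h0

theorem canonical_bits (n : ℕ) : Canonical n.bits := by
  induction n using Nat.binaryRec' with
  | zero => simp [Canonical]
  | bit b n h ih =>
    rw [Nat.bits_append_bit _ _ h]
    cases hn : n.bits with
    | nil =>
      have h0 : n = 0 := by rw [← binValue_bits n, hn]; rfl
      simp [Canonical, h h0]
    | cons c l => simpa [Canonical, List.getLast?_cons_cons, hn] using ih

theorem bits_binValue (l : List Bool) : (binValue (l ++ [true])).bits = l ++ [true] := by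
  induction l with
  | nil => rfl
  | cons b l ih =>
    have h : binValue (b :: l ++ [true]) = Nat.bit b (binValue (l ++ [true])) := rfl
    rw [h, Nat.bits_append_bit, ih]
    · rfl
    · intro h0
      rw [h0] at ih
      simp at ih

theorem binValue_append_false (l : List Bool) : binValue (l ++ [false]) = binValue l := by
  induction l with
  | nil => rfl
  | cons b l ih => simp [ih]

/-- Dropping leading zeros makes a number canonical. -/
theorem dropWhile_eq_bits (l : List Bool) :
    l.dropWhile (fun b => !b) = (binValue l.reverse).bits.reverse := by
  induction l with
  | nil => rfl
  | cons b l ih =>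
    cases b
    · simpa [binValue_append_false] using ih
    · simp [bits_binValue]

theorem length_bits_le (l : List Bool) : (binValue l).bits.length ≤ l.length := by
  have h : (binValue l).bits.length = (l.reverse.dropWhile fun b => !b).length := by
    rw [dropWhile_eq_bits, List.reverse_reverse, List.length_reverse]
  rw [h, ← List.length_reverse (as := l)]
  exact (List.dropWhile_sublist _).length_le

theorem dat_reverse (l : List Bool) : dat l.reverse = (dat l).reverse := by simp [dat]

/-- The complement of a binary number is its distance to the overflow. -/
theorem binValue_map_not (l : List Bool) :
    binValue (l.map (!·)) + binValue l + 1 = 2 ^ l.length := by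
  induction l with
  | nil => rfl
  | cons b l ih =>
    simp only [List.map_cons, binValue_cons, List.length_cons, pow_succ]
    cases b <;> simp <;> omega

/-- The first part of the log: indices of provers and ends of rounds. -/
def encI (L : List Event) : List Tok :=
  L.flatMap fun | none => [roundMark] | some (e, _) => dat e ++ [endMark]

/-- The second part of the log: messages. -/
def encM (L : List Event) : List Tok :=
  L.flatMap fun | none => [] | some (_, m) => dat m ++ [endMark]

@[simp] theorem encI_nil : encI [] = [] := rfl
@[simp] theorem encM_nil : encM [] = [] := rfl
@[simp] theorem encI_none (L : List Event) : encI (none :: L) = roundMark :: encI L := rfl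
@[simp] theorem encM_none (L : List Event) : encM (none :: L) = encM L := rfl
@[simp] theorem encI_some (e m : List Bool) (L : List Event) :
    encI (some (e, m) :: L) = dat e ++ endMark :: encI L := by simp [encI]
@[simp] theorem encM_some (e m : List Bool) (L : List Event) :
    encM (some (e, m) :: L) = dat m ++ endMark :: encM L := by simp [encM]
@[simp] theorem encI_append (L L' : List Event) : encI (L ++ L') = encI L ++ encI L' := by
  simp [encI]
@[simp] theorem encM_append (L L' : List Event) : encM (L ++ L') = encM L ++ encM L' := by
  simp [encM]

section Reach

variable {V M : Machine} {Y : Layout} {x : List Bool} {p : Profile} {s : Store V M}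
  {an : Option Bool} {rd : ℕ} {sn : ℕ → ℕ → List Bool} {bs : List Bool} {n N : ℕ}
  {c' : (simulator V M).Config}

theorem goes_strip (w : Coord) {m : List Bool} (hm : s.coord w = m)
    (h : Goes Y x p (config (.conv w) { s with
      coord := Function.update s.coord w (m.dropWhile (fun b => !b)) } an rd sn) bs n c')
    (hN : n + m.length + 1 ≤ N) :
    Goes Y x p (config (.strip w) s an rd sn) bs N c' := by
  induction m generalizing s N with
  | nil =>
    refine Machine.Reach.mono (reach_idle (s' := s) (n := n) (l' := .conv w) (by simp)
      (by simp [IsDraw]) ?_ ?_ ?_ ?_) (by simpa using hN)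
    · intro r; simp [next, Store.tops, Store.toFun, hm]
    · intro r a; simp [next, Store.tops, Store.toFun, hm, StackOp.apply]
    · intro r; simp [next, Store.tops, Store.toFun, hm]
    · have e : Function.update s.coord w [] = s.coord := by rw [← hm]; simp
      simpa [e] using h
  | cons b m ih =>
    obtain ⟨k, rfl⟩ : ∃ k, N = k + 1 := ⟨N - 1, by omega⟩
    cases b
    · refine reach_idle (s' := { s with coord := Function.update s.coord w m }) (l' := .strip w)
        (by simp) (by simp [IsDraw]) ?_ ?_ ?_ (ih (by simp) (by simpa using h)
          (by simp at hN; omega))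
      · intro r; simp [next, Store.tops, Store.toFun, hm]
      · intro r a
        simp only [next, Store.tops, Store.toFun, hm, List.head?_cons, if_true]
        cases a <;> try rfl
        rename_i w'
        by_cases h' : w' = w
        · subst h'; simp [hm, StackOp.apply]
        · simp [h', StackOp.apply]
      · intro r; simp [next, Store.tops, Store.toFun, hm]
    · refine Machine.Reach.mono (reach_idle (s' := s) (n := n) (l' := .conv w) (by simp)
        (by simp [IsDraw]) ?_ ?_ ?_ ?_) (by omega)
      · intro r; simp [next, Store.tops, Store.toFun, hm]
      · intro r a; simp [next, Store.tops, Store.toFun, hm, StackOp.apply]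
      · intro r; simp [next, Store.tops, Store.toFun, hm]
      · have e : Function.update s.coord w (true :: m) = s.coord := by rw [← hm]; simp
        simpa [e] using h

/-- The state after the conversion of a coordinate. -/
def afterConv : Coord → Label V.Q V.K M.Q
  | .bit => .strip .round
  | .round => .strip .prover
  | .prover => .rev

theorem goes_conv (w : Coord) {m : List Bool} (hm : s.coord w = m)
    (h : Goes Y x p (config (afterConv w) { s with
      coord := Function.update s.coord w []
      query := endMark :: (dat m.reverse ++ s.query)
      target := if w = .prover then m.reverse ++ s.target else s.target
      counter := if w = .round then
        Function.update s.counter .rounds (m.reverse.map (!·) ++ s.counter .rounds).tail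
        else s.counter } an rd sn) bs n c')
    (hN : n + m.length + 1 ≤ N) :
    Goes Y x p (config (.conv w) s an rd sn) bs N c' := by
  induction m generalizing s N with
  | nil =>
    refine Machine.Reach.mono (reach_idle (n := n) (l' := afterConv w) (by simp)
      (by simp [IsDraw]) ?_ ?_ ?_ h) (by simpa using hN)
    · intro r; cases w <;> simp [next, Store.tops, Store.toFun, hm, afterConv]
    · intro r a
      have e : Function.update s.coord w [] = s.coord := by rw [← hm]; simp
      simp only [next, Store.tops, Store.toFun, hm, List.head?_nil, e]
      cases a <;> try rfl
      · rename_i c; cases w <;> cases c <;> rfl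
      · cases w <;> rfl
    · intro r; simp [next, Store.tops, Store.toFun, hm]
  | cons b m ih =>
    obtain ⟨k, rfl⟩ : ∃ k, N = k + 1 := ⟨N - 1, by omega⟩
    refine reach_idle (s' := { s with
      coord := Function.update s.coord w m
      query := (false, b) :: s.query
      target := if w = .prover then b :: s.target else s.target
      counter := if w = .round then
        Function.update s.counter .rounds ((!b) :: s.counter .rounds) else s.counter })
      (l' := .conv w) (by simp) (by simp [IsDraw]) ?_ ?_ ?_ (ih (by simp) ?_
          (by simp at hN; omega))
    · intro r; simp [next, Store.tops, Store.toFun, hm]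
    · intro r a
      simp only [next, Store.tops, Store.toFun, hm, List.head?_cons]
      cases a <;> try rfl
      · rename_i c; cases w <;> cases c <;> rfl
      · rename_i w'
        by_cases h' : w' = w
        · subst h'; simp [hm, StackOp.apply]
        · simp [h', StackOp.apply]
      · cases w <;> rfl
    · intro r; simp [next, Store.tops, Store.toFun, hm]
    · cases w <;> simpa using h

/-- A coordinate is stripped of leading zeros and written to the query. The number of the round is
also turned into a counter of verifier rounds. -/
theorem goes_coord (w : Coord)
    (h : Goes Y x p (config (afterConv w) { s with
      coord := Function.update s.coord w []
      query := endMark :: (dat (binValue (s.coord w).reverse).bits ++ s.query)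
      target := if w = .prover then (binValue (s.coord w).reverse).bits ++ s.target else s.target
      counter := if w = .round then Function.update s.counter .rounds
        ((binValue (s.coord w).reverse).bits.map (!·) ++ s.counter .rounds).tail
        else s.counter } an rd sn) bs n c')
    (hN : n + 2 * (s.coord w).length + 2 ≤ N) :
    Goes Y x p (config (.strip w) s an rd sn) bs N c' := by
  have hle : ((s.coord w).dropWhile (fun b => !b)).length ≤ (s.coord w).length :=
    (List.dropWhile_sublist _).length_le
  refine goes_strip (n := n + ((s.coord w).dropWhile (fun b => !b)).length + 1) w rfl
    (goes_conv (n := n) w (m := (s.coord w).dropWhile (fun b => !b)) (by simp) ?_ (by omega))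
    (by omega)
  simpa [dropWhile_eq_bits] using h

theorem goes_rev {m : ℕ} (hm : s.logI.length + s.logM.length ≤ m)
    (h : Goes Y x p (config (.inc .rounds) { s with
      logI := []
      logM := []
      revI := s.logI.reverse ++ s.revI
      revM := s.logM.reverse ++ s.revM } an rd sn) bs n c') (hN : n + m + 1 ≤ N) :
    Goes Y x p (config .rev s an rd sn) bs N c' := by
  induction m generalizing s N with
  | zero =>
    have h1 : s.logI = [] := List.eq_nil_of_length_eq_zero (by omega)
    have h2 : s.logM = [] := List.eq_nil_of_length_eq_zero (by omega)
    refine Machine.Reach.mono (reach_idle (s' := s) (n := n) (l' := .inc .rounds) (by simp)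
      (by simp [IsDraw]) ?_ ?_ ?_ ?_) (by simpa using hN)
    · intro r; simp [next, Store.tops, Store.toFun, h1, h2]
    · intro r a; simp [next, Store.tops, Store.toFun, h1, h2, StackOp.apply]
    · intro r; simp [next, Store.tops, Store.toFun, h1, h2]
    · obtain ⟨⟩ := s
      simp only at h1 h2
      subst h1 h2
      simpa using h
  | succ m ih =>
    obtain ⟨k, rfl⟩ : ∃ k, N = k + 1 := ⟨N - 1, by omega⟩
    by_cases h0 : s.logI = [] ∧ s.logM = []
    · obtain ⟨h1, h2⟩ := h0
      exact (ih (by simp [h1, h2]) h (by omega : n + m + 1 ≤ n + m + 1)).mono (by omega)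
    · refine reach_idle (s' := { s with
        logI := s.logI.tail
        logM := s.logM.tail
        revI := s.logI.head?.toList ++ s.revI
        revM := s.logM.head?.toList ++ s.revM })
        (l' := .rev) (by simp) (by simp [IsDraw]) ?_ ?_ ?_ (ih ?_ ?_ (by omega))
      · intro r
        simp only [next, Store.tops, Store.toFun, List.head?_eq_none_iff, half_eq_nil, h0, if_false]
      · intro r a
        simp only [next, Store.tops, Store.toFun, List.head?_eq_none_iff, half_eq_nil, h0, if_false]
        cases a <;> try rfl
        · simp [StackOp.apply, half]
        · simp [StackOp.apply, half]
        · cases s.logI <;> simp [pushOpt, StackOp.apply]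
        · cases s.logM <;> simp [pushOpt, StackOp.apply]
      · intro r
        simp only [next, Store.tops, Store.toFun, List.head?_eq_none_iff, half_eq_nil, h0, if_false]
      · have : s.logI.length ≠ 0 ∨ s.logM.length ≠ 0 := by
          rw [Ne, Ne, List.length_eq_zero_iff, List.length_eq_zero_iff]
          exact not_and_or.1 h0
        simp only [List.length_tail]
        omega
      · have e : ∀ l l' : List Tok, l.tail.reverse ++ (l.head?.toList ++ l') = l.reverse ++ l' := by
          intro l l'; cases l <;> simp
        simpa [e] using h

/-- The comparison of a logged index with that of the prover to be asked about; leading zeros of the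
logged index are ignored. -/
theorem goes_compare {e : List Bool} {rest : List Tok} (ok : Bool)
    (hI : s.revI = dat e ++ endMark :: rest)
    (hc : Canonical s.target)
    (h : ∀ tg sv, sv.reverse ++ tg = s.saved.reverse ++ s.target →
      sv.length ≤ s.saved.length + e.length →
      Goes Y x p (config (.restore (ok && (binValue e == binValue s.target))) { s with
        revI := rest
        target := tg
        saved := sv } an rd sn) bs n c') :
    Goes Y x p (config (.compare ok) s an rd sn) bs (n + e.length + 1) c' := by
  induction e generalizing s ok with
  | nil =>
    simp only [dat_nil, List.nil_append] at hI
    refine reach_idle (by simp) (by simp [IsDraw]) ?_ ?_ ?_ (h s.target s.saved rfl (by simp))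
    · intro r
      have e : s.target.isEmpty = (binValue [] == binValue s.target) := by
        by_cases h0 : s.target = []
        · simp [h0]
        · have : binValue s.target ≠ 0 := fun h1 => h0 (hc.eq_nil h1)
          have h2 : s.target.isEmpty = false := by simpa using h0
          rw [h2]
          symm
          simpa using Ne.symm this
      rw [← e]
      cases ht : s.target <;> simp [next, Store.tops, Store.toFun, hI, endMark, ht]
    · intro r a
      simp only [next, Store.tops, Store.toFun, hI, half_cons, List.head?_cons, endMark, cond_false]
      cases a <;> try rfl
    · intro r; simp [next, Store.tops, Store.toFun, hI, endMark]
  | cons v e ih =>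
    simp only [dat_cons, List.cons_append] at hI
    by_cases hok : ok = true ∧ s.target.head? = some v
    · obtain ⟨rfl, hv⟩ := hok
      obtain ⟨tg, htg⟩ : ∃ tg, s.target = v :: tg := by
        cases ht : s.target with
        | nil => simp [ht] at hv
        | cons u tg => exact ⟨tg, by simpa [ht] using hv⟩
      refine reach_idle (l' := .compare true) (s' := { s with
        revI := dat e ++ endMark :: rest
        target := tg
        saved := v :: s.saved }) (by simp) (by simp [IsDraw]) ?_ ?_ ?_
        (ih true rfl (by rw [htg] at hc; exact hc.tail) ?_)
      · intro r; simp [next, Store.tops, Store.toFun, hI, htg]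
      · intro r a
        simp only [next, Store.tops, Store.toFun, hI, half_cons, List.head?_cons, cond_false,
          cond_true, htg, and_self, if_true]
        cases a <;> try rfl
      · intro r; simp [next, Store.tops, Store.toFun, hI, htg]
      · intro tg' sv' h1 h2
        have := h tg' sv' (by rw [h1, htg]; simp) (by simp at h2 ⊢; omega)
        have e1 : (binValue (v :: e) == binValue s.target) = (binValue e == binValue tg) := by
          rw [htg, binValue_cons, binValue_cons]
          by_cases h3 : binValue e = binValue tg
          · simp [h3]
          · rw [beq_eq_false_iff_ne.2 h3, beq_eq_false_iff_ne]
            omega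
        rw [e1] at this
        exact this
    · refine reach_idle (l' := .compare (ok && s.target.isEmpty && !v)) (s' := { s with
        revI := dat e ++ endMark :: rest }) (by simp) (by simp [IsDraw]) ?_ ?_ ?_
        (ih _ rfl hc ?_)
      · intro r
        have h0 : ¬ (ok = true ∧ s.tops (.target) = s.tops (.revI true)) := by
          simpa [Store.tops, Store.toFun, hI] using hok
        have h1 : s.tops (.revI false) = some false := by simp [Store.tops, Store.toFun, hI]
        simp only [next, h0, h1, if_false]
        congr 1
        cases ht : s.target <;> cases v <;> simp [Store.tops, Store.toFun, hI, ht]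
      · intro r a
        have h0 : ¬ (ok = true ∧ s.tops (.target) = s.tops (.revI true)) := by
          simpa [Store.tops, Store.toFun, hI] using hok
        have h1 : s.tops (.revI false) = some false := by simp [Store.tops, Store.toFun, hI]
        simp only [next, h0, h1, if_false]
        cases a <;> try rfl
        simp [Store.toFun, hI, StackOp.apply]
      · intro r
        have h0 : ¬ (ok = true ∧ s.tops (.target) = s.tops (.revI true)) := by
          simpa [Store.tops, Store.toFun, hI] using hok
        have h1 : s.tops (.revI false) = some false := by simp [Store.tops, Store.toFun, hI]
        simp only [next, h0, h1, if_false]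
      · intro tg' sv' h1 h2
        have := h tg' sv' h1 (by simp at h2 ⊢; omega)
        have e1 : (ok && (binValue (v :: e) == binValue s.target)) =
            (ok && s.target.isEmpty && !v && (binValue e == binValue s.target)) := by
          cases ok
          · rfl
          · simp only [true_and] at hok
            cases ht : s.target with
            | nil =>
              cases v
              · by_cases h3 : binValue e = 0 <;> simp [h3]
              · simp
            | cons u tg =>
              have hu : u ≠ v := fun h => hok (by simp [ht, h])
              simp only [List.isEmpty_cons, Bool.true_and, Bool.false_and, binValue_cons,
                beq_eq_false_iff_ne]
              have := Bool.toNat_le u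
              have := Bool.toNat_le v
              have : u.toNat ≠ v.toNat := by revert hu; cases u <;> cases v <;> simp
              omega
        rw [e1] at this
        exact this

theorem goes_restore (ok : Bool) {sv : List Bool} (hs : s.saved = sv)
    (h : Goes Y x p (config (.copy ok) { s with
      target := sv.reverse ++ s.target
      saved := [] } an rd sn) bs n c') :
    Goes Y x p (config (.restore ok) s an rd sn) bs (n + sv.length + 1) c' := by
  induction sv generalizing s with
  | nil =>
    refine reach_idle (by simp) (by simp [IsDraw]) ?_ ?_ ?_ h
    · intro r; simp [next, Store.tops, Store.toFun, hs]
    · intro r a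
      simp only [next, Store.tops, Store.toFun, hs, List.head?_nil]
      cases a <;> try rfl
    · intro r; simp [next, Store.tops, Store.toFun, hs]
  | cons b sv ih =>
    refine reach_idle (s' := { s with
      target := b :: s.target
      saved := sv }) (l' := .restore ok) (by simp) (by simp [IsDraw]) ?_ ?_ ?_ (ih rfl ?_)
    · intro r; simp [next, Store.tops, Store.toFun, hs]
    · intro r a
      simp only [next, Store.tops, Store.toFun, hs, List.head?_cons]
      cases a <;> try rfl
    · intro r; simp [next, Store.tops, Store.toFun, hs]
    · simpa using h

theorem goes_copy (ok : Bool) {m : List Bool} {rest : List Tok}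
    (hs : s.revM = dat m ++ endMark :: rest)
    (h : Goes Y x p (config .event { s with
      revM := rest
      query := (if ok then dat m else []).reverse ++ s.query } an rd sn) bs n c') :
    Goes Y x p (config (.copy ok) s an rd sn) bs (n + m.length + 1) c' := by
  induction m generalizing s with
  | nil =>
    simp only [dat_nil, List.nil_append] at hs
    refine reach_idle (by simp) (by simp [IsDraw]) ?_ ?_ ?_ h
    · intro r; simp [next, Store.tops, Store.toFun, hs, endMark]
    · intro r a
      simp only [next, Store.tops, Store.toFun, hs, half_cons, endMark, List.head?_cons, cond_false]
      cases a <;> try rfl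
      · simp [StackOp.apply]
    · intro r; simp [next, Store.tops, Store.toFun, hs, endMark]
  | cons b m ih =>
    simp only [dat_cons, List.cons_append] at hs
    refine reach_idle (s' := { s with
      revM := dat m ++ endMark :: rest
      query := if ok then (false, b) :: s.query else s.query }) (l' := .copy ok) (by simp)
      (by simp [IsDraw]) ?_ ?_ ?_ (ih rfl ?_)
    · intro r; simp [next, Store.tops, Store.toFun, hs]
    · intro r a
      simp only [next, Store.tops, Store.toFun, hs, half_cons, List.head?_cons, cond_false,
        cond_true]
      cases a <;> try rfl
      · rename_i h; cases ok <;> cases h <;> rfl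
    · intro r; simp [next, Store.tops, Store.toFun, hs]
    · cases ok <;> simpa using h

/-- The counter of the rounds overflows after the last round. -/
theorem goes_rounds {h : ℕ} (hc : s.carry = [])
    (hv : binValue (s.counter .rounds) + h + 1 = 2 ^ (s.counter .rounds).length)
    (h0 : h = 0 → Goes Y x p (config .send₀ { s with
      counter := Function.update s.counter .rounds (incr (s.counter .rounds)) } an rd sn) bs n c')
    (h1 : ∀ k, h = k + 1 → Goes Y x p (config .event { s with
      counter := Function.update s.counter .rounds (incr (s.counter .rounds)) } an rd sn) bs n c')
    (hN : n + 2 * (s.counter .rounds).count true + 5 ≤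
      N + 2 * (incr (s.counter .rounds)).count true) :
    Goes Y x p (config (.inc .rounds) s an rd sn) bs N c' := by
  have hall : (s.counter .rounds).all id = decide (h = 0) := by
    rw [Bool.eq_iff_iff, all_iff_binValue]
    simp only [decide_eq_true_eq]
    omega
  refine goes_inc (n := n + 1) .rounds hc ?_ (by omega)
  rw [hall]
  refine reach_idle (l' := if h = 0 then .send₀ else .event) (s' := { s with
      counter := Function.update s.counter .rounds (incr (s.counter .rounds)) })
      (by simp) (by simp [IsDraw]) ?_ ?_ ?_ ?_
  · intro r; simp [next, Store.tops, Store.toFun, hc]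
  · intro r a
    simp only [next, Store.tops, Store.toFun, hc, List.head?_nil]
    rfl
  · intro r; simp [next, Store.tops, Store.toFun, hc]
  · cases h with
    | zero => exact h0 rfl
    | succ k => exact h1 k rfl

/-- The traversal of the log. -/
theorem goes_event {R : (simulator V M).Config → Prop} {i : ℕ} {L : List Event} {h : ℕ}
    (hc : s.carry = []) (hsv : s.saved = [])
    (ht : s.target = i.bits)
    (hv : binValue (s.counter .rounds) + h + 1 = 2 ^ (s.counter .rounds).length)
    (hI : s.revI = encI L) (hM : s.revM = encM L)
    (hg : ∀ s' : Store V M, s'.query = (outToks i (h + 1) L).reverse ++ s.query → s'.sim = s.sim →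
      s'.claim = s.claim → s'.one = s.one → s'.five = s.five →
      ∃ c', Goes Y x p (config .send₀ s' an rd sn) bs n c' ∧ R c')
    (hN : n + 6 * (encI L).length + 2 * (encM L).length + 2 * (s.counter .rounds).count true + 1
      ≤ N) :
    ∃ c', Goes Y x p (config .event s an rd sn) bs N c' ∧ R c' := by
  induction L generalizing s N h with
  | nil =>
    rw [encI_nil] at hI
    obtain ⟨c', hc', hR⟩ := hg s rfl rfl rfl rfl rfl
    refine ⟨c', (reach_idle (s' := s) (l' := .send₀) (by simp) (by simp [IsDraw]) ?_ ?_ ?_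
      hc').mono (by omega), hR⟩
    · intro r; simp [next, Store.tops, Store.toFun, hI]
    · intro r a
      simp only [next, Store.tops, Store.toFun, hI, half_nil, List.head?_nil]
      rfl
    · intro r; simp [next, Store.tops, Store.toFun, hI]
  | cons ev L ih =>
    obtain ⟨k, rfl⟩ : ∃ k, N = k + 1 := ⟨N - 1, by omega⟩
    match ev with
    | none =>
      rw [encI_none] at hI hN
      rw [encM_none] at hM hN
      obtain ⟨j, -, -, -, -, -, h5⟩ := exists_incr (s.counter .rounds)
      simp only [List.length_cons] at hN
      obtain ⟨c', h0, h1, hR⟩ : ∃ c', (h = 0 → Goes Y x p (config .send₀ { s with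
            revI := encI L
            query := endMark :: s.query
            counter := Function.update s.counter .rounds (incr (s.counter .rounds)) } an rd sn)
            bs (n + 6 * (encI L).length + 2 * (encM L).length +
              2 * (incr (s.counter .rounds)).count true + 1) c') ∧
          (∀ k, h = k + 1 → Goes Y x p (config .event { s with
            revI := encI L
            query := endMark :: s.query
            counter := Function.update s.counter .rounds (incr (s.counter .rounds)) } an rd sn)
            bs (n + 6 * (encI L).length + 2 * (encM L).length +
              2 * (incr (s.counter .rounds)).count true + 1) c') ∧ R c' := by
        cases h with
        | zero =>
          obtain ⟨c', hc', hR⟩ := hg { s with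
            revI := encI L
            query := endMark :: s.query
            counter := Function.update s.counter .rounds (incr (s.counter .rounds)) }
            (by simp [outToks]) rfl rfl rfl rfl
          exact ⟨c', fun _ => hc'.mono (by omega), fun _ h => by simp at h, hR⟩
        | succ h =>
          have hall : (s.counter .rounds).all id = false := by
            rw [← Bool.not_eq_true, all_iff_binValue]
            omega
          obtain ⟨c', hc', hR⟩ := ih (N := n + 6 * (encI L).length + 2 * (encM L).length +
              2 * (incr (s.counter .rounds)).count true + 1) (s := { s with
            revI := encI L
            query := endMark :: s.query
            counter := Function.update s.counter .rounds (incr (s.counter .rounds)) })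
            (h := h) hc hsv ht
            (by
              simp only [Function.update_self, binValue_incr, length_incr, hall]
              simp only [Bool.toNat_false, Nat.add_zero]
              omega) rfl hM
            (fun s' h1 h2 h3 h4 h5 => hg s' (by simp [h1, outToks]) h2 h3 h4 h5)
            (by simp only [Function.update_self]; omega)
          exact ⟨c', fun h => by simp at h, fun k hk => hc', hR⟩
      refine ⟨c', ?_, hR⟩
      refine reach_idle (l' := .inc .rounds) (s' := { s with
        revI := encI L
        query := endMark :: s.query }) (by simp) (by simp [IsDraw]) ?_ ?_ ?_ ?_
      · intro r; simp [next, Store.tops, Store.toFun, hI, roundMark]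
      · intro r a
        simp only [next, Store.tops, Store.toFun, hI, half_cons, roundMark, List.head?_cons,
          cond_false, cond_true]
        cases a <;> try rfl
      · intro r; simp [next, Store.tops, Store.toFun, hI, roundMark]
      exact goes_rounds (h := h) (n := n + 6 * (encI L).length + 2 * (encM L).length +
        2 * (incr (s.counter .rounds)).count true + 1) hc hv h0 h1 (by simp only; omega)
    | some (e, m) =>
      rw [encI_some] at hI hN
      rw [encM_some] at hM hN
      simp only [List.length_append, List.length_cons, length_dat] at hN
      have hend : (s.tops (.revI false) = some true ∧ s.tops (.revI true) = some false) ∨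
          ∃ b, s.tops (.revI false) = some false ∧ s.tops (.revI true) = some b := by
        cases e with
        | nil => left; simp [Store.tops, Store.toFun, hI, endMark]
        | cons b e => right; exact ⟨b, by simp [Store.tops, Store.toFun, hI]⟩
      obtain ⟨c', hc', hR⟩ := ih (N := n + 6 * (encI L).length + 2 * (encM L).length +
        2 * (s.counter .rounds).count true + 1) (s := { s with
          revI := encI L
          target := i.bits
          saved := []
          revM := encM L
          query := (if true && (binValue e == binValue s.target) then dat m else []).reverse ++
            s.query })
        (h := h) hc rfl rfl hv rfl rfl (fun s' h3 h4 h5 h6 h7 => hg s' (by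
          rw [h3, outToks, ht, binValue_bits]
          simp) h4 h5 h6 h7) le_rfl
      refine ⟨c', ?_, hR⟩
      refine reach_idle (l' := .compare true) (s' := s) (by simp) (by simp [IsDraw]) ?_ ?_ ?_ ?_
      · intro r; rcases hend with ⟨h1, h2⟩ | ⟨b, h1, h2⟩ <;> simp [next, h1, h2]
      · intro r a
        rcases hend with ⟨h1, h2⟩ | ⟨b, h1, h2⟩ <;> simp [next, h1, h2, StackOp.apply]
      · intro r; rcases hend with ⟨h1, h2⟩ | ⟨b, h1, h2⟩ <;> simp [next, h1, h2]
      refine Machine.Reach.mono (n := n + 6 * (encI L).length + 2 * (encM L).length +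
        2 * (s.counter .rounds).count true + 1 + m.length + 1 + e.length + 1 + e.length + 1) ?_
        (by omega)
      refine goes_compare true hI (by rw [ht]; exact canonical_bits i) ?_
      intro tg sv h1 h2
      refine (goes_restore (n := n + 6 * (encI L).length + 2 * (encM L).length +
        2 * (s.counter .rounds).count true + 1 + m.length + 1) _ (sv := sv) rfl ?_).mono
        (by simp [hsv] at h2; omega)
      refine goes_copy _ hM ?_
      simpa [h1, hsv, ht] using hc'

/-- The store after the coordinates have been converted and the logs have been reversed. -/
def Store.prepared (s : Store V M) (i j b : ℕ) (L : List Event) : Store V M := { s with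
  coord := fun _ => []
  query := endMark :: (dat i.bits ++ endMark :: (dat j.bits ++ endMark :: dat b.bits))
  target := i.bits
  counter := Function.update s.counter .rounds (j.bits.map (!·)).tail
  logI := []
  logM := []
  revI := encI L.reverse
  revM := encM L.reverse }

theorem goes_prepare {L : List Event} (ht : s.target = []) (hr : s.counter .rounds = [])
    (hq : s.query = []) (hrI : s.revI = []) (hrM : s.revM = [])
    (hI : s.logI = (encI L.reverse).reverse) (hM : s.logM = (encM L.reverse).reverse)
    (h : Goes Y x p (config (.inc .rounds) (s.prepared (binValue (s.coord .prover).reverse)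
      (binValue (s.coord .round).reverse) (binValue (s.coord .bit).reverse) L) an rd sn) bs n c')
    (hN : n + (encI L.reverse).length + (encM L.reverse).length + 2 * (s.coord .prover).length +
      2 * (s.coord .round).length + 2 * (s.coord .bit).length + 7 ≤ N) :
    Goes Y x p (config (.strip .bit) s an rd sn) bs N c' := by
  refine goes_coord (n := N - (2 * (s.coord .bit).length + 2)) .bit ?_ (by omega)
  refine goes_coord (n := N - (2 * (s.coord .bit).length + 2) - (2 * (s.coord .round).length + 2))
    .round ?_ (by simp; omega)
  refine goes_coord (n := N - (2 * (s.coord .bit).length + 2) -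
    (2 * (s.coord .round).length + 2) - (2 * (s.coord .prover).length + 2)) .prover ?_
    (by simp; omega)
  refine goes_rev (n := n) le_rfl ?_ (by simp [hI, hM]; omega)
  simp only [reduceCtorEq, if_true, if_false, Function.update_self, ne_eq,
    not_false_eq_true, Function.update_of_ne, hr, hq, ht, hrI, hrM, hI, hM, List.append_nil,
    List.reverse_reverse]
  have e : Function.update (Function.update (Function.update s.coord .bit []) .round []) .prover []
      = fun _ => [] := by
    funext c; cases c <;> rfl
  rw [e]
  exact h

/-- The whole construction of the query, from the coordinates of a bit and the logs. -/
theorem goes_query {R : (simulator V M).Config → Prop} {L : List Event} (hc : s.carry = [])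
    (hsv : s.saved = []) (ht : s.target = [])
    (hr : s.counter .rounds = []) (hq : s.query = []) (hrI : s.revI = []) (hrM : s.revM = [])
    (hI : s.logI = (encI L.reverse).reverse) (hM : s.logM = (encM L.reverse).reverse)
    (hg : ∀ s' : Store V M, s'.query = Sim.query (s.coord .prover).reverse (s.coord .round).reverse
        (s.coord .bit).reverse L → s'.sim = s.sim →
      s'.claim = s.claim → s'.one = s.one → s'.five = s.five →
      ∃ c', Goes Y x p (config .send₀ s' an rd sn) bs n c' ∧ R c')
    (hN : n + 8 * (encI L.reverse).length + 4 * (encM L.reverse).length +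
      2 * (s.coord .prover).length + 4 * (s.coord .round).length + 2 * (s.coord .bit).length + 13
      ≤ N) :
    ∃ c', Goes Y x p (config (.strip .bit) s an rd sn) bs N c' ∧ R c' := by
  have hl : (binValue (s.coord .round).reverse).bits.length ≤ (s.coord .round).length := by
    simpa using length_bits_le (s.coord .round).reverse
  suffices h : ∃ c', Goes Y x p (config (.inc .rounds) (s.prepared
      (binValue (s.coord .prover).reverse) (binValue (s.coord .round).reverse)
      (binValue (s.coord .bit).reverse) L) an rd sn) bs (n + 6 * (encI L.reverse).length +
        2 * (encM L.reverse).length + 2 * (s.coord .round).length + 6) c' ∧ R c' by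
    obtain ⟨c', h, hR⟩ := h
    exact ⟨c', goes_prepare ht hr hq hrI hrM hI hM h (by omega), hR⟩
  rw [Sim.query] at hg
  generalize binValue (s.coord .prover).reverse = i at *
  generalize binValue (s.coord .round).reverse = j at *
  generalize binValue (s.coord .bit).reverse = b at *
  have hcl : (j.bits.map (!·)).tail.count true ≤ (s.coord .round).length :=
    List.count_le_length.trans (by simp; omega)
  have hv : binValue (j.bits.map (!·)).tail + j / 2 + 1 = 2 ^ (j.bits.map (!·)).tail.length := by
    have h1 := binValue_bits j
    cases hjb : j.bits with
    | nil => simp [hjb] at h1; simp [← h1]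
    | cons c l =>
      rw [hjb, binValue_cons] at h1
      have h2 := Bool.toNat_le c
      have h3 := binValue_map_not l
      simp only [List.map_cons, List.tail_cons, List.length_map]
      omega
  cases hj : j / 2 with
  | zero =>
    obtain ⟨c', h, hR⟩ := hg { s.prepared i j b L with
      counter := Function.update (s.prepared i j b L).counter .rounds
        (incr ((s.prepared i j b L).counter .rounds)) }
      (by simp [hj, Store.prepared, queryToks, outToks, dat_reverse]) rfl rfl rfl rfl
    refine ⟨c', goes_rounds (h := 0) hc ?_ (fun _ => h) (fun k hk => by simp at hk) ?_, hR⟩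
    · simpa [Store.prepared, hj] using hv
    · simp only [Store.prepared, Function.update_self]
      omega
  | succ k =>
    have hv' : binValue (incr (j.bits.map (!·)).tail) + k + 1 =
      2 ^ (incr (j.bits.map (!·)).tail).length := by
      have hall : (j.bits.map (!·)).tail.all id = false := by
        rw [← Bool.not_eq_true, all_iff_binValue]
        omega
      rw [binValue_incr, length_incr, hall, Bool.toNat_false, add_zero]
      omega
    obtain ⟨c', h, hR⟩ := goes_event (s := { s.prepared i j b L with
      counter := Function.update (s.prepared i j b L).counter .rounds
        (incr ((s.prepared i j b L).counter .rounds)) }) (n := n) (i := i) (L := L.reverse) (h := k)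
      (R := R) (Y := Y) (x := x) (p := p) (an := an) (rd := rd) (sn := sn) (bs := bs)
      (N := n + 6 * (encI L.reverse).length + 2 * (encM L.reverse).length +
        2 * (incr (j.bits.map (!·)).tail).count true + 1)
      hc hsv rfl (by simpa [Store.prepared] using hv') rfl rfl
      (fun s' h1 h2 h3 h4 h5 => hg s' (by
        rw [h1, hj]
        simp [Store.prepared, queryToks, dat_reverse]) h2 h3 h4 h5) (by simp [Store.prepared])
    refine ⟨c', goes_rounds (n := n + 6 * (encI L.reverse).length + 2 * (encM L.reverse).length +
      2 * (incr (j.bits.map (!·)).tail).count true + 1) (h := k + 1) hc ?_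
      (fun hk => by simp at hk) (fun k' hk => ?_) ?_, hR⟩
    · simpa [Store.prepared, hj] using hv
    · obtain rfl : k = k' := by omega
      exact h
    · simp only [Store.prepared, Function.update_self]
      omega

end Reach

end MRIP

namespace MRIP

/-! ### The last two rounds and the payment -/

/-- The messages after the query `q` has been sent in round 4. -/
def withQuery (sn : ℕ → ℕ → List Bool) (q : List Tok) : ℕ → ℕ → List Bool :=
  Function.update sn 1 (Function.update (sn 1) 4 (sn 1 4 ++ wire q))

section Reach

variable {V M : Machine} {Y : Layout} {x : List Bool} {p : Profile} {s : Store V M}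
  {an : Option Bool} {rd : ℕ} {sn : ℕ → ℕ → List Bool} {bs : List Bool} {n N : ℕ}
  {c' : (simulator V M).Config}

/-- The output stacks are emptied, and then a payment of `1` or `0` is written. -/
theorem goes_pay (ok : Bool) {m : ℕ} (h1 : (s.sim V.num).length ≤ m)
    (h2 : (s.sim V.den).length ≤ m) :
    ∃ c', Goes Y x p (config (.pay ok) s an rd sn) [] (m + 1) c' ∧
      c'.state = (simulator V M).halt ∧ c'.sent = sn ∧
      c'.stack (.sim V.num) = (if ok then [true] else []) ∧
      c'.stack (.sim V.den) = (if ok then [true] else []) := by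
  have hexit : ∀ s : Store V M, s.sim V.num = [] → s.sim V.den = [] →
    ∃ c', Goes Y x p (config (.pay ok) s an rd sn) [] 1 c' ∧
      c'.state = (simulator V M).halt ∧ c'.sent = sn ∧
      c'.stack (.sim V.num) = (if ok then [true] else []) ∧
      c'.stack (.sim V.den) = (if ok then [true] else []) := by
    intro s h3 h4
    refine ⟨_, reach_idle (n := 0) (l' := .halt) (s' := { s with
      sim := fun k => if ok = true ∧ (k = V.num ∨ k = V.den) then [true] else s.sim k })
      (by simp) (by simp [IsDraw]) ?_ ?_ ?_ (.refl _ _), rfl, rfl, ?_, ?_⟩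
    · intro r; simp [next, Store.tops, Store.toFun, h3, h4]
    · intro r a
      simp only [next, Store.tops, Store.toFun, h3, h4, List.head?_nil, and_self, if_true]
      cases a <;> try rfl
      rename_i k
      by_cases hk : ok = true ∧ (k = V.num ∨ k = V.den)
      · simp only [if_pos hk, StackOp.apply]
        rcases hk.2 with rfl | rfl
        · simp [h3]
        · simp [h4]
      · simp only [if_neg hk, StackOp.apply]
    · intro r; simp [next, Store.tops, Store.toFun, h3, h4]
    · cases ok <;> simp [config, Store.toFun, h3]
    · cases ok <;> simp [config, Store.toFun, h4]
  induction m generalizing s with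
  | zero =>
    exact hexit s (List.eq_nil_of_length_eq_zero (by omega))
      (List.eq_nil_of_length_eq_zero (by omega))
  | succ m ih =>
    by_cases h0 : s.sim V.num = [] ∧ s.sim V.den = []
    · obtain ⟨c', hc, h⟩ := hexit s h0.1 h0.2
      exact ⟨c', hc.mono (by omega), h⟩
    · obtain ⟨c', hc, h⟩ := ih (s := { s with
        sim := fun k => (popTwo V.num V.den k).apply (s.sim k) })
        (by simp [popTwo, StackOp.apply]; omega) (by simp [popTwo, StackOp.apply]; omega)
      refine ⟨c', reach_idle (by simp) (by simp [IsDraw]) ?_ ?_ ?_ hc, h⟩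
      · intro r
        simp only [next, Store.tops, Store.toFun, List.head?_eq_none_iff, h0, if_false]
      · intro r a
        simp only [next, Store.tops, Store.toFun, List.head?_eq_none_iff, h0, if_false]
        cases a <;> rfl
      · intro r
        simp only [next, Store.tops, Store.toFun, List.head?_eq_none_iff, h0, if_false]

/-- The query is sent to the second prover, and his reply `b` is compared with the claimed bit `w`.
-/
theorem goes_reply (hp : Y.provers = 2) (hr : Y.rounds = 5) (hl : 0 < Y.len 1 5)
    (h1 : s.one = [true]) (h5 : s.five = [true, false, true]) {m : ℕ}
    (hn : (s.sim V.num).length ≤ m) (hd : (s.sim V.den).length ≤ m) {w b : Bool}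
    (hw : s.claim = [w])
    (hb : (Y.message p (withQuery sn s.query) 1 5)[0]? = some b) :
    ∃ c', Goes Y x p (config .send₀ s an 4 sn) [] (m + 6) c' ∧
      c'.state = (simulator V M).halt ∧ c'.sent = withQuery sn s.query ∧
      c'.stack (.sim V.num) = (if w = b then [true] else []) ∧
      c'.stack (.sim V.den) = (if w = b then [true] else []) := by
  obtain ⟨c', hc, hc1, hc2, hc3, hc4⟩ := goes_pay (Y := Y) (x := x) (p := p) (an := some b)
    (rd := 6) (sn := withQuery sn s.query) (s := { s with query := [] }) (w == b) hn hd
  refine ⟨c', ?_, hc1, hc2, by simpa using hc3, by simpa using hc4⟩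
  have e1 : binValue [true] = 1 := rfl
  have e5 : binValue [true, false, true] = 5 := rfl
  refine .det (c₁ := ⟨Label.send₁, Function.update (Function.update s.toFun Stk.one [])
      (Stk.query false) [], an, 4, Function.update sn 1 (Function.update (sn 1) 4
        (sn 1 4 ++ half false s.query))⟩)
    (by simp [config, IsDraw]) (fun r => ?_) ?_
  · rw [step_config (l' := .send₁) (s' := s) (mv := .send .one (.query false)) (by simp) rfl
      (fun _ => rfl) rfl]
    simp only [Machine.act, config, Store.toFun, h1, e1, hp, hr]
    rw [if_pos (by decide)]
  refine .det (c₁ := config .close { s with one := [], query := [] } an 4 (withQuery sn s.query))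
    (by simp [IsDraw]) (fun r => ?_) ?_
  · rw [Machine.step, if_neg (by simp)]
    have hnext : ∀ t an r, next V M .send₁ t an r =
      (.close, fun | .one => .push true | _ => .keep, .send .one (.query true)) := fun _ _ _ => rfl
    simp only [hnext, Machine.act]
    have e6 : (StackOp.push true).apply (Function.update (Function.update s.toFun Stk.one [])
      (Stk.query false) [] Stk.one) = [true] := rfl
    simp only [e6, e1, hp, hr]
    rw [if_pos (by decide)]
    simp only [Option.some.injEq, config, Machine.Config.mk.injEq, true_and]
    constructor
    · funext a
      cases a <;> try rfl
      rename_i h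
      cases h <;> rfl
    · have e7 : StackOp.keep.apply (Function.update (Function.update s.toFun Stk.one [])
        (Stk.query false) [] (Stk.query true)) = half true s.query := rfl
      rw [e7]
      simp only [withQuery, wire, Function.update_self, Function.update_idem, List.append_assoc]
      rfl
  refine reach_move (l' := .readReply) (s' := { s with one := [], query := [] }) .nextRound
    (by simp) (by simp [IsDraw]) (fun _ => rfl) (fun r a => rfl) (fun _ => rfl)
    (c₁ := config .readReply { s with one := [], query := [] } an 6 (withQuery sn s.query)) ?_ ?_
  · simp [Machine.act, config, hr]
  refine reach_move (l' := .judge) (s' := { s with query := [] }) (.readMessage .one .five .zero)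
    (by simp) (by simp [IsDraw]) (fun _ => rfl) (fun r a => ?_) (fun _ => rfl)
    (c₁ := config .judge { s with query := [] } (some b) 6 (withQuery sn s.query)) ?_ ?_
  · cases a <;> try rfl
    simp [next, Store.toFun, h1, StackOp.apply]
  · simp only [Machine.act, config, Store.toFun, binValue_nil, h1, h5, e1, e5, hp, hr]
    rw [if_pos ⟨by decide, by decide, by decide, by decide, hl⟩, hb]
  refine reach_idle (s' := { s with query := [] }) (l' := .pay (w == b)) (by simp)
    (by simp [IsDraw]) ?_ (fun r a => rfl) (fun _ => rfl) hc
  intro r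
  simp [next, Store.tops, Store.toFun, hw]

/-- The coordinates of the bit to be checked are moved from the simulated stacks, which need not be
distinct. -/
theorem goes_load {i j b : V.K} {m : ℕ} (hi : (s.sim i).length ≤ m) (hj : (s.sim j).length ≤ m)
    (hb : (s.sim b).length ≤ m)
    (h : Goes Y x p (config (.strip .bit) { s with
        sim := fun k => if k = i ∨ k = j ∨ k = b then [] else s.sim k
        coord := fun
          | .prover => (s.sim i).reverse ++ s.coord .prover
          | .round => (s.sim j).reverse ++ s.coord .round
          | .bit => (s.sim b).reverse ++ s.coord .bit } an rd sn) bs n c') :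
    Goes Y x p (config (.load i j b) s an rd sn) bs (n + m + 1) c' := by
  have hnil : ∀ s : Store V M, s.sim i = [] → s.sim j = [] → s.sim b = [] →
      Goes Y x p (config (.strip .bit) { s with
        sim := fun k => if k = i ∨ k = j ∨ k = b then [] else s.sim k
        coord := fun
          | .prover => (s.sim i).reverse ++ s.coord .prover
          | .round => (s.sim j).reverse ++ s.coord .round
          | .bit => (s.sim b).reverse ++ s.coord .bit } an rd sn) bs n c' →
      Goes Y x p (config (.load i j b) s an rd sn) bs (n + 1) c' := by
    intro s h1 h2 h3 h
    have e : (fun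
          | .prover => (s.sim i).reverse ++ s.coord .prover
          | .round => (s.sim j).reverse ++ s.coord .round
          | .bit => (s.sim b).reverse ++ s.coord .bit : Coord → List Bool) = s.coord := by
      funext w; cases w <;> simp [h1, h2, h3]
    have e' : (fun k => if k = i ∨ k = j ∨ k = b then [] else s.sim k) = s.sim := by
      funext k
      split_ifs with hk
      · rcases hk with rfl | rfl | rfl
        · exact h1.symm
        · exact h2.symm
        · exact h3.symm
      · rfl
    rw [e, e'] at h
    refine reach_idle (by simp) (by simp [IsDraw]) ?_ ?_ ?_ h
    · intro r; simp [next, Store.tops, Store.toFun, h1, h2, h3]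
    · intro r a; simp [next, Store.tops, Store.toFun, h1, h2, h3, StackOp.apply]
    · intro r; simp [next, Store.tops, Store.toFun, h1, h2, h3]
  induction m generalizing s with
  | zero =>
    exact hnil s (List.eq_nil_of_length_eq_zero (by omega))
      (List.eq_nil_of_length_eq_zero (by omega)) (List.eq_nil_of_length_eq_zero (by omega)) h
  | succ m ih =>
    by_cases h0 : s.sim i = [] ∧ s.sim j = [] ∧ s.sim b = []
    · exact (hnil s h0.1 h0.2.1 h0.2.2 h).mono (by omega)
    have htail : ∀ l l' : List Bool, l.tail.reverse ++ (l.head?.toList ++ l') =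
        l.reverse ++ l' := by
      intro l l'; cases l <;> simp
    have e : (fun k => if k = i ∨ k = j ∨ k = b then [] else
        if k = i ∨ k = j ∨ k = b then (s.sim k).tail else s.sim k) =
        fun k => if k = i ∨ k = j ∨ k = b then [] else s.sim k := by
      funext k; split_ifs <;> rfl
    refine reach_idle (l' := .load i j b) (s' := { s with
      sim := fun k => if k = i ∨ k = j ∨ k = b then (s.sim k).tail else s.sim k
      coord := fun
        | .prover => (s.sim i).head?.toList ++ s.coord .prover
        | .round => (s.sim j).head?.toList ++ s.coord .round
        | .bit => (s.sim b).head?.toList ++ s.coord .bit }) (by simp) (by simp [IsDraw]) ?_ ?_ ?_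
      (ih (by simp; omega) (by simp; omega) (by simp; omega) (by simpa [htail, e] using h))
    · intro r
      simp only [next, Store.tops, Store.toFun, List.head?_eq_none_iff, h0, if_false]
    · intro r a
      simp only [next, Store.tops, Store.toFun, List.head?_eq_none_iff, h0, if_false]
      cases a <;> try rfl
      · rename_i k
        by_cases hk : k = i ∨ k = j ∨ k = b
        · simp [hk, StackOp.apply]
        · simp [hk, StackOp.apply]
      · rename_i w
        cases w
        · cases hl : s.sim b <;> simp [pushOpt, StackOp.apply]
        · cases hl : s.sim j <;> simp [pushOpt, StackOp.apply]
        · cases hl : s.sim i <;> simp [pushOpt, StackOp.apply]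
    · intro r
      simp only [next, Store.tops, Store.toFun, List.head?_eq_none_iff, h0, if_false]

/-- A message that the simulated verifier sends is moved to the log. -/
theorem goes_simSend {q : V.Q} {src : Option (Option Bool)} {i j : V.K} {m : ℕ}
    (hi : (s.sim i).length ≤ m) (hj : (s.sim j).length ≤ m)
    (h : Goes Y x p (config (.sim q src) { s with
        sim := Function.update (Function.update s.sim i []) j []
        logI := endMark :: ((dat (s.sim i)).reverse ++ s.logI)
        logM := endMark :: ((dat (s.sim j)).reverse ++ s.logM) } an rd sn) bs n c') :
    Goes Y x p (config (.simSend q src i j) s an rd sn) bs (n + m + 1) c' := by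
  have hnil : ∀ s : Store V M, s.sim i = [] → s.sim j = [] →
      Goes Y x p (config (.sim q src) { s with
        sim := Function.update (Function.update s.sim i []) j []
        logI := endMark :: ((dat (s.sim i)).reverse ++ s.logI)
        logM := endMark :: ((dat (s.sim j)).reverse ++ s.logM) } an rd sn) bs n c' →
      Goes Y x p (config (.simSend q src i j) s an rd sn) bs (n + 1) c' := by
    intro s h1 h2
    have e : Function.update (Function.update s.sim i []) j [] = s.sim := by
      funext k
      by_cases h3 : k = j
      · subst h3; simp [h2]
      · by_cases h4 : k = i
        · subst h4; simp [h1, h3]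
        · simp [h3, h4]
    rw [e]
    refine reach_idle (by simp) (by simp [IsDraw]) ?_ ?_ ?_
    · intro r; simp [next, Store.tops, Store.toFun, h1, h2]
    · intro r a
      simp only [next, Store.tops, Store.toFun, h1, h2, List.head?_nil, and_self, if_true]
      cases a <;> try rfl
    · intro r; simp [next, Store.tops, Store.toFun, h1, h2]
  induction m generalizing s with
  | zero =>
    exact hnil s (List.eq_nil_of_length_eq_zero (by omega))
      (List.eq_nil_of_length_eq_zero (by omega)) h
  | succ m ih =>
    by_cases h0 : s.sim i = [] ∧ s.sim j = []
    · exact (hnil s h0.1 h0.2 h).mono (by omega)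
    have htail : ∀ (l : List Bool) (l' : List Tok),
        (dat l.tail).reverse ++ (dat l.head?.toList ++ l') = (dat l).reverse ++ l' := by
      intro l l'; cases l <;> simp
    refine reach_idle (l' := .simSend q src i j) (s' := { s with
      sim := fun k => (popTwo i j k).apply (s.sim k)
      logI := dat (s.sim i).head?.toList ++ s.logI
      logM := dat (s.sim j).head?.toList ++ s.logM }) (by simp) (by simp [IsDraw]) ?_ ?_ ?_
      (ih ?_ ?_ ?_)
    · intro r
      simp only [next, Store.tops, Store.toFun, List.head?_eq_none_iff, h0, if_false]
    · intro r a
      simp only [next, Store.tops, Store.toFun, List.head?_eq_none_iff, h0, if_false]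
      cases a <;> try rfl
      · cases hl : s.sim i <;> simp [pushOptTok, pushTok, StackOp.apply]
      · cases hl : s.sim j <;> simp [pushOptTok, pushTok, StackOp.apply]
    · intro r
      simp only [next, Store.tops, Store.toFun, List.head?_eq_none_iff, h0, if_false]
    · simp [popTwo, StackOp.apply]; omega
    · simp [popTwo, StackOp.apply]; omega
    · have e : Function.update (Function.update (fun k => (popTwo i j k).apply (s.sim k)) i []) j []
          = Function.update (Function.update s.sim i []) j [] := by
        funext k
        by_cases h3 : k = j
        · subst h3; simp
        · by_cases h4 : k = i
          · subst h4; simp [h3]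
          · simp [h3, h4, popTwo, StackOp.apply]
      have e1 : (popTwo i j i).apply (s.sim i) = (s.sim i).tail := by simp [popTwo, StackOp.apply]
      have e2 : (popTwo i j j).apply (s.sim j) = (s.sim j).tail := by simp [popTwo, StackOp.apply]
      simp only [e, e1, e2, htail]
      exact h

end Reach

end MRIP

namespace MRIP

/-! ### The whole simulation -/

namespace Sim

variable {V : Machine}

/-- The total length of the stacks. -/
def size (v : V.K → List Bool) : ℕ := ∑ k, (v k).length

/-- The potential of a state of the simulation, which bounds the time that is needed for emptying
stacks and for the construction of a query. The factor `3` ensures that the potential does not rise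
when two stacks are moved to the log, apart from two end marks. -/
def potential (a : Sim V) : ℕ :=
  3 * size a.stack + (encI a.log.reverse).length + (encM a.log.reverse).length

theorem length_le_size (v : V.K → List Bool) (k : V.K) : (v k).length ≤ size v :=
  Finset.single_le_sum (f := fun k => (v k).length) (fun _ _ => Nat.zero_le _) (Finset.mem_univ k)

theorem size_stack' (a : Sim V) (r : Bool) :
    size (a.stack' r) ≤ size a.stack + Fintype.card V.K := by
  calc size (a.stack' r) ≤ ∑ k, ((a.stack k).length + 1) := by
        refine Finset.sum_le_sum fun k _ => ?_
        unfold stack'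
        cases ((a.next r).2.1 k) <;> simp [StackOp.apply]
        omega
    _ = _ := by simp [Finset.sum_add_distrib, size]

theorem size_update (v : V.K → List Bool) (i m : V.K) :
    size (Function.update (Function.update v i []) m []) + max (v i).length (v m).length ≤
      size v := by
  have h : ∀ (v : V.K → List Bool) (i : V.K),
      size (Function.update v i []) + (v i).length = size v := by
    intro v i
    have h1 := Finset.add_sum_erase Finset.univ (fun k => (v k).length) (Finset.mem_univ i)
    have h2 := Finset.add_sum_erase Finset.univ (fun k => (Function.update v i [] k).length)
      (Finset.mem_univ i)
    have h3 : ∑ k ∈ Finset.univ.erase i, (Function.update v i [] k).length =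
        ∑ k ∈ Finset.univ.erase i, (v k).length :=
      Finset.sum_congr rfl fun k hk => by rw [Function.update_of_ne (Finset.ne_of_mem_erase hk)]
    simp only [Function.update_self, List.length_nil] at h2
    simp only [size]
    omega
  have h1 := h v i
  have h2 := h v m
  have h3 := h (Function.update v i []) m
  by_cases him : m = i
  · subst him
    simp only [Function.update_self, List.length_nil] at h3
    simp only [max_self]
    omega
  · rw [Function.update_of_ne him] at h3
    omega

theorem length_outToks_le (i h : ℕ) (L : List Event) :
    (outToks i h L).length ≤ (encI L).length + (encM L).length := by
  induction L generalizing h with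
  | nil => cases h <;> simp [outToks]
  | cons e L ih =>
    cases h with
    | zero => simp [outToks]
    | succ h =>
      match e with
      | none =>
        have := ih h
        simp only [outToks, List.length_cons, encI_none, encM_none]
        omega
      | some (e, m) =>
        have := ih (h + 1)
        simp only [outToks, encI_some, encM_some, List.length_append, List.length_cons, length_dat]
        split_ifs <;> simp <;> omega

theorem length_query_le (i j b : List Bool) (L : List Event) :
    (query i j b L).length ≤ i.length + j.length + b.length + 3 + (encI L.reverse).length +
      (encM L.reverse).length := by
  have h1 := length_bits_le i
  have h2 := length_bits_le j
  have h3 := length_bits_le b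
  have h4 := length_outToks_le (binValue i) (binValue j / 2) L.reverse
  simp only [query, queryToks, List.length_reverse, List.length_append, blocks_cons, blocks_nil,
    length_dat, List.length_cons, List.length_nil]
  omega

end Sim

section Reach

variable {V M : Machine} {Y : Layout} {x : List Bool} {p : Profile} {s : Store V M}
  {an : Option Bool} {rd : ℕ} {sn : ℕ → ℕ → List Bool} {bs : List Bool} {n N : ℕ}
  {c' : (simulator V M).Config}

/-- The store at the steps of the simulation `a` with the remaining bits `rs`, `ws`, `ms`. -/
structure Store.Follows (s : Store V M) (a : Sim V) (rs ws ms : List Bool) : Prop where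
  sim : s.sim = a.stack
  logI : s.logI = (encI a.log.reverse).reverse
  logM : s.logM = (encM a.log.reverse).reverse
  rand : s.rand = rs
  claims : s.claims = ws
  marks : s.marks = ms
  carry : s.carry = []
  saved : s.saved = []
  target : s.target = []
  rounds : s.counter .rounds = []
  query : s.query = []
  revI : s.revI = []
  revM : s.revM = []
  coord : s.coord = fun _ => []
  claim : s.claim = []
  one : s.one = [true]
  five : s.five = [true, false, true]

/-- The results of the verifier: it pays what the simulated verifier would pay, or it checks
whether the claimed bit agrees with the reply of the second prover, who follows `f`. -/
def Outcome (f : List Tok → Bool) (flag : Bool) (sn : ℕ → ℕ → List Bool) (a : Sim V)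
    (qw : List Tok × Bool) (B : ℕ) (c' : (simulator V M).Config) : Prop :=
  c'.state = (simulator V M).halt ∧
    if flag then c'.sent = sn ∧ c'.stack (.sim V.num) = a.stack V.num ∧
      c'.stack (.sim V.den) = a.stack V.den
    else c'.sent = withQuery sn qw.1 ∧ qw.1.length ≤ B ∧
      c'.stack (.sim V.num) = (if qw.2 = f qw.1 then [true] else []) ∧
      c'.stack (.sim V.den) = (if qw.2 = f qw.1 then [true] else [])

/-- The query, the reply and the payment, from the coordinates of the bit to be checked. -/
theorem goes_check {f : List Tok → Bool} (hp : Y.provers = 2) (hr : Y.rounds = 5)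
    (hl : 0 < Y.len 1 5) (hf : ∀ q, (Y.message p (withQuery sn q) 1 5)[0]? = some (f q))
    {L : List Event} {w : Bool} (hc : s.carry = []) (hsv : s.saved = []) (ht : s.target = [])
    (hro : s.counter .rounds = []) (hq : s.query = []) (hrI : s.revI = []) (hrM : s.revM = [])
    (h1 : s.one = [true]) (h5 : s.five = [true, false, true])
    (hI : s.logI = (encI L.reverse).reverse) (hM : s.logM = (encM L.reverse).reverse)
    (hw : s.claim = [w]) {q : List Tok} {m : ℕ}
    (hqq : Sim.query (s.coord .prover).reverse (s.coord .round).reverse (s.coord .bit).reverse L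
      = q)
    (hn : (s.sim V.num).length ≤ m) (hd : (s.sim V.den).length ≤ m)
    (hN : m + 8 * (encI L.reverse).length + 4 * (encM L.reverse).length +
      2 * (s.coord .prover).length + 4 * (s.coord .round).length + 2 * (s.coord .bit).length + 19
      ≤ N) (a : Sim V) {B : ℕ} (hB : q.length ≤ B) :
    ∃ c', Goes Y x p (config (.strip .bit) s an 4 sn) [] N c' ∧
      Outcome f false sn a (q, w) B c' := by
  refine goes_query (n := m + 6) hc hsv ht hro hq hrI hrM hI hM ?_ (by omega)
  intro s' h2 h3 h4 h6 h7
  rw [hqq] at h2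
  obtain ⟨c', hc', hs, h8, h9, h10⟩ := goes_reply (V := V) (M := M) (x := x) (an := an) hp hr hl
    (h6.trans h1) (h7.trans h5) (m := m) (by rw [h3]; exact hn) (by rw [h3]; exact hd)
    (h4.trans hw) (by rw [h2]; exact hf q)
  rw [h2] at h8
  exact ⟨c', hc', hs, h8, hB, h9, h10⟩

/-- The end of the simulation, where the answer bit is checked if the verifier does not pay what
the simulated verifier would pay. -/
theorem goes_done {f : List Tok → Bool} (hp : Y.provers = 2) (hr : Y.rounds = 5)
    (hl : 0 < Y.len 1 5) (hf : ∀ q, (Y.message p (withQuery sn q) 1 5)[0]? = some (f q))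
    {a₀ : Bool} (ha₀ : (Y.message p sn 0 1)[0]? = some a₀) {flag : Bool}
    (hfl : flag = !s.flag.isEmpty) {a : Sim V} {rs ws ms : List Bool} (h : s.Follows a rs ws ms)
    (hN : 12 * a.potential + 40 ≤ N) :
    ∃ c', Goes Y x p (config .done s an 4 sn) [] N c' ∧
      Outcome f flag sn a (queryToks 0 1 0 [], a₀) 10 c' := by
  obtain ⟨k, rfl⟩ : ∃ k, N = k + 3 := ⟨N - 3, by omega⟩
  cases hs : s.flag with
  | cons b l =>
    rw [hs] at hfl
    obtain rfl : flag = true := hfl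
    refine ⟨config .halt s an 4 sn, reach_idle (s' := s) (l' := .halt) (by simp)
      (by simp [IsDraw]) ?_ ?_ ?_ (.refl _ _), rfl, ?_⟩
    · intro r; simp [next, Store.tops, Store.toFun, hs]
    · intro r a
      simp only [next, Store.tops, Store.toFun, hs, List.head?_cons]
      rfl
    · intro r; simp [next, Store.tops, Store.toFun, hs]
    · simp [config, Store.toFun, h.sim]
  | nil =>
    rw [hs] at hfl
    obtain rfl : flag = false := hfl
    have e1 : binValue [true] = 1 := rfl
    have hlen := (List.getElem?_eq_some_iff.1 ha₀).1
    rw [Layout.length_message] at hlen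
    have hsz := fun k => Sim.length_le_size a.stack k
    obtain ⟨c', hc', ho⟩ := goes_check (V := V) (M := M) (Y := Y) (x := x) (p := p) (an := some a₀)
      (N := k) (s := { s with
        one := [true], claim := [a₀]
        coord := fun | .round => [true] | _ => [] }) hp hr hl hf h.carry h.saved
      h.target h.rounds h.query h.revI h.revM rfl h.five h.logI h.logM rfl
      (q := queryToks 0 1 0 []) (m := a.potential) (by simp [Sim.query, outToks, e1])
      (by rw [h.sim]; have := hsz V.num; simp only [Sim.potential]; omega)
      (by rw [h.sim]; have := hsz V.den; simp only [Sim.potential]; omega)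
      (by simp [Sim.potential] at hN ⊢; omega) a (B := 10) (by simp [queryToks])
    refine ⟨c', ?_, ho⟩
    refine reach_idle (l' := .readAnswer) (s' := s) (by simp) (by simp [IsDraw]) ?_ ?_ ?_ ?_
    · intro r; simp [next, Store.tops, Store.toFun, hs]
    · intro r a
      simp only [next, Store.tops, Store.toFun, hs, List.head?_nil]
      rfl
    · intro r; simp [next, Store.tops, Store.toFun, hs]
    refine reach_move (l' := .storeAnswer) (s' := s) (.readMessage .zero .one .zero) (by simp)
      (by simp [IsDraw]) (fun _ => rfl) (fun _ _ => rfl) (fun _ => rfl)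
      (c₁ := config .storeAnswer s (some a₀) 4 sn) ?_ ?_
    · simp only [Machine.act, config, Store.toFun, binValue_nil, h.one, e1, hp, hr]
      rw [if_pos ⟨by decide, by decide, by decide, by decide, hlen⟩, ha₀]
    refine reach_idle (by simp) (by simp [IsDraw]) (fun _ => rfl) ?_ (fun _ => rfl) hc'
    intro r a
    cases a <;> try rfl
    · rename_i w
      simp only [next, Store.toFun, h.coord]
      cases w <;> rfl
    · simp only [next, Store.toFun, h.claim]
      rfl
    · simp [next, Store.toFun, h.one, StackOp.apply]

/-- The simulation, which runs up to the first marked step that reads a message bit, or to its end.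
A step raises the potential by at most `3` for each stack and `2` for end marks, and takes constant
time apart from the time that is paid by a loss of potential. -/
theorem goes_sim {f : List Tok → Bool} (hp : Y.provers = 2) (hr : Y.rounds = 5)
    (hl : 0 < Y.len 1 5) (hf : ∀ q, (Y.message p (withQuery sn q) 1 5)[0]? = some (f q))
    {a₀ : Bool} (ha₀ : (Y.message p sn 0 1)[0]? = some a₀) {flag : Bool}
    (hfl : flag = !s.flag.isEmpty) {a : Sim V} {rs ws ms : List Bool} (h : s.Follows a rs ws ms)
    (hws : ws.length = rs.length) (hms : ms.length = rs.length) {src : Option (Option Bool)}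
    (hsrc : src.getD an = a.answer) {B : ℕ}
    (hB : a.potential + rs.length * (3 * Fintype.card V.K + 4) + 10 ≤ B)
    (hN : 12 * (a.potential + rs.length * (3 * Fintype.card V.K + 4)) + 41 ≤ N) :
    ∃ c', Goes Y x p (config (.sim a.state src) s an 4 sn) [] N c' ∧
      Outcome f flag sn (a.run x rs ws)
        (Sim.check x (queryToks 0 1 0 [], a₀) a rs ws ms) B c' := by
  have hmono : ∀ {a' : Sim V} {qw : List Tok × Bool} {B' : ℕ} {c'}, B' ≤ B →
      Outcome (M := M) f flag sn a' qw B' c' → Outcome f flag sn a' qw B c' := by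
    rintro a' qw B' c' hb ⟨h1, h2⟩
    refine ⟨h1, ?_⟩
    cases flag with
    | true => exact h2
    | false => exact ⟨h2.1, h2.2.1.trans hb, h2.2.2⟩
  have hdone : ∀ {s : Store V M} {a : Sim V} {an : Option Bool} {src : Option (Option Bool)}
      {rs ws ms : List Bool} {N : ℕ}, flag = (!s.flag.isEmpty) → s.Follows a rs ws ms → 10 ≤ B →
      12 * a.potential + 41 ≤ N →
      (∀ r, next V M (.sim a.state src) s.tops an r = (.done, fun _ => .keep, .idle)) →
      ∃ c', Goes Y x p (config (.sim a.state src) s an 4 sn) [] N c' ∧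
      Outcome f flag sn a (queryToks 0 1 0 [], a₀) B c' := by
    intro s a an src rs ws ms N hfl h hB hN hd
    obtain ⟨k, rfl⟩ : ∃ k, N = k + 1 := ⟨N - 1, by omega⟩
    obtain ⟨c', hc', ho⟩ := goes_done (V := V) (M := M) (N := k) (x := x) (an := an) hp hr hl hf ha₀
      hfl h (by omega)
    exact ⟨c', reach_idle (s' := s) (by simp) (by simp [IsDraw]) (fun r => by rw [hd])
      (fun r a => by rw [hd]; rfl) (fun r => by rw [hd]) hc', hmono hB ho⟩
  induction rs generalizing a s ws ms an src N with
  | nil =>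
    have : Sim.run x a [] ws = a := by cases ws <;> rfl
    rw [this]
    have : Sim.check x (queryToks 0 1 0 [], a₀) a [] ws ms = (queryToks 0 1 0 [], a₀) := by
      cases ws <;> cases ms <;> rfl
    rw [this]
    refine hdone hfl h (by omega) (by simp at hN; omega) fun r => ?_
    by_cases hh : a.state = V.halt
    · simp [next, hh]
    · simp [next, hh, Store.tops, Store.toFun, h.rand]
  | cons r rs ih =>
    obtain ⟨w, ws, rfl⟩ := List.exists_cons_of_length_pos (l := ws) (by simp [hws])
    obtain ⟨m, ms, rfl⟩ := List.exists_cons_of_length_pos (l := ms) (by simp [hms])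
    by_cases hh : a.state = V.halt
    · rw [Sim.run_of_halt x hh, Sim.check_of_halt x _ hh]
      exact hdone hfl h (by omega) (by rw [mul_add] at hN; omega) fun r => by simp [next, hh]
    simp only [List.length_cons, Nat.add_right_cancel_iff] at hws hms
    have key : ∀ r', next V M (.sim a.state src) s.tops an r' =
        simNext V M src s.tops (a.next r) := by
      intro r'
      have e1 : s.tops .rand = some r := by simp [Store.tops, Store.toFun, h.rand]
      have e2 : (fun k => s.tops (.sim k)) = fun k => (a.stack k).head? := by
        funext k; simp [Store.tops, Store.toFun, h.sim]
      simp only [next, hh, if_false, e1, e2, hsrc, Sim.next]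
    have hst := Sim.size_stack' a r
    generalize hκ : Fintype.card V.K = κ at *
    rw [List.length_cons, add_mul, one_mul] at hB hN
    have hpot : a.potential = 3 * Sim.size a.stack + (encI a.log.reverse).length +
      (encM a.log.reverse).length := rfl
    obtain ⟨N, rfl⟩ : ∃ k, N = k + 1 := ⟨N - 1, by omega⟩
    -- The stacks after the step, apart from the logs and the answer.
    have hops : ∀ (b : Stk V.K M.K), (simOps (a.next r).2.1 b).apply (s.toFun b) =
        ({ s with
          sim := a.stack' r, rand := rs, claims := ws, marks := ms } : Store V M).toFun b := by
      intro b
      cases b <;> try rfl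
      · simp only [simOps, Store.toFun, h.sim]; rfl
      · simp only [simOps, Store.toFun, h.rand]; rfl
      · simp only [simOps, Store.toFun, h.claims]; rfl
      · simp only [simOps, Store.toFun, h.marks]; rfl
    have hfol : ∀ {an' : Option Bool}, Store.Follows { s with
        sim := a.stack' r, rand := rs, claims := ws, marks := ms }
        (⟨(a.next r).1, a.stack' r, an', a.log⟩ : Sim V) rs ws ms := fun {_} =>
      { h with
        sim := rfl, rand := rfl, claims := rfl, marks := rfl, logI := h.logI, logM := h.logM }
    have hpot' : ∀ {an' : Option Bool}, Sim.potential
        (⟨(a.next r).1, a.stack' r, an', a.log⟩ : Sim V) ≤ a.potential + 3 * κ := by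
      intro an'
      simp only [Sim.potential]
      omega
    simp only [Sim.run, Sim.check]
    have hstep := Eq.refl (a.step x r w)
    have hask := Eq.refl (a.ask r)
    conv_rhs at hstep => rw [Sim.step, if_neg hh]
    conv_rhs at hask => rw [Sim.ask, if_neg hh]
    cases hmv : (a.next r).2.2 with
    | idle =>
      simp only [hmv] at hstep hask
      simp only [simNext, hmv] at key
      rw [hask, ite_self, hstep]
      obtain ⟨c', hc', ho⟩ := ih (N := N) (an := an) (src := src) (by exact hfl)
        (hfol (an' := a.answer)) hws hms hsrc
        (by have := hpot' (an' := a.answer); omega) (by have := hpot' (an' := a.answer); omega)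
      exact ⟨c', reach_idle (by simp) (by simp [IsDraw]) (fun r' => by rw [key])
        (fun r' b => by rw [key]; exact hops b) (fun r' => by rw [key]) hc', ho⟩
    | readInput k =>
      simp only [hmv] at hstep hask
      simp only [simNext, hmv] at key
      rw [hask, ite_self, hstep]
      obtain ⟨c', hc', ho⟩ := ih (N := N) (an := x[binValue (a.stack' r k)]?) (src := none)
        (by exact hfl) (hfol (an' := x[binValue (a.stack' r k)]?)) hws hms rfl
        (by have := hpot' (an' := x[binValue (a.stack' r k)]?); omega)
        (by have := hpot' (an' := x[binValue (a.stack' r k)]?); omega)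
      exact ⟨c', reach_move (.readInput (.sim k)) (by simp) (by simp [IsDraw])
        (fun r' => by rw [key]) (fun r' b => by rw [key]; exact hops b) (fun r' => by rw [key])
        rfl hc', ho⟩
    | readMessage i j b =>
      simp only [hmv] at hstep hask
      simp only [simNext, hmv] at key
      rw [hask, hstep]
      by_cases hcond : s.tops .marks = some true ∧ s.tops .flag = none
      · simp only [if_pos hcond] at key
        obtain ⟨h1, h2⟩ := hcond
        obtain rfl : m = true := by simpa [Store.tops, Store.toFun, h.marks] using h1
        have h3 : s.flag = [] := by simpa [Store.tops, Store.toFun] using h2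
        obtain rfl : flag = false := by rw [hfl, h3]; rfl
        simp only [if_true]
        have hsz := fun k => Sim.length_le_size (a.stack' r) k
        have hb1 := hsz i
        have hb2 := hsz j
        have hb3 := hsz b
        have hq := Sim.length_query_le (a.stack' r i) (a.stack' r j) (a.stack' r b) a.log
        have hz : ∀ k, (if k = i ∨ k = j ∨ k = b then [] else a.stack' r k).length ≤
            Sim.size (a.stack' r) := by
          intro k
          split_ifs
          · exact Nat.zero_le _
          · exact hsz k
        obtain ⟨c', hc', ho⟩ := goes_check (V := V) (M := M) (Y := Y) (x := x) (p := p) (an := an)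
          (f := f) (sn := sn)
          (N := N - Sim.size (a.stack' r) - 1) (s := { s with
            sim := fun k => if k = i ∨ k = j ∨ k = b then [] else a.stack' r k
            coord := fun
              | .prover => (a.stack' r i).reverse ++ []
              | .round => (a.stack' r j).reverse ++ []
              | .bit => (a.stack' r b).reverse ++ []
            rand := rs
            claims := ws
            marks := ms
            claim := [w] }) (L := a.log) hp hr hl hf h.carry h.saved h.target h.rounds h.query
          h.revI h.revM h.one h.five h.logI h.logM rfl (m := Sim.size (a.stack' r))
          (q := Sim.query (a.stack' r i) (a.stack' r j) (a.stack' r b) a.log) (by simp)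
          (hz _) (hz _) (by simp; omega)
          (Sim.run x (a.step x r w) rs ws) (B := B) (by omega)
        rw [hstep] at ho
        refine ⟨c', Machine.Reach.mono (n := (N - Sim.size (a.stack' r) - 1) +
          Sim.size (a.stack' r) + 1 + 1) ?_ (by omega), ho⟩
        refine reach_idle (l' := .load i j b) (s' := { s with
            sim := a.stack' r
            rand := rs
            claims := ws
            marks := ms
            claim := [w] }) (by simp) (by simp [IsDraw]) (fun r' => by rw [key]) ?_
          (fun r' => by rw [key]) (goes_load hb1 hb2 hb3 ?_)
        · intro r' a
          rw [key]
          by_cases ha : a = .claim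
          · subst ha
            simp [Store.tops, Store.toFun, h.claims, h.claim, pushOpt, StackOp.apply]
          · have := hops a
            cases a <;> first | exact this | exact absurd rfl ha
        · simp only [h.coord]
          exact hc'
      · simp only [if_neg hcond] at key
        have hqw : flag = true ∨ m = false := by
          rw [hfl]
          simp only [Store.tops, Store.toFun, h.marks, List.head?_cons, Option.some.injEq,
            List.head?_eq_none_iff] at hcond
          by_cases h0 : s.flag = []
          · right; simpa [h0] using hcond
          · left; simpa using h0
        obtain ⟨c', hc', ho⟩ := ih (N := N) (an := an) (src := some (some w))
          (by exact hfl) (hfol (an' := some w)) hws hms rfl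
          (by have := hpot' (an' := some w); omega)
          (by have := hpot' (an' := some w); omega)
        refine ⟨c', reach_idle (by simp) (by simp [IsDraw])
          (fun r' => by rw [key]; simp [Store.tops, Store.toFun, h.claims])
          (fun r' b => by rw [key]; exact hops b) (fun r' => by rw [key]) hc', ?_⟩
        rcases hqw with rfl | rfl
        · exact ho
        · exact ho
    | send i j =>
      simp only [hmv] at hstep hask
      simp only [simNext, hmv] at key
      rw [hask, ite_self, hstep]
      have hsz := Sim.size_update (a.stack' r) i j
      have h1 := le_max_left (a.stack' r i).length (a.stack' r j).length
      have h2 := le_max_right (a.stack' r i).length (a.stack' r j).length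
      set z := max (a.stack' r i).length (a.stack' r j).length
      have hp' : Sim.potential (⟨(a.next r).1,
          Function.update (Function.update (a.stack' r) i []) j [],
          a.answer, some (a.stack' r i, a.stack' r j) :: a.log⟩ : Sim V) + z ≤
          a.potential + 3 * κ + 2 := by
        simp only [Sim.potential, List.reverse_cons, encI_append, encM_append, encI_some, encM_some,
          encI_nil, encM_nil, List.length_append, List.length_cons, length_dat, List.length_nil]
        omega
      obtain ⟨c', hc', ho⟩ := ih (a := ⟨(a.next r).1,
          Function.update (Function.update (a.stack' r) i []) j [], a.answer,
          some (a.stack' r i, a.stack' r j) :: a.log⟩) (N := N - z - 1) (an := an)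
          (src := src) (s := { s with
          sim := Function.update (Function.update (a.stack' r) i []) j []
          logI := endMark :: ((dat (a.stack' r i)).reverse ++ s.logI)
          logM := endMark :: ((dat (a.stack' r j)).reverse ++ s.logM)
          rand := rs
          claims := ws
          marks := ms }) (by exact hfl)
        { h with
          sim := rfl
          rand := rfl
          claims := rfl
          marks := rfl
          logI := by simp [h.logI]
          logM := by simp [h.logM] } hws hms hsrc
        (by omega) (by omega)
      refine ⟨c', Machine.Reach.mono (n := (N - z - 1) + z + 1 + 1) ?_ (by omega), ho⟩
      exact reach_idle (by simp) (by simp [IsDraw]) (fun r' => by rw [key])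
        (fun r' b => by rw [key]; exact hops b) (fun r' => by rw [key]) (goes_simSend h1 h2 hc')
    | nextRound =>
      simp only [hmv] at hstep hask
      simp only [simNext, hmv] at key
      rw [hask, ite_self, hstep]
      have hp' : Sim.potential (⟨(a.next r).1, a.stack' r, a.answer, none :: a.log⟩ : Sim V) ≤
          a.potential + 3 * κ + 1 := by
        simp only [Sim.potential, List.reverse_cons, encI_append, encM_append, encI_none, encM_none,
          encI_nil, encM_nil, List.length_append, List.length_cons, List.length_nil]
        omega
      obtain ⟨c', hc', ho⟩ := ih (a := ⟨(a.next r).1, a.stack' r, a.answer, none :: a.log⟩)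
        (N := N) (an := an) (src := src) (s := { s with
          sim := a.stack' r
          logI := roundMark :: s.logI
          rand := rs
          claims := ws
          marks := ms }) (by exact hfl)
        { h with
          sim := rfl
          rand := rfl
          claims := rfl
          marks := rfl
          logI := by simp [h.logI]
          logM := by simp [h.logM] } hws hms hsrc
        (by omega) (by omega)
      refine ⟨c', reach_idle (by simp) (by simp [IsDraw]) (fun r' => by rw [key]) ?_
        (fun r' => by rw [key]) hc', ho⟩
      intro r' b
      rw [key]
      have := hops b
      cases b <;> first | exact this | rfl

end Reach

end MRIP

namespace MRIP

/-! ### The choice of the step to be checked -/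

theorem binValue_iterate_incr (n : ℕ) (l : List Bool) :
    binValue (incr^[n] l) = binValue l + n := by
  induction n with
  | zero => rfl
  | succ n ih => rw [Function.iterate_succ_apply', binValue_incr, ih]; ring

/-- The number of binary digits of `n`. -/
def digits (n : ℕ) : ℕ := (incr^[n] []).length

theorem lt_two_pow_digits (n : ℕ) : n < 2 ^ digits n := by
  have := binValue_lt (incr^[n] [])
  rwa [binValue_iterate_incr, binValue_nil, zero_add] at this

theorem two_pow_digits_le {n : ℕ} (hn : 1 ≤ n) : 2 ^ digits n ≤ 2 * n := by
  induction n, hn using Nat.le_induction with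
  | base => decide
  | succ n _ ih =>
    unfold digits at ih ⊢
    rw [Function.iterate_succ_apply', length_incr]
    cases h : (incr^[n] []).all id with
    | true =>
      have := (all_iff_binValue _).1 h
      rw [binValue_iterate_incr, binValue_nil, zero_add] at this
      rw [Bool.toNat_true, pow_succ, ← this, mul_comm]
    | false => rw [Bool.toNat_false, add_zero]; omega

theorem digits_le (n : ℕ) : digits n ≤ 2 * n := by
  rcases n.eq_zero_or_pos with rfl | hn
  · exact le_rfl
  · exact (Nat.lt_two_pow_self).le.trans (two_pow_digits_le hn)

/-- A counter gets longer only when it overflows. -/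
theorem length_iterate_incr (n : ℕ) (l : List Bool) (h : binValue l + n < 2 ^ (l.length + 1)) :
    (incr^[n] l).length = if binValue l + n < 2 ^ l.length then l.length else l.length + 1 := by
  induction n with
  | zero => simp [binValue_lt l]
  | succ n ih =>
    have ih := ih (by omega)
    have hall := all_iff_binValue (incr^[n] l)
    rw [binValue_iterate_incr, ih] at hall
    rw [Function.iterate_succ_apply', length_incr, ih]
    split_ifs at hall ⊢ with h1 h2 h2
    · have : (incr^[n] l).all id = false := by rw [← Bool.not_eq_true, hall]; omega
      rw [this]; rfl
    · rw [hall.2 (by omega)]; rfl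
    · omega
    · have : (incr^[n] l).all id = false := by rw [← Bool.not_eq_true, hall]; omega
      rw [this]; rfl

theorem length_overflows (n : ℕ) (l : List Bool) : (overflows n l).length = n := by
  induction n generalizing l with
  | zero => rfl
  | succ n ih => simp [overflows, ih]

theorem getElem?_overflows {n t : ℕ} (ht : t < n) (l : List Bool) :
    (overflows n l)[t]? = some ((incr^[t] l).all id) := by
  induction n generalizing l t with
  | zero => omega
  | succ n ih =>
    cases t with
    | zero => rfl
    | succ t => exact ih (by omega) _

/-- A counter that starts from a number of as many digits as `n` overflows at most once in `n`
increments. -/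
theorem getElem?_reverse_overflows {n t : ℕ} (ht : t < n) {l : List Bool}
    (hl : l.length = digits n) :
    (overflows n l).reverse[t]? = some (decide (binValue l + (n - t) = 2 ^ digits n)) := by
  have h1 := binValue_lt l
  have h2 := lt_two_pow_digits n
  rw [List.getElem?_reverse (by rwa [length_overflows]), length_overflows,
    getElem?_overflows (by omega), Option.some.injEq, Bool.eq_iff_iff, decide_eq_true_eq,
    all_iff_binValue, binValue_iterate_incr,
    length_iterate_incr _ _ (by rw [hl, pow_succ] at *; omega)]
  rw [hl] at h1 ⊢
  split_ifs
  · omega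
  · rw [pow_succ]
    omega

theorem exists_binValue {m v : ℕ} (hv : v < 2 ^ m) : ∃ l, l.length = m ∧ binValue l = v := by
  induction m generalizing v with
  | zero => exact ⟨[], rfl, by simp at hv; simp [hv]⟩
  | succ m ih =>
    obtain ⟨l, h1, h2⟩ := ih (v := v / 2) (by rw [pow_succ] at hv; omega)
    refine ⟨decide (v % 2 = 1) :: l, by simp [h1], ?_⟩
    rw [binValue_cons, h2]
    by_cases h : v % 2 = 1
    · simp [h]; omega
    · simp [h]; omega

/-- Some choice marks no step. -/
theorem exists_no_mark (n : ℕ) : ∃ l : List Bool, l.length = digits n ∧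
    ∀ m ∈ (overflows n l).reverse, m = false := by
  obtain ⟨l, h1, h2⟩ := exists_binValue (m := digits n) (v := 0) (by positivity)
  refine ⟨l, h1, fun m hm => ?_⟩
  obtain ⟨t, ht⟩ := List.getElem?_of_mem hm
  have htn : t < n := by
    have := (List.getElem?_eq_some_iff.1 ht).1
    rwa [List.length_reverse, length_overflows] at this
  rw [getElem?_reverse_overflows htn h1, Option.some.injEq] at ht
  have := lt_two_pow_digits n
  rw [← ht, decide_eq_false_iff_not]
  omega

/-- Each step is the only one that is marked for some choice. -/
theorem exists_mark {n t : ℕ} (ht : t < n) : ∃ l : List Bool, l.length = digits n ∧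
    (∀ i < t, (overflows n l).reverse[i]? = some false) ∧
    (overflows n l).reverse[t]? = some true := by
  have := lt_two_pow_digits n
  obtain ⟨l, h1, h2⟩ := exists_binValue (m := digits n) (v := 2 ^ digits n - (n - t)) (by omega)
  refine ⟨l, h1, fun i hi => ?_, ?_⟩
  · rw [getElem?_reverse_overflows (by omega) h1, Option.some.injEq, decide_eq_false_iff_not]
    omega
  · rw [getElem?_reverse_overflows ht h1, Option.some.injEq, decide_eq_true_eq]
    omega

/-! ### The computation of the verifier -/

/-- The messages after round 2, in which the first prover is told the random bits. -/
def sentRand (r : List Bool) : ℕ → ℕ → List Bool :=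
  Function.update (fun _ _ => []) 0 (Function.update (fun _ => []) 2 r)

/-- A bound on the number of steps of the verifier, the computation of the running time `T` of the
simulated verifier excepted. -/
def overhead (V : Machine) (T : ℕ) : ℕ :=
  12 * (T * (3 * Fintype.card V.K + 4)) + 19 * T + 6 * digits T + 60

/-- The whole computation, where `lr` are the random bits of the simulation, `lc` determine the
marked step, and `b :: lf` decide between payment and check. -/
theorem goes_verifier {V M : Machine} {Y : Layout} {x : List Bool} {p q : Profile} {T t : ℕ}
    (hp : Y.provers = 2) (hr : Y.rounds = 5) (h03 : Y.len 0 3 = T)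
    (h15 : 0 < Y.len 1 5) {c₁ : M.Config}
    (hM : M.runL ⟨0, 0, fun _ _ => 0⟩ x q (List.replicate t false) M.init = some c₁)
    (hh : c₁.state = M.halt) (hT : (c₁.stack M.num).length = T) {lr lc lf : List Bool} {b : Bool}
    (hlr : lr.length = T) (hlc : lc.length = digits T) (hlf : lf.length = digits T)
    {f : List Tok → Bool}
    (hf : ∀ q, (Y.message p (withQuery (sentRand lr.reverse) q) 1 5)[0]? = some (f q)) {a₀ : Bool}
    (ha₀ : (Y.message p (sentRand lr.reverse) 0 1)[0]? = some a₀) :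
    ∃ c', Goes Y x p (simulator V M).init (lr ++ (lc ++ (b :: lf))) (t + overhead V T) c' ∧
      Outcome f ((b :: lf).all id) (sentRand lr.reverse)
        ((Sim.init V).run x lr.reverse (Y.message p (sentRand lr.reverse) 0 3).reverse)
        (Sim.check x (queryToks 0 1 0 [], a₀) (Sim.init V) lr.reverse
          (Y.message p (sentRand lr.reverse) 0 3).reverse (overflows T lc.reverse).reverse)
        (T * (3 * Fintype.card V.K + 4) + 10) c' := by
  set w := Y.message p (sentRand lr.reverse) 0 3 with hw
  have hwl : w.length = T := by rw [hw, Layout.length_message, h03]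
  have hcount := lc.count_le_length (a := true)
  rw [hlc] at hcount
  let s₁ : Store V M := { Store.start V M with ctor := Function.update c₁.stack M.num [] }
  let s₂ : Store V M := { s₁ with
    counter := fun | .size => incr^[T] [] | _ => []
    unary := List.replicate T true
    rand := lr.reverse
    randCopy := lr.reverse }
  let s₃ : Store V M := { s₂ with
    counter := fun | .pick => lc.reverse | _ => []
    flag := if lf.all id then (if b then [true] else []) else [] }
  let s₄ : Store V M := { s₃ with
    randCopy := []
    unary := []
    counter := Function.update (Function.update s₃.counter .addr (incr^[w.length] []))
      .pick (incr^[w.length] lc.reverse)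
    claims := w.reverse ++ []
    marks := (overflows w.length lc.reverse).reverse ++ [] }
  have hrs : (lr.reverse).length = T := by simpa using hlr
  obtain ⟨c', hc', ho⟩ := goes_sim (V := V) (M := M) (Y := Y) (x := x) (p := p) (s := s₄)
    (an := w.getLast?.or c₁.answer) (sn := sentRand lr.reverse) hp hr h15 hf ha₀
    (flag := (b :: lf).all id)
    (by simp only [List.all_cons, id, s₄, s₃]; cases b <;> cases lf.all _ <;> rfl)
    (a := Sim.init V) (rs := lr.reverse) (ws := w.reverse)
    (ms := (overflows w.length lc.reverse).reverse)
    ⟨rfl, rfl, rfl, rfl, List.append_nil _, List.append_nil _, rfl,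
      rfl, rfl, rfl, rfl, rfl, rfl, rfl, rfl, rfl, rfl⟩
    (by rw [hrs, List.length_reverse, hwl])
    (by rw [hrs, List.length_reverse, length_overflows, hwl]) (src := some none) rfl
    (B := T * (3 * Fintype.card V.K + 4) + 10) (by simp [Sim.potential, Sim.size, Sim.init, hlr])
    le_rfl
  rw [hwl] at ho
  refine ⟨c', ?_, ho⟩
  have hpot : (Sim.init V).potential = 0 := by simp [Sim.potential, Sim.size, Sim.init]
  rw [hpot, zero_add, hrs] at hc'
  have e : Function.update (fun _ _ => []) 0 (Function.update (fun _ => []) 2 ([] ++ lr.reverse)) =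
    sentRand lr.reverse := rfl
  have hread := goes_read (an := c₁.answer) (sn := sentRand lr.reverse)
    (s := { s₃ with randCopy := [] })
    (N := 12 * (T * (3 * Fintype.card V.K + 4)) + 12 * T + 2 * digits T + 42) hp hr w rfl
    (by simp [s₃, s₂, hwl]) rfl rfl
    hc' (by simp [s₃, hwl]; omega)
  have hflag := goes_drawFlag (bs := lf ++ []) (s := { s₂ with
      counter := fun | .pick => lc.reverse | _ => []
      marks := List.replicate lc.length true }) b rfl
    (goes_genFlag (bs := []) lf (by rw [List.length_replicate, hlc, hlf]) (by cases b <;> simp)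
      (goes_sendRand hp hr (s := s₃) hread) le_rfl) le_rfl
  rw [List.append_nil] at hflag
  have hpick := goes_genPick (s := s₂) lc hlc.symm (bs := b :: lf) (by
    have e1 : Function.update (Function.update s₂.counter .size []) .pick
        (lc.reverse ++ s₂.counter .pick) = fun | .pick => lc.reverse | _ => [] := by
      funext c; cases c <;> simp [s₂]
    rw [e1]
    simpa [s₂, s₁, Store.start] using hflag) le_rfl
  have hgen := goes_gen (s := { Store.start V M with ctor := c₁.stack }) (an := c₁.answer)
    (bs := lc ++ (b :: lf)) lr rfl (hT.trans hlr.symm) (by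
      have e1 : Function.update (fun _ => []) Counter.size (incr^[T] []) =
          fun | .size => incr^[T] [] | _ => [] := by
        funext c; cases c <;> rfl
      simpa [s₂, s₁, Store.start, e1, hlr] using hpick) le_rfl
  refine (goes_init (goes_ctor (s := Store.start V M) t (c₀ := M.init) rfl hM hh hgen)).mono ?_
  simp [Store.start, hlr, hlc, hlf, overhead]
  omega

end MRIP

namespace MRIP

/-! ### The two-prover protocol -/

/-- The payment for a result of a computation. -/
noncomputable def payoff (M : Machine) : Option M.Config → ℝ
  | some c => min 1 ((binValue (c.stack M.num) : ℝ) / (binValue (c.stack M.den) : ℝ))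
  | none => 0

theorem payoff_nonneg {M : Machine} (c : Option M.Config) : 0 ≤ payoff M c := by
  cases c <;> simp only [payoff] <;> positivity

theorem payoff_le_one {M : Machine} (c : Option M.Config) : payoff M c ≤ 1 := by
  cases c <;> simp [payoff]

namespace Protocol

theorem utility_eq (P : Protocol) (x : List Bool) (s : Profile) :
    P.utility x s = avgBits (P.time x.length) fun l => payoff P.verifier
      (P.verifier.runL (P.layout x.length) x s l P.verifier.init) := by
  rw [utility, sum_bits_div (P.time x.length) (fun r => P.payment x s r)]
  refine avgBits_congr fun l hl => ?_
  rw [← Machine.run_getD, hl, payment, run]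
  cases P.verifier.run (P.layout x.length) x s (fun t => l.getD t false) (P.time x.length) <;> rfl

theorem utility_nonneg (P : Protocol) (x : List Bool) (s : Profile) : 0 ≤ P.utility x s := by
  rw [utility_eq, ← avgBits_const (P.time x.length) 0]
  exact avgBits_le fun _ _ => payoff_nonneg _

theorem utility_le_one (P : Protocol) (x : List Bool) (s : Profile) : P.utility x s ≤ 1 := by
  rw [utility_eq]
  exact (avgBits_le fun _ _ => payoff_le_one _).trans_eq (avgBits_const _ 1)

/-- A profile may be replaced by the answers that the second prover would give according to it. -/
theorem utility_profileOf_oracleOf (P : Protocol) (x : List Bool) (s : Profile) :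
    P.utility x (profileOf ((P.layout x.length).oracleOf s) (P.len x.length)) =
      P.utility x s := by
  rw [utility_eq, utility_eq]
  refine avgBits_congr fun l hl => congrArg _ ?_
  clear hl
  set Y := P.layout x.length
  have hact : ∀ (c : P.verifier.Config) (mv : Move P.verifier.K),
      P.verifier.act Y x (profileOf (Y.oracleOf s) Y.len) c mv = P.verifier.act Y x s c mv := by
    intro c mv
    cases mv <;> try rfl
    rename_i i j b
    simp only [Machine.act]
    split_ifs with h
    · rw [Y.message_profileOf_oracleOf s _ _ _ h.2.1]
    · rfl
  have hstep : ∀ (c : P.verifier.Config) (r : Bool),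
      P.verifier.step Y x (profileOf (Y.oracleOf s) Y.len) r c = P.verifier.step Y x s r c := by
    intro c r
    simp only [Machine.step, hact]
  generalize P.verifier.init = c
  induction l generalizing c with
  | nil => rfl
  | cons b l ih =>
    have ih : P.verifier.runL Y x (profileOf (Y.oracleOf s) Y.len) l =
        P.verifier.runL Y x s l := funext ih
    change (P.verifier.step Y x (profileOf (Y.oracleOf s) Y.len) b c).bind
      (P.verifier.runL Y x (profileOf (Y.oracleOf s) Y.len) l) =
      (P.verifier.step Y x s b c).bind (P.verifier.runL Y x s l)
    rw [hstep, ih]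

theorem answerBit_profileOf (P : Protocol) (x : List Bool) (f : List Tok → Bool) :
    P.answerBit x (profileOf f (P.len x.length)) = f (queryToks 0 1 0 []) := by
  have h := P.len_pos x.length
  rw [answerBit, List.takeD_eq_take _ (by simp [profileOf])]
  obtain ⟨k, hk⟩ : ∃ k, P.len x.length 0 1 = k + 1 := ⟨P.len x.length 0 1 - 1, by omega⟩
  simp [profileOf, hk, List.range_succ_eq_map, evens]

/-- The two-prover protocol for `P`, where `M` computes the running time of `P` in time `t`. The
first prover sends the answer bit in round 1 and a claimed message bit for each step of the
verifier of `P` in round 3; the second prover sends one bit in round 5. -/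
def twoProver (P : Protocol) (M : Machine) (t : ℕ → ℕ) : Protocol where
  provers _ := 2
  rounds _ := 5
  len n i j := if i = 0 ∧ j = 1 then 1 else if i = 0 ∧ j = 3 then P.time n else
    if i = 1 ∧ j = 5 then 1 else 0
  verifier := simulator P.verifier M
  time n := t n + overhead P.verifier (P.time n)
  provers_pos _ := by decide
  rounds_pos _ := by decide
  len_pos _ := by simp

end Protocol

/-- The reply of the second prover to a query. -/
def replyOf (s : Profile) (q : List Tok) : Bool :=
  ((s 1 5 [[], [], [], wire q]).takeD 1 false).headD false

/-- The message of the first prover in round 3 if he is told the random bits `r`, last bit first. -/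
def claimsOf (s : Profile) (T : ℕ) (r : List Bool) : List Bool :=
  ((s 0 3 [(s 0 1 []).takeD 1 false, r]).takeD T false).reverse

/-- The payment of the simulated verifier. -/
noncomputable def simPay (V : Machine) (x : List Bool) (r w : List Bool) : ℝ :=
  min 1 ((binValue (((Sim.init V).run x r w).stack V.num) : ℝ) /
    (binValue (((Sim.init V).run x r w).stack V.den) : ℝ))

/-- The payment in a check, where the digits `c` determine the step that is checked. -/
noncomputable def checkPay (V : Machine) (x : List Bool) (f : List Tok → Bool) (a : Bool)
    (r w c : List Bool) : ℝ :=
  let qw := Sim.check x (queryToks 0 1 0 [], a) (Sim.init V) r w (overflows r.length c).reverse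
  if qw.2 = f qw.1 then 1 else 0

section TwoProver

variable (P : Protocol) (M : Machine) (t : ℕ → ℕ)

theorem message_one (n : ℕ) (s : Profile) (r : List Bool) :
    ((P.twoProver M t).layout n).message s (sentRand r) 0 1 = (s 0 1 []).takeD 1 false := rfl

theorem message_three (n : ℕ) (s : Profile) (r : List Bool) :
    (((P.twoProver M t).layout n).message s (sentRand r) 0 3).reverse =
      claimsOf s (P.time n) r := rfl

/-- What the verifier sends to the second prover does not depend on the messages of the first
prover. -/
theorem message_five (n : ℕ) (s : Profile) (r : List Bool) (q : List Tok) :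
    (((P.twoProver M t).layout n).message s (withQuery (sentRand r) q) 1 5)[0]? =
      some (replyOf s q) := by
  have h : ((P.twoProver M t).layout n).message s (withQuery (sentRand r) q) 1 5 =
    (s 1 5 [[], [], [], wire q]).takeD 1 false := rfl
  rw [h, replyOf]
  cases s 1 5 [[], [], [], wire q] <;> rfl

variable {P M t}

/-- The computation of the verifier of the two-prover protocol: its payment and the number of
bits that are transmitted. -/
theorem twoProver_reach {x : List Bool} {q : Profile} {c : M.Config}
    (hM : M.runL ⟨0, 0, fun _ _ => 0⟩ x q (List.replicate (t x.length) false) M.init = some c)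
    (hc : c.state = M.halt) (hT : (c.stack M.num).length = P.time x.length) (s : Profile)
    {lr lc lb : List Bool} (hlr : lr.length = P.time x.length)
    (hlc : lc.length = digits (P.time x.length)) (hlb : lb.length = digits (P.time x.length) + 1) :
    ∃ c', Goes ((P.twoProver M t).layout x.length) x s (simulator P.verifier M).init
        (lr ++ (lc ++ lb)) ((P.twoProver M t).time x.length) c' ∧
      c'.state = (simulator P.verifier M).halt ∧
      payoff (simulator P.verifier M) (some c') =
        (if lb.all id then simPay P.verifier x lr.reverse (claimsOf s (P.time x.length) lr.reverse)
          else checkPay P.verifier x (replyOf s) ((P.twoProver M t).answerBit x s) lr.reverse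
            (claimsOf s (P.time x.length) lr.reverse) lc.reverse) ∧
      ((P.twoProver M t).layout x.length).totalBits s c'.sent ≤
        2 * P.time x.length + 2 +
          2 * (P.time x.length * (3 * Fintype.card P.verifier.K + 4) + 10) := by
  obtain ⟨b, lf, rfl⟩ := List.exists_cons_of_length_pos (l := lb) (by omega)
  obtain ⟨c', hc', hh, ho⟩ := goes_verifier (V := P.verifier) (M := M)
    (T := P.time x.length) (b := b) (Y := (P.twoProver M t).layout x.length) (p := s)
    rfl rfl rfl Nat.one_pos hM hc hT hlr hlc
    (by simpa using hlb) (message_five P M t x.length s lr.reverse)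
    (a₀ := (P.twoProver M t).answerBit x s) (by
      rw [message_one, Protocol.answerBit]
      change _ = some (((s 0 1 []).takeD 1 false).headD false)
      cases s 0 1 [] <;> rfl)
  rw [message_three] at ho
  have htotal : ∀ sn : ℕ → ℕ → List Bool,
      ((P.twoProver M t).layout x.length).totalBits s sn =
      2 + P.time x.length + (sn 0 2).length + (sn 0 4).length + (sn 1 2).length +
        (sn 1 4).length := by
    intro sn
    have e : ∀ i, (((P.twoProver M t).layout x.length).transcript s sn i 5).map List.length =
        [(P.twoProver M t).len x.length i 1, (sn i 2).length, (P.twoProver M t).len x.length i 3,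
          (sn i 4).length, (P.twoProver M t).len x.length i 5] := by
      intro i
      have h2 : ¬ Odd 2 := by decide
      have h3 : Odd 3 := by decide
      have h4 : ¬ Odd 4 := by decide
      have h5 : Odd 5 := by decide
      simp [Layout.transcript, h2, h3, h4, h5, Protocol.layout]
    change ∑ i ∈ Finset.range 2, ((((P.twoProver M t).layout x.length).transcript s sn i 5).map
      List.length).sum = _
    rw [Finset.sum_range_succ, Finset.sum_range_succ, Finset.sum_range_zero, e, e]
    simp [Protocol.twoProver]
    omega
  refine ⟨c', hc', hh, ?_, ?_⟩
  · cases hl : (b :: lf).all id with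
    | true =>
      rw [hl] at ho
      simp only [if_true] at ho ⊢
      rw [payoff, simPay]
      change min 1 ((binValue (c'.stack (.sim P.verifier.num)) : ℝ) /
        (binValue (c'.stack (.sim P.verifier.den)) : ℝ)) = _
      rw [ho.2.1, ho.2.2]
    | false =>
      rw [hl] at ho
      simp only [Bool.false_eq_true, if_false] at ho ⊢
      rw [payoff, checkPay]
      change min 1 ((binValue (c'.stack (.sim P.verifier.num)) : ℝ) /
        (binValue (c'.stack (.sim P.verifier.den)) : ℝ)) = _
      rw [ho.2.2.1, ho.2.2.2, List.length_reverse, hlr]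
      split_ifs <;> simp
  · rw [htotal]
    cases hl : (b :: lf).all id with
    | true =>
      rw [hl] at ho
      simp only [if_true] at ho
      rw [ho.1]
      simp [sentRand, hlr]
      omega
    | false =>
      rw [hl] at ho
      simp only [Bool.false_eq_true, if_false] at ho
      have := ho.2.1
      rw [ho.1]
      simp [sentRand, withQuery, wire, hlr]
      omega

end TwoProver

end MRIP

namespace MRIP

variable {P : Protocol} {M : Machine} {t : ℕ → ℕ}

/-- On inputs of length `n`, `M` computes the running time of `P` in time `t n`, if its random bits
are zeros. -/
def ComputesTime (P : Protocol) (M : Machine) (t : ℕ → ℕ) : Prop :=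
  ∀ x : List Bool, ∃ c : M.Config, M.runL ⟨0, 0, fun _ _ => 0⟩ x (fun _ _ _ => [])
    (List.replicate (t x.length) false) M.init = some c ∧ c.state = M.halt ∧
      (c.stack M.num).length = P.time x.length

theorem not_isDraw_halt (V M : Machine) : ¬ IsDraw V M (simulator V M).halt := by simp [IsDraw]

theorem exists_split {l : List Bool} {a b c : ℕ} (h : l.length = a + (b + c)) :
    ∃ l₁ l₂ l₃, l = l₁ ++ (l₂ ++ l₃) ∧ l₁.length = a ∧ l₂.length = b ∧ l₃.length = c :=
  ⟨l.take a, (l.drop a).take b, (l.drop a).drop b, by simp, by simp; omega, by simp; omega,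
    by simp; omega⟩

/-- The verifier halts in time, and few bits are transmitted. -/
theorem twoProver_run (hM : ComputesTime P M t) (x : List Bool) (s : Profile) (r : ℕ → Bool) :
    ∃ c', (P.twoProver M t).run x s r ((P.twoProver M t).time x.length) = some c' ∧
      c'.state = (P.twoProver M t).verifier.halt ∧
      ((P.twoProver M t).layout x.length).totalBits s c'.sent ≤
        2 * P.time x.length + 2 +
          2 * (P.time x.length * (3 * Fintype.card P.verifier.K + 4) + 10) := by
  obtain ⟨c, h1, h2, h3⟩ := hM x
  rw [Protocol.run, Machine.run_eq_runL]
  refine Machine.runL_of_reach (M := simulator P.verifier M) (not_isDraw_halt _ _)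
    (fun c' => ((P.twoProver M t).layout x.length).totalBits s c'.sent ≤ _) _
    (P.time x.length + (digits (P.time x.length) + (digits (P.time x.length) + 1))) _ ?_
  intro l hl
  obtain ⟨l₁, l₂, l₃, rfl, e1, e2, e3⟩ := exists_split hl
  obtain ⟨c', hc, hh, -, ht⟩ := twoProver_reach h1 h2 h3 s e1 e2 e3
  exact ⟨c', by rw [List.length_map, List.length_range]; exact hc, hh, ht⟩

/-- The expected payment, given the random bits of the simulation (last bit first). -/
noncomputable def value (P : Protocol) (x : List Bool) (s : Profile) (a : Bool) (r : List Bool) :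
    ℝ :=
  let w := claimsOf s (P.time x.length) r
  let d := digits (P.time x.length)
  (1 / 2) ^ (d + 1) * simPay P.verifier x r w +
    (1 - (1 / 2) ^ (d + 1)) * avgBits d fun c => checkPay P.verifier x (replyOf s) a r w c

/-- The expectation over the random bits that determine the marked step, and decide between payment
and check, for fixed random bits of the simulation. -/
theorem utility_twoProver (hM : ComputesTime P M t) (x : List Bool) (s : Profile) :
    (P.twoProver M t).utility x s =
      avgBits (P.time x.length) (value P x s ((P.twoProver M t).answerBit x s)) := by
  obtain ⟨c, h1, h2, h3⟩ := hM x
  set T := P.time x.length with hT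
  let F : List Bool → List Bool → List Bool → ℝ := fun lr lc lb =>
    if lb.all id then simPay P.verifier x lr.reverse (claimsOf s T lr.reverse)
      else checkPay P.verifier x (replyOf s) ((P.twoProver M t).answerBit x s) lr.reverse
        (claimsOf s T lr.reverse) lc.reverse
  rw [Protocol.utility_eq]
  refine (Machine.avgBits_runL (M := simulator P.verifier M) (not_isDraw_halt _ _)
    (payoff (simulator P.verifier M)) _ (T + (digits T + (digits T + 1))) _
    (fun l => F (l.take T) ((l.drop T).take (digits T)) ((l.drop T).drop (digits T))) ?_).trans ?_
  · intro l hl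
    obtain ⟨l₁, l₂, l₃, rfl, e1, e2, e3⟩ := exists_split hl
    obtain ⟨c', hc, hh, hp, -⟩ := twoProver_reach h1 h2 h3 s e1 e2 e3
    refine ⟨c', hc, hh, hp.trans ?_⟩
    simp only [F, List.take_left' e1, List.drop_left' e1, List.take_left' e2, List.drop_left' e2]
    rfl
  · rw [avgBits_add, ← avgBits_reverse T (value P x s _)]
    refine avgBits_congr fun lr hlr => ?_
    rw [avgBits_add]
    simp only [value, ← hT]
    rw [← avgBits_reverse (digits T) (fun c => checkPay P.verifier x (replyOf s) _ lr.reverse _ c),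
      add_comm (_ * simPay _ _ _ _), ← avgBits_affine]
    refine avgBits_congr fun lc hlc => ?_
    rw [add_comm (_ * checkPay _ _ _ _ _ _ _), ← avgBits_all]
    refine avgBits_congr fun lb _ => ?_
    simp only [F, List.take_left' hlr, List.drop_left' hlr, List.take_left' hlc,
      List.drop_left' hlc]

/-! ### The analysis of the two-prover protocol -/

theorem checkPay_le_one (V : Machine) (x : List Bool) (f : List Tok → Bool) (a : Bool)
    (r w c : List Bool) : checkPay V x f a r w c ≤ 1 := by
  simp only [checkPay]; split_ifs <;> norm_num

theorem simPay_le_one (V : Machine) (x r w : List Bool) : simPay V x r w ≤ 1 := min_le_left _ _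

theorem avgBits_checkPay_le_one (V : Machine) (x : List Bool) (f : List Tok → Bool) (a : Bool)
    (r w : List Bool) (n : ℕ) : avgBits n (checkPay V x f a r w) ≤ 1 :=
  (avgBits_le fun _ _ => checkPay_le_one V x f a r w _).trans_eq (avgBits_const n 1)

/-- If a claimed bit is wrong, a check of the step in which it is used finds this out. -/
theorem avgBits_checkPay_of_not_consistent {V : Machine} {x : List Bool} {f : List Tok → Bool}
    (a : Bool) {r w : List Bool} (h : ¬ Sim.Consistent f x (Sim.init V) r w) :
    avgBits (digits r.length) (checkPay V x f a r w) ≤ 1 - (1 / 2) ^ digits r.length := by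
  obtain ⟨t, ht, hms⟩ := Sim.exists_check_of_not_consistent (queryToks 0 1 0 [], a) _ _ _ h
  obtain ⟨c, hc, h0, h1⟩ := exists_mark ht
  refine avgBits_le_of_eq_zero (fun l _ => checkPay_le_one _ _ _ _ _ _ _) hc ?_
  simp only [checkPay]
  rw [if_neg (hms _ h0 h1)]

/-- If the answer bit is wrong, a check at the end of the simulation finds this out. -/
theorem avgBits_checkPay_of_ne {V : Machine} (x : List Bool) {f : List Tok → Bool} {a : Bool}
    (r w : List Bool) (h : a ≠ f (queryToks 0 1 0 [])) :
    avgBits (digits r.length) (checkPay V x f a r w) ≤ 1 - (1 / 2) ^ digits r.length := by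
  obtain ⟨c, hc, h0⟩ := exists_no_mark r.length
  refine avgBits_le_of_eq_zero (fun l _ => checkPay_le_one _ _ _ _ _ _ _) hc ?_
  simp only [checkPay]
  rw [Sim.check_of_unmarked _ _ _ _ _ _ h0, if_neg h]

theorem avgBits_checkPay_of_consistent {V : Machine} {x : List Bool} {f : List Tok → Bool}
    {r w : List Bool} (h : Sim.Consistent f x (Sim.init V) r w) (n : ℕ) :
    avgBits n (checkPay V x f (f (queryToks 0 1 0 [])) r w) = 1 := by
  rw [← avgBits_const n 1]
  refine avgBits_congr fun c _ => ?_
  simp only [checkPay]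
  exact if_pos (Sim.check_of_consistent rfl _ _ _ _ h)

/-- The strategy of the second prover as a strategy profile of the given protocol. -/
abbrev Protocol.profile (P : Protocol) (x : List Bool) (f : List Tok → Bool) : Profile :=
  profileOf f (P.len x.length)

/-- The payment of the given protocol for given random bits. -/
noncomputable def Protocol.pay (P : Protocol) (x : List Bool) (s : Profile) (r : List Bool) : ℝ :=
  payoff P.verifier (P.verifier.runL (P.layout x.length) x s r P.verifier.init)

/-- As long as no claimed bit is wrong, the simulation pays what the simulated verifier pays to
provers who follow the strategy of the second prover. -/
theorem simPay_of_consistent (hP : P.HaltsInTime) {x : List Bool} {f : List Tok → Bool}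
    {r w : List Bool} (hr : r.length = P.time x.length) (hw : w.length = r.length)
    (h : Sim.Consistent f x (Sim.init P.verifier) r w) :
    simPay P.verifier x r w = P.pay x (P.profile x f) r := by
  obtain ⟨c, hc, -⟩ := hP x (P.profile x f) (fun t => r.getD t false)
  rw [Protocol.run, ← hr, Machine.run_getD] at hc
  have hrel := (Sim.rel_init P.verifier).run hw hc h
  rw [simPay, Protocol.pay, hc, payoff, hrel.stack]

theorem length_claimsOf (s : Profile) (T : ℕ) (r : List Bool) : (claimsOf s T r).length = T := by
  simp [claimsOf]

theorem Protocol.pay_mem (P : Protocol) (x : List Bool) (s : Profile) (r : List Bool) :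
    0 ≤ P.pay x s r ∧ P.pay x s r ≤ 1 := ⟨payoff_nonneg _, payoff_le_one _⟩

/-- The weight of the payment of the simulated verifier is so small that a failed check costs more
than this payment may gain. -/
theorem value_le (hP : P.HaltsInTime) {x : List Bool} (s : Profile) (a : Bool) {r : List Bool}
    (hr : r.length = P.time x.length) :
    value P x s a r ≤ (1 / 2) ^ (digits (P.time x.length) + 1) * P.pay x (P.profile x (replyOf s)) r
      + (1 - (1 / 2) ^ (digits (P.time x.length) + 1)) := by
  simp only [value]
  have hw := length_claimsOf s (P.time x.length) r
  set w := claimsOf s (P.time x.length) r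
  set d := digits (P.time x.length) with hd
  have hδ : (0 : ℝ) < (1 / 2) ^ d := by positivity
  have hδ' : (1 / 2 : ℝ) ^ d ≤ 1 := pow_le_one₀ (by norm_num) (by norm_num)
  obtain ⟨h0, h1⟩ := P.pay_mem x (P.profile x (replyOf s)) r
  rw [pow_succ]
  by_cases h : Sim.Consistent (replyOf s) x (Sim.init P.verifier) r w
  · rw [simPay_of_consistent hP hr (hw.trans hr.symm) h]
    have := avgBits_checkPay_le_one P.verifier x (replyOf s) a r w d
    nlinarith
  · have h2 := avgBits_checkPay_of_not_consistent a h
    rw [hr, ← hd] at h2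
    have h3 := simPay_le_one P.verifier x r w
    nlinarith

/-- An answer bit that the second prover does not confirm costs more than the payment of the
simulated verifier may gain. -/
theorem value_le_of_ne {x : List Bool} (hT : 1 ≤ P.time x.length)
    {s : Profile} {a : Bool} (ha : a ≠ replyOf s (queryToks 0 1 0 [])) {r : List Bool}
    (hr : r.length = P.time x.length) :
    value P x s a r ≤ 1 - (1 / 2) ^ (digits (P.time x.length) + 1)
      - (1 / 2) ^ digits (P.time x.length) / 4 := by
  simp only [value]
  set w := claimsOf s (P.time x.length) r
  have h2 := avgBits_checkPay_of_ne (V := P.verifier) x r w ha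
  rw [hr] at h2
  have hd : 1 ≤ digits (P.time x.length) := by
    have := lt_two_pow_digits (P.time x.length)
    by_contra h
    rw [show digits (P.time x.length) = 0 by omega] at this
    omega
  set d := digits (P.time x.length)
  have hδ : (0 : ℝ) < (1 / 2) ^ d := by positivity
  have hδ' : (1 / 2 : ℝ) ^ d ≤ 1 / 2 := by
    calc (1 / 2 : ℝ) ^ d ≤ (1 / 2) ^ 1 := pow_le_pow_of_le_one (by norm_num) (by norm_num) hd
      _ = 1 / 2 := pow_one _
  have h3 := simPay_le_one P.verifier x r w
  rw [pow_succ]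
  nlinarith

/-- Truthful claims are never caught, and the simulated verifier pays its usual payment. -/
theorem value_of_honest (hP : P.HaltsInTime) {x : List Bool} {s : Profile} {r : List Bool}
    (hr : r.length = P.time x.length)
    (h : claimsOf s (P.time x.length) r =
      Sim.honest (replyOf s) x (Sim.init P.verifier) r) :
    value P x s (replyOf s (queryToks 0 1 0 [])) r =
      (1 / 2) ^ (digits (P.time x.length) + 1) * P.pay x (P.profile x (replyOf s)) r
      + (1 - (1 / 2) ^ (digits (P.time x.length) + 1)) := by
  simp only [value, h]
  have hc := Sim.consistent_honest (replyOf s) x (Sim.init P.verifier) r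
  rw [simPay_of_consistent hP hr (Sim.length_honest _ _ _ _) hc]
  have := avgBits_checkPay_of_consistent hc (digits (P.time x.length))
  rw [show (fun c => checkPay P.verifier x (replyOf s) (replyOf s (queryToks 0 1 0 [])) r
    (Sim.honest (replyOf s) x (Sim.init P.verifier) r) c) = checkPay P.verifier x (replyOf s)
    (replyOf s (queryToks 0 1 0 [])) r (Sim.honest (replyOf s) x (Sim.init P.verifier) r) from rfl,
    this, mul_one]

open Classical in
/-- The profile in which the second prover follows `f` and the first prover tells the truth about
what the second prover would answer. -/
noncomputable def honestProfile (V : Machine) (x : List Bool) (f : List Tok → Bool) : Profile :=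
  fun _ j tr =>
    if j = 1 then [f (queryToks 0 1 0 [])]
    else if j = 3 then (Sim.honest f x (Sim.init V) (tr.getD 1 [])).reverse
    else [decide (∃ q, wire q = tr.getD 3 [] ∧ f q = true)]

theorem replyOf_honestProfile (V : Machine) (x : List Bool) (f : List Tok → Bool) :
    replyOf (honestProfile V x f) = f := by
  funext q
  have : ∀ q', wire q' = wire q ↔ q' = q := fun q' => wire_injective.eq_iff
  simp [replyOf, honestProfile, this]

theorem claimsOf_honestProfile (V : Machine) (x : List Bool) (f : List Tok → Bool) {T : ℕ}
    {r : List Bool} (hr : r.length = T) :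
    claimsOf (honestProfile V x f) T r = Sim.honest f x (Sim.init V) r := by
  have h : honestProfile V x f 0 3 [(honestProfile V x f 0 1 []).takeD 1 false, r] =
    (Sim.honest f x (Sim.init V) r).reverse := rfl
  rw [claimsOf, h, List.takeD_eq_take _ (by simp [Sim.length_honest, hr]),
    List.take_of_length_le (by simp [Sim.length_honest, hr]), List.reverse_reverse]

/-- The utility of a profile of the two-prover protocol is bounded in terms of the utility in the
given protocol of the strategy of the second prover. -/
theorem utility_twoProver_le (hP : P.HaltsInTime) (hM : ComputesTime P M t) (x : List Bool)
    (s : Profile) : (P.twoProver M t).utility x s ≤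
      (1 / 2) ^ (digits (P.time x.length) + 1) * P.utility x (P.profile x (replyOf s))
      + (1 - (1 / 2) ^ (digits (P.time x.length) + 1)) := by
  rw [utility_twoProver hM, Protocol.utility_eq, ← avgBits_affine]
  exact avgBits_le fun r hr => value_le hP s _ hr

theorem utility_twoProver_le_of_ne (hM : ComputesTime P M t) {x : List Bool}
    (hT : 1 ≤ P.time x.length) {s : Profile}
    (ha : (P.twoProver M t).answerBit x s ≠ replyOf s (queryToks 0 1 0 [])) :
    (P.twoProver M t).utility x s ≤ 1 - (1 / 2) ^ (digits (P.time x.length) + 1)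
      - (1 / 2) ^ digits (P.time x.length) / 4 := by
  rw [utility_twoProver hM, ← avgBits_const (P.time x.length) (_ - _)]
  exact avgBits_le fun r hr => value_le_of_ne hT ha hr

/-- The bound in `utility_twoProver_le` is attained when the first prover is truthful. -/
theorem utility_honestProfile (hP : P.HaltsInTime) (hM : ComputesTime P M t) (x : List Bool)
    (f : List Tok → Bool) : (P.twoProver M t).utility x (honestProfile P.verifier x f) =
      (1 / 2) ^ (digits (P.time x.length) + 1) * P.utility x (P.profile x f)
      + (1 - (1 / 2) ^ (digits (P.time x.length) + 1)) := by
  rw [utility_twoProver hM, Protocol.utility_eq P, ← avgBits_affine]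
  refine avgBits_congr fun r hr => ?_
  have ha : (P.twoProver M t).answerBit x (honestProfile P.verifier x f) =
      replyOf (honestProfile P.verifier x f) (queryToks 0 1 0 []) := by
    rw [replyOf_honestProfile]
    rfl
  rw [ha, value_of_honest hP hr (by rw [claimsOf_honestProfile _ _ _ hr, replyOf_honestProfile]),
    replyOf_honestProfile, Protocol.pay]

end MRIP

namespace MRIP

variable {P : Protocol} {M : Machine} {t : ℕ → ℕ} {L : Language Bool}

/-- A verifier that does no step pays nothing, so that the answer bit would be arbitrary. -/
theorem Protocol.IsMRIP.time_pos (hL : P.IsMRIP L) (n : ℕ) : 1 ≤ P.time n := by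
  by_contra h
  have h0 : P.time (List.replicate n false).length = 0 := by rw [List.length_replicate]; omega
  have hopt : ∀ s, P.IsOptimal (List.replicate n false) s := by
    intro s s'
    rw [utility_eq, utility_eq, h0]
    exact le_rfl
  have hb : ∀ b, P.answerBit (List.replicate n false)
      (P.profile (List.replicate n false) fun _ => b) = b := fun b =>
    P.answerBit_profileOf _ _
  have h1 := hL.correct _ _ (hopt (P.profile (List.replicate n false) fun _ => true))
  have h2 := hL.correct _ _ (hopt (P.profile (List.replicate n false) fun _ => false))
  rw [hb] at h1 h2
  simp only [true_iff] at h1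
  simp [h1] at h2

/-- Every profile of the given protocol can be imitated by the two provers. -/
theorem le_utility_of_isOptimal (hP : P.HaltsInTime) (hM : ComputesTime P M t) {x : List Bool}
    {s : Profile} (hs : (P.twoProver M t).IsOptimal x s) (s₀ : Profile) :
    (1 / 2) ^ (digits (P.time x.length) + 1) * P.utility x s₀
      + (1 - (1 / 2) ^ (digits (P.time x.length) + 1)) ≤ (P.twoProver M t).utility x s := by
  have h := hs (honestProfile P.verifier x ((P.layout x.length).oracleOf s₀))
  rwa [utility_honestProfile hP hM, Protocol.profile, P.utility_profileOf_oracleOf] at h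

/-- In an optimal profile the second prover confirms the answer bit, and his strategy is an optimal
profile of the given protocol. -/
theorem twoProver_optimal (hL : P.IsMRIP L) (hM : ComputesTime P M t) {x : List Bool}
    {s : Profile} (hs : (P.twoProver M t).IsOptimal x s) :
    (P.twoProver M t).answerBit x s = replyOf s (queryToks 0 1 0 []) ∧
      P.IsOptimal x (P.profile x (replyOf s)) := by
  have hδ : (0 : ℝ) < (1 / 2) ^ digits (P.time x.length) := by positivity
  have hδ' : (0 : ℝ) < (1 / 2) ^ (digits (P.time x.length) + 1) := by positivity
  constructor
  · by_contra h
    have h1 := utility_twoProver_le_of_ne hM (hL.time_pos _) h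
    have h2 := le_utility_of_isOptimal hL.halts hM hs s
    have h3 := mul_nonneg hδ'.le (P.utility_nonneg x s)
    linarith
  · intro s₀
    have h1 := utility_twoProver_le hL.halts hM x s
    have h2 := le_utility_of_isOptimal hL.halts hM hs s₀
    exact le_of_mul_le_mul_left (by linarith) hδ'

theorem twoProver_isMRIP (hL : P.IsMRIP L) (hM : ComputesTime P M t) :
    (P.twoProver M t).IsMRIP L where
  halts x s r := by
    obtain ⟨c, h1, h2, -⟩ := twoProver_run hM x s r
    exact ⟨c, h1, h2⟩
  exists_optimal x := by
    obtain ⟨s₀, hs₀⟩ := hL.exists_optimal x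
    refine ⟨honestProfile P.verifier x ((P.layout x.length).oracleOf s₀), fun s => ?_⟩
    rw [utility_honestProfile hL.halts hM, Protocol.profile, P.utility_profileOf_oracleOf]
    refine (utility_twoProver_le hL.halts hM x s).trans ?_
    have := hs₀ (P.profile x (replyOf s))
    gcongr
  correct x s hs := by
    obtain ⟨h1, h2⟩ := twoProver_optimal hL hM hs
    rw [h1, ← hL.correct x _ h2, P.answerBit_profileOf]

/-- The utility gap of the given protocol is at most `1`. -/
theorem one_lt_of_hasUtilityGap (hL : P.IsMRIP L) {γ : ℕ → ℝ} (hγ : P.HasUtilityGap γ)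
    (x : List Bool) : 1 < γ x.length := by
  obtain ⟨s₀, hs₀⟩ := hL.exists_optimal x
  have hs' : P.answerBit x (P.profile x fun _ => !P.answerBit x s₀) ≠ P.answerBit x s₀ := by
    rw [P.answerBit_profileOf]
    simp
  have h := hγ x s₀ _ hs₀ hs'
  have h0 := hs₀ (P.profile x fun _ => !P.answerBit x s₀)
  have h1 := P.utility_le_one x s₀
  have h2 := P.utility_nonneg x (P.profile x fun _ => !P.answerBit x s₀)
  by_contra hle
  nlinarith

/-- A wrong answer bit is either not confirmed by the second prover, which costs a fraction of the
order `1 / T` of a payment, or the strategy of the second prover loses the utility gap of the given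
protocol, scaled by the probability of the payment of the simulated verifier. -/
theorem twoProver_gap (hL : P.IsMRIP L) (hM : ComputesTime P M t) {γ : ℕ → ℝ}
    (hγ : P.HasUtilityGap γ) {x : List Bool} {s s' : Profile}
    (hs : (P.twoProver M t).IsOptimal x s)
    (hs' : (P.twoProver M t).answerBit x s' ≠ (P.twoProver M t).answerBit x s) :
    1 < 8 * P.time x.length * γ x.length *
      ((P.twoProver M t).utility x s - (P.twoProver M t).utility x s') := by
  obtain ⟨h1, h2⟩ := twoProver_optimal hL hM hs
  have hγ1 := one_lt_of_hasUtilityGap hL hγ x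
  have hT := hL.time_pos x.length
  -- The probabilities are powers of two of the order of the reciprocal of the running time.
  have hδ : 1 ≤ 2 * (P.time x.length : ℝ) * (1 / 2) ^ digits (P.time x.length) := by
    have h3 : (2 : ℝ) ^ digits (P.time x.length) ≤ 2 * P.time x.length := by
      exact_mod_cast two_pow_digits_le hT
    rw [one_div, inv_pow, ← div_eq_mul_inv, one_le_div (by positivity)]
    exact h3
  have hle := le_utility_of_isOptimal hL.halts hM hs (P.profile x (replyOf s))
  have hd : (0 : ℝ) < (1 / 2) ^ digits (P.time x.length) := by positivity
  have hT' : (1 : ℝ) ≤ P.time x.length := by exact_mod_cast hT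
  rw [pow_succ] at hle
  set δ : ℝ := (1 / 2) ^ digits (P.time x.length)
  by_cases ha : (P.twoProver M t).answerBit x s' = replyOf s' (queryToks 0 1 0 [])
  · have hne : P.answerBit x (P.profile x (replyOf s')) ≠
        P.answerBit x (P.profile x (replyOf s)) := by
      rwa [P.answerBit_profileOf, P.answerBit_profileOf, ← ha, ← h1]
    have hgap := hγ x _ _ h2 hne
    have hle' := utility_twoProver_le hL.halts hM x s'
    rw [pow_succ] at hle'
    set u := P.utility x (P.profile x (replyOf s))
    set u' := P.utility x (P.profile x (replyOf s'))
    calc (1 : ℝ) < γ x.length * (u - u') := hgap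
      _ ≤ (4 * P.time x.length * δ) * (γ x.length * (u - u')) := by
        refine le_mul_of_one_le_left (by linarith) (by linarith)
      _ = 8 * P.time x.length * γ x.length * (δ * (1 / 2) * (u - u')) := by ring
      _ ≤ _ := by
        refine mul_le_mul_of_nonneg_left (by linarith) (by positivity)
  · have hle' := utility_twoProver_le_of_ne hM hT ha
    have hu := P.utility_nonneg x (P.profile x (replyOf s))
    rw [pow_succ] at hle'
    calc (1 : ℝ) < γ x.length := hγ1
      _ ≤ (2 * P.time x.length * δ) * γ x.length :=
        le_mul_of_one_le_left (by linarith) hδ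
      _ = 8 * P.time x.length * γ x.length * (δ / 4) := by ring
      _ ≤ _ := by
        have := mul_nonneg hd.le hu
        refine mul_le_mul_of_nonneg_left (by linarith) (by positivity)

end MRIP

theorem mainTheorem4 (L : Language Bool) (P : Protocol) (p k T C : ℕ → ℕ)
    (hL : P.IsMRIP L)
    (hp : ∀ n, P.provers n = p n) (hk : ∀ n, P.rounds n = k n)
    (hT : ∀ n, P.time n = T n) (hC : P.CommunicationAtMost C)
    (hconstr : ComputableInTime T (fun n => T n + Nat.log 2 (C n))) :
    ∃ P' : Protocol, P'.IsMRIP L ∧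
      (∀ n, P'.provers n = 2) ∧ (∀ n, P'.rounds n = 5) ∧
      (∀ n, P'.len n 1 1 = 0 ∧ P'.len n 1 3 = 0 ∧ P'.len n 1 5 = 1) ∧
      ∃ A : ℕ,
        (∀ n, P'.time n ≤ A * (T n + Nat.log 2 (C n))) ∧
        P'.CommunicationAtMost (fun n => A * (T n + Nat.log 2 (C n))) ∧
        ∀ γ : ℕ → ℝ, P.HasUtilityGap γ →
          P'.HasUtilityGap (fun n => A * (T n + C n : ℝ) ^ A * γ n) := by
  obtain ⟨M, a, hMa⟩ := hconstr
  obtain rfl : P.time = T := funext hT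
  set t : ℕ → ℕ := fun n => a * (P.time n + Nat.log 2 (C n)) with ht
  have hM : ComputesTime P M t := by
    intro x
    obtain ⟨c, h1, h2, h3⟩ := hMa x fun _ => false
    rw [Machine.run_eq_runL] at h1
    exact ⟨c, by simpa [List.map_const'] using h1, h2, h3⟩
  have hpos := hL.time_pos
  set κ := Fintype.card P.verifier.K with hκ
  refine ⟨P.twoProver M t, twoProver_isMRIP hL hM, fun _ => rfl, fun _ => rfl,
    -- The constant covers the multiples of the running time in `overhead` and in `twoProver_run`,
    -- and the factor `8` in `twoProver_gap`.
    fun _ => ⟨rfl, rfl, rfl⟩, a + 36 * κ + 200, fun n => ?_, fun x s r c hc => ?_,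
    fun γ hγ x s s' hs hs' => ?_⟩
  · have h1 := digits_le (P.time n)
    have h2 := hpos n
    have h3 : overhead P.verifier (P.time n) ≤ (36 * κ + 200) * P.time n := by
      unfold overhead
      rw [← hκ]
      nlinarith
    calc t n + overhead P.verifier (P.time n)
        ≤ a * (P.time n + Nat.log 2 (C n)) + (36 * κ + 200) * (P.time n + Nat.log 2 (C n)) :=
          Nat.add_le_add le_rfl (h3.trans (Nat.mul_le_mul le_rfl (Nat.le_add_right _ _)))
      _ = _ := by ring
  · obtain ⟨c', h1, -, h2⟩ := twoProver_run hM x s r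
    rw [h1, Option.mem_some_iff] at hc
    subst hc
    refine h2.trans ?_
    have h3 := hpos x.length
    rw [← hκ]
    calc _ ≤ (36 * κ + 200) * P.time x.length := by nlinarith
      _ ≤ _ := Nat.mul_le_mul (by omega) (Nat.le_add_right _ _)
  · have hgap := twoProver_gap hL hM hγ hs hs'
    have hγ1 := one_lt_of_hasUtilityGap hL hγ x
    refine hgap.trans_le ?_
    have hd : 0 ≤ (P.twoProver M t).utility x s - (P.twoProver M t).utility x s' :=
      sub_nonneg.2 (hs s')
    have h3 : (1 : ℝ) ≤ P.time x.length := by exact_mod_cast hpos x.length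
    have h4 : (P.time x.length : ℝ) ≤ (P.time x.length + C x.length) ^ (a + 36 * κ + 200) := by
      calc (P.time x.length : ℝ) ≤ P.time x.length + C x.length := by simp
        _ ≤ _ := le_self_pow₀ (by have : (0 : ℝ) ≤ C x.length := by positivity
                                  linarith) (by omega)
    have h5 : (8 : ℝ) ≤ (a + 36 * κ + 200 : ℕ) := by exact_mod_cast (by omega)
    beta_reduce
    gcongr
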